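/- **Setting.** Let $N,M,R\ge 1$, let $A=A_1A_2\in\mathbb C^{N\times M}$ with $A_1=\sum_{j=1}^R\|u_j\|\,|u_j\rangle\langle j|\in\mathbb C^{N\times R}$ (of arbitrary, possibly low, rank) and $A_2=\sum_{j=1}^R\|v_j\|\,|j\rangle\langle v_j|\in\mathbb C^{R\times M}$ with $\operatorname{rank}(A_2)=R$, and let $b=\|b\|\,|b\rangle\in\mathbb C^N$ with $\|b\|>0$. The norms $\|u_j\|,\|v_j\|\ge 0$ and $\|b\|$ are given classically. The unit vectors $|u_j\rangle,|b\rangle\in\mathbb C^N$ and $|v_j\rangle\in\mathbb C^M$ are given by quantum circuits of one- and two-qubit gates that prepare them from $|0\cdots0\rangle$ on $\lceil\log_2N\rceil$, respectively $\lceil\log_2M\rceil$, qubits (vectors are padded with zeros), of depth at most $D(\log N)$, respectively $D(\log M)$, where $D$ is a fixed polynomial. Let $\Gamma=\max_{1\le j\le R}\{\|u_j\|^2,\|u_j\|\,\|b\|,\|v_j\|^2\}$, let $\|B\|$ be the largest and $\sigma_{\min}(B)$ the smallest nonzero singular value of a matrix $B$, and let $\kappa(B)=\|B\|/\sigma_{\min}(B)$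 (with $\sigma_{\min}(0)=\kappa(0)=0$). A *hybrid algorithm* is a single program for all instances. It receives $R,N,M$, the norms above, $\|A_1\|,\sigma_{\min}(A_1),\|A_2\|,\sigma_{\min}(A_2)$, the accuracy $\varepsilon$ and a confidence parameter $k\in\mathbb N$, $k\ge1$. It performs classical operations (exact arithmetic on complex numbers, comparisons, loops) at unit cost, except that rounding up to a natural number $m$ costs $m+O(1)$, and it accesses the vectors only by runs of the Hadamard tests for $\langle u_i|u_j\rangle$, $\langle u_i|b\rangle$, $\langle v_i|v_j\rangle$; each run returns one measured bit, distributed according to the Born rule, and costs the number of gates of its circuit (gates on the ancilla, and the gates of the given circuits or their inverses controlled by the ancilla), up to an additive constant. **Theorem.** There is a hybrid algorithm such that for every constant $c>0$ and every polynomial $D$ there is a polynomial $p$ in five variables with the following property. For every instance as above with $\max\{\Gamma,\|A_2\|\}\ge c$, every $0<\varepsilon\le 1/c$ and every $k\ge1$, the algorithm always stops within time $$k\cdot\frac{R^3\,\Gamma^2\;p\big(\kappa(A_1),\kappa(A_2),\log M,\log N,\|b\|\big)}{\varepsilon^4},$$ and with probability at least $1-2^{-k}$ it outputs a classical vector $s=(s_1,\dots,s_R)\in\mathbb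 C^R$ such that $\hat x=\sum_{j=1}^R s_j|v_j\rangle$ satisfies $$\|A\hat x-b\|-\min_{x\in\mathbb C^M}\|Ax-b\|\le\varepsilon .$$ -/

import Mathlib

open scoped Matrix

noncomputable section

namespace Hybrid

/-! ### Quantum circuits -/

/-- Computational basis states of `n` qubits. -/
abbrev Bits (n : ℕ) : Type := Fin n → Bool

/-- A one- or two-qubit gate on `n` qubits. -/
inductive Gate (n : ℕ) : Type where
  | one (q : Fin n) (U : Matrix.unitaryGroup Bool ℂ)
  | two (p q : Fin n) (hpq : p ≠ q) (U : Matrix.unitaryGroup (Bool × Bool) ℂ)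

namespace Gate

variable {n : ℕ}

/-- The qubits a gate acts on. -/
def wires : Gate n → Finset (Fin n)
  | one q _ => {q}
  | two p q _ _ => {p, q}

/-- The action of a gate on a vector of amplitudes. -/
def apply : Gate n → (Bits n → ℂ) → (Bits n → ℂ)
  | one q U, ψ => fun x => ∑ a : Bool, U.1 (x q) a * ψ (Function.update x q a)
  | two p q _ U, ψ => fun x => ∑ a : Bool × Bool,
      U.1 (x p, x q) a * ψ (Function.update (Function.update x p a.1) q a.2)

/-- The inverse gate. -/
def inv : Gate n → Gate n
  | one q U => one q U⁻¹
  | two p q h U => two p q h U⁻¹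

end Gate

/-- One layer of a circuit: gates acting on pairwise disjoint sets of qubits. -/
def Layer (n : ℕ) : Type :=
  {l : List (Gate n) // l.Pairwise fun g h => Disjoint g.wires h.wires}

/-- A circuit is a list of layers, applied from the first to the last. -/
abbrev Circuit (n : ℕ) : Type := List (Layer n)

/-- The amplitudes of `|0…0⟩`. -/
def ketZero (n : ℕ) : Bits n → ℂ := fun x => if x = fun _ => false then 1 else 0

namespace Circuit

variable {n : ℕ}

/-- The depth of a circuit is the number of its layers. -/
def depth (C : Circuit n) : ℕ := List.length C

/-- All gates of a circuit, in the order in which they are applied. -/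
def gates (C : Circuit n) : List (Gate n) := List.flatMap (fun l : Layer n => l.1) C

/-- The gates of the inverse circuit, in the order in which they are applied. -/
def invGates (C : Circuit n) : List (Gate n) := C.gates.reverse.map Gate.inv

/-- The state `U|0…0⟩` prepared by the circuit of `U`. -/
def state (C : Circuit n) : Bits n → ℂ := C.gates.foldl (fun ψ g => g.apply ψ) (ketZero n)

end Circuit

/-- The basis state of `n` qubits that encodes the number `i` in binary. -/
def encode (n i : ℕ) : Bits n := fun q => i.testBit q

/-- The vector of `ℂᴺ` whose coordinates are the first `N` amplitudes of the state that the circuit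
prepares on `⌈log₂ N⌉` qubits. -/
def ketOf (N : ℕ) (C : Circuit (Nat.clog 2 N)) : Fin N → ℂ := fun i => C.state (encode _ i)

/-- The prepared state is a vector of `ℂᴺ`: the amplitudes beyond the first `N` vanish. This is
automatic when `N` is a power of two. -/
def PreparesIn (N : ℕ) (C : Circuit (Nat.clog 2 N)) : Prop :=
  ∀ x, (∀ i : Fin N, encode _ i ≠ x) → C.state x = 0

/-! ### The Hadamard test -/

/-- The Hadamard gate. -/
def hadamard : Matrix.unitaryGroup Bool ℂ :=
  ⟨Matrix.of fun a b => if a && b then -((√2 : ℝ) : ℂ)⁻¹ else ((√2 : ℝ) : ℂ)⁻¹, by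
    have h : ((√2 : ℝ) : ℂ)⁻¹ * ((√2 : ℝ) : ℂ)⁻¹ = 1 / 2 := by
      rw [← mul_inv, ← Complex.ofReal_mul, Real.mul_self_sqrt (by norm_num)]
      norm_num
    rw [Matrix.mem_unitaryGroup_iff]
    ext a b
    cases a <;> cases b <;>
      simp [Matrix.mul_apply, Matrix.star_apply, Complex.conj_ofReal, h] <;> norm_num⟩

/-- The phase gate. -/
def phase : Matrix.unitaryGroup Bool ℂ :=
  ⟨Matrix.diagonal fun a => if a then Complex.I else 1, by
    rw [Matrix.mem_unitaryGroup_iff]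
    ext a b
    cases a <;> cases b <;>
      simp [Matrix.mul_apply, Matrix.star_apply, Matrix.diagonal]⟩

/-- An elementary operation on one ancilla qubit and `n` further qubits: a gate on the ancilla, or a
gate on the other qubits controlled by the ancilla. -/
inductive TestGate (n : ℕ) : Type where
  | ancilla (U : Matrix.unitaryGroup Bool ℂ)
  | controlled (g : Gate n)

/-- The action of an elementary operation on amplitudes. -/
def TestGate.apply {n : ℕ} : TestGate n → (Bool × Bits n → ℂ) → (Bool × Bits n → ℂ)
  | .ancilla U, ψ => fun z => ∑ a : Bool, U.1 z.1 a * ψ (a, z.2)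
  | .controlled g, ψ => fun z => if z.1 then g.apply (fun x => ψ (true, x)) z.2 else ψ z

/-- The circuit of the Hadamard test of `{|0…0⟩, V†U}`, where `C` is the circuit of `U` and `C'` that
of `V`: a Hadamard gate on the ancilla, the controlled `V†U`, possibly a phase gate on the ancilla,
and another Hadamard gate on the ancilla. -/
def testGates {n : ℕ} (ph : Bool) (C' C : Circuit n) : List (TestGate n) :=
  .ancilla hadamard :: (C.gates ++ C'.invGates).map .controlled ++
    (if ph then [.ancilla phase] else []) ++ [.ancilla hadamard]

/-- The state at the end of the Hadamard test, started from `|0⟩|0…0⟩`. -/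
def testState {n : ℕ} (ph : Bool) (C' C : Circuit n) : Bool × Bits n → ℂ :=
  (testGates ph C' C).foldl (fun ψ g => g.apply ψ)
    fun z => if z.1 then 0 else ketZero n z.2

/-! Gates preserve the norm of the amplitudes, so that measurement probabilities add up to one. -/

theorem sum_normSq_unitary {ι : Type*} [Fintype ι] [DecidableEq ι] (U : Matrix.unitaryGroup ι ℂ)
    (v : ι → ℂ) : ∑ a, ‖∑ b, U.1 a b * v b‖ ^ 2 = ∑ a, ‖v a‖ ^ 2 := by
  have key : ∀ w : ι → ℂ, ((∑ a, ‖w a‖ ^ 2 : ℝ) : ℂ) = star w ⬝ᵥ w := by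
    intro w
    simp only [dotProduct, Pi.star_apply, Complex.ofReal_sum, Complex.ofReal_pow]
    exact Finset.sum_congr rfl fun a _ => (Complex.conj_mul' (w a)).symm
  have h : ((∑ a, ‖(U.1 *ᵥ v) a‖ ^ 2 : ℝ) : ℂ) = ((∑ a, ‖v a‖ ^ 2 : ℝ) : ℂ) := by
    rw [key, key, Matrix.star_mulVec, ← Matrix.dotProduct_mulVec, Matrix.mulVec_mulVec,
      ← Matrix.star_eq_conjTranspose, Matrix.mem_unitaryGroup_iff'.1 U.2, Matrix.one_mulVec]
  exact_mod_cast h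

/-- The bits of two distinct wires and the remaining bits. -/
def splitTwo {n : ℕ} (p q : Fin n) (hpq : p ≠ q) :
    Bits n ≃ (Bool × Bool) × ({j : Fin n // j ≠ p ∧ j ≠ q} → Bool) where
  toFun x := ((x p, x q), fun j => x j)
  invFun z := fun j => if h : j ≠ p ∧ j ≠ q then z.2 ⟨j, h⟩ else if j = p then z.1.1 else z.1.2
  left_inv x := by
    funext j
    by_cases hp : j = p
    · simp [hp]
    · by_cases hq : j = q
      · subst hq
        simp [hp]
      · simp [hp, hq]
  right_inv z := by
    refine Prod.ext (Prod.ext ?_ ?_) ?_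
    · simp
    · simp [hpq.symm]
    · funext j
      simp [j.2.1, j.2.2]

theorem Gate.sum_apply {n : ℕ} (g : Gate n) (ψ : Bits n → ℂ) :
    ∑ x, ‖g.apply ψ x‖ ^ 2 = ∑ x, ‖ψ x‖ ^ 2 := by
  cases g with
  | one q U =>
    rw [← (Equiv.funSplitAt q Bool).symm.sum_comp fun x => ‖Gate.apply _ ψ x‖ ^ 2,
      ← (Equiv.funSplitAt q Bool).symm.sum_comp fun x => ‖ψ x‖ ^ 2,
      Fintype.sum_prod_type_right, Fintype.sum_prod_type_right]
    refine Finset.sum_congr rfl fun r _ => ?_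
    refine Eq.trans ?_ (sum_normSq_unitary U _)
    refine Finset.sum_congr rfl fun a _ => ?_
    simp only [Gate.apply]
    congr 2
    refine Finset.sum_congr rfl fun b _ => ?_
    congr 2
    · simp [Equiv.funSplitAt]
    · funext j
      by_cases h : j = q
      · subst h
        simp [Equiv.funSplitAt]
      · simp [Equiv.funSplitAt, h]
  | two p q hpq U =>
    rw [← (splitTwo p q hpq).symm.sum_comp fun x => ‖Gate.apply _ ψ x‖ ^ 2,
      ← (splitTwo p q hpq).symm.sum_comp fun x => ‖ψ x‖ ^ 2,
      Fintype.sum_prod_type_right, Fintype.sum_prod_type_right]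
    refine Finset.sum_congr rfl fun r _ => ?_
    refine Eq.trans ?_ (sum_normSq_unitary U _)
    refine Finset.sum_congr rfl fun a _ => ?_
    simp only [Gate.apply]
    congr 2
    refine Finset.sum_congr rfl fun b _ => ?_
    congr 2
    · simp [splitTwo, hpq.symm]
    · funext j
      by_cases hp : j = p
      · subst hp
        simp [splitTwo, Function.update_of_ne hpq]
      · by_cases hq : j = q
        · subst hq
          simp [splitTwo, hp]
        · simp [splitTwo, hp, hq]

theorem TestGate.sum_apply {n : ℕ} (g : TestGate n) (ψ : Bool × Bits n → ℂ) :
    ∑ z, ‖g.apply ψ z‖ ^ 2 = ∑ z, ‖ψ z‖ ^ 2 := by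
  cases g with
  | ancilla U =>
    rw [Fintype.sum_prod_type_right, Fintype.sum_prod_type_right]
    exact Finset.sum_congr rfl fun x _ => sum_normSq_unitary U fun a => ψ (a, x)
  | controlled g =>
    rw [Fintype.sum_prod_type, Fintype.sum_prod_type]
    simp [TestGate.apply, g.sum_apply]

theorem sum_testState {n : ℕ} (ph : Bool) (C' C : Circuit n) :
    ∑ z, ‖testState ph C' C z‖ ^ 2 = 1 := by
  have h : ∀ (l : List (TestGate n)) (ψ : Bool × Bits n → ℂ),
      ∑ z, ‖l.foldl (fun ψ g => g.apply ψ) ψ z‖ ^ 2 = ∑ z, ‖ψ z‖ ^ 2 := by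
    intro l
    induction l with
    | nil => intro ψ; rfl
    | cons g l ih => intro ψ; rw [List.foldl_cons, ih, g.sum_apply]
  rw [testState, h, Fintype.sum_prod_type]
  simp [ketZero, apply_ite]

/-- One run of the Hadamard test: the ancilla is measured in the computational basis and the outcome
is obtained with the probability given by the Born rule. -/
def measureTest {n : ℕ} (ph : Bool) (C' C : Circuit n) : PMF Bool :=
  PMF.ofFintype (fun a => ENNReal.ofReal (∑ x, ‖testState ph C' C (a, x)‖ ^ 2)) (by
    rw [← ENNReal.ofReal_sum_of_nonneg fun a _ => Finset.sum_nonneg fun x _ => sq_nonneg _,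
      ← Fintype.sum_prod_type', sum_testState, ENNReal.ofReal_one])

/-! ### Singular values -/

/-- The spectral norm `‖A‖`, that is, the largest singular value. -/
def specNorm {N M : ℕ} (A : Matrix (Fin N) (Fin M) ℂ) : ℝ :=
  (Matrix.toEuclideanLin A).singularValues 0

/-- The smallest nonzero singular value (zero for `A = 0`); its reciprocal is the norm of the
pseudo-inverse. -/
def minSingularValue {N M : ℕ} (A : Matrix (Fin N) (Fin M) ℂ) : ℝ :=
  (Matrix.toEuclideanLin A).singularValues (A.rank - 1)

/-- The condition number `κ(A) = ‖A‖ ‖A⁻¹‖`, where `A⁻¹` is the pseudo-inverse. -/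
def condNumber {N M : ℕ} (A : Matrix (Fin N) (Fin M) ℂ) : ℝ := specNorm A / minSingularValue A

/-! ### Factorized linear systems with quantum access -/

/-- A factorized linear system: norms and state preparation circuits for the columns
`normU j • |u_j⟩` of `A₁`, the rows `normV j • ⟨v_j|` of `A₂`, and the vector `normB • |b⟩`. -/
structure FactorizedSystem where
  N : ℕ
  M : ℕ
  R : ℕ
  normU : Fin R → ℝ
  normU_nonneg : ∀ j, 0 ≤ normU j
  circU : Fin R → Circuit (Nat.clog 2 N)
  preparesU : ∀ j, PreparesIn N (circU j)
  normV : Fin R → ℝ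
  normV_nonneg : ∀ j, 0 ≤ normV j
  circV : Fin R → Circuit (Nat.clog 2 M)
  preparesV : ∀ j, PreparesIn M (circV j)
  normB : ℝ
  normB_pos : 0 < normB
  circB : Circuit (Nat.clog 2 N)
  preparesB : PreparesIn N circB

namespace FactorizedSystem

variable (S : FactorizedSystem)

/-- `A₁ = ∑ⱼ ‖u_j‖ |u_j⟩⟨j|`. -/
def A₁ : Matrix (Fin S.N) (Fin S.R) ℂ :=
  Matrix.of fun i j => (S.normU j : ℂ) * ketOf S.N (S.circU j) i

/-- `A₂ = ∑ⱼ ‖v_j‖ |j⟩⟨v_j|`. -/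
def A₂ : Matrix (Fin S.R) (Fin S.M) ℂ :=
  Matrix.of fun j k => (S.normV j : ℂ) * star (ketOf S.M (S.circV j) k)

/-- `A = A₁ A₂`. -/
def A : Matrix (Fin S.N) (Fin S.M) ℂ := S.A₁ * S.A₂

/-- `b = ‖b‖ |b⟩`. -/
def b : Fin S.N → ℂ := fun i => (S.normB : ℂ) * ketOf S.N S.circB i

/-- The size bound `Γ = maxⱼ {‖u_j‖², ‖u_j‖‖b‖, ‖v_j‖²}`. -/
def Γ : ℝ := ⨆ j : Fin S.R, max (max (S.normU j ^ 2) (S.normU j * S.normB)) (S.normV j ^ 2)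

/-- The Euclidean residual `‖A x - b‖`. -/
def residual (x : Fin S.M → ℂ) : ℝ := ‖WithLp.toLp 2 (S.A *ᵥ x - S.b)‖

/-- The vector `∑ⱼ s_j |v_j⟩`. -/
def combine (s : Fin S.R → ℂ) : Fin S.M → ℂ := ∑ j, s j • ketOf S.M (S.circV j)

/-- The depths of the circuits are at most `D (log N)`, respectively `D (log M)`. -/
def DepthBound (D : Polynomial ℝ) : Prop :=
  (∀ j, ((S.circU j).depth : ℝ) ≤ D.eval (Real.log S.N)) ∧
  (∀ j, ((S.circV j).depth : ℝ) ≤ D.eval (Real.log S.M)) ∧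
  (S.circB.depth : ℝ) ≤ D.eval (Real.log S.N)

end FactorizedSystem

/-! ### Hybrid programs

A program works on registers for natural numbers and on two-dimensional arrays of complex numbers.
Every operation has unit cost, except for the Hadamard test, which costs the number of gates of its
circuit, and for rounding a number up to a natural number, which costs the result, like a loop that
counts up to it. A program accesses the states `|u_j⟩`, `|v_j⟩`, `|b⟩` by Hadamard tests only. -/

/-- The classical memory. -/
@[ext]
structure Store where
  nat : ℕ → ℕ
  num : ℕ → ℕ → ℕ → ℂ

namespace Store

/-- Write to a register. -/
def setNat (s : Store) (v n : ℕ) : Store := { s with nat := Function.update s.nat v n }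

/-- Write to an array entry. -/
def setNum (s : Store) (a i j : ℕ) (z : ℂ) : Store :=
  { s with num := fun a' i' j' => if a' = a ∧ i' = i ∧ j' = j then z else s.num a' i' j' }

end Store

/-- Expressions for natural numbers. -/
inductive NatExp : Type where
  | lit (n : ℕ)
  | reg (v : ℕ)
  | add (e f : NatExp)
  | sub (e f : NatExp)

namespace NatExp

/-- The value of an expression. -/
def eval (s : Store) : NatExp → ℕ
  | lit n => n
  | reg v => s.nat v
  | add e f => e.eval s + f.eval s
  | sub e f => e.eval s - f.eval s

/-- The number of operations in an expression. -/
def cost : NatExp → ℕ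
  | lit _ => 1
  | reg _ => 1
  | add e f => e.cost + f.cost + 1
  | sub e f => e.cost + f.cost + 1

end NatExp

/-- Expressions for complex numbers. -/
inductive NumExp : Type where
  | lit (q : ℚ)
  | I
  | ofNat (e : NatExp)
  | entry (a : ℕ) (i j : NatExp)
  | add (e f : NumExp)
  | sub (e f : NumExp)
  | mul (e f : NumExp)
  | div (e f : NumExp)
  | conj (e : NumExp)

namespace NumExp

/-- The value of an expression. -/
def eval (s : Store) : NumExp → ℂ
  | lit q => (q : ℂ)
  | I => Complex.I
  | ofNat e => (e.eval s : ℂ)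
  | entry a i j => s.num a (i.eval s) (j.eval s)
  | add e f => e.eval s + f.eval s
  | sub e f => e.eval s - f.eval s
  | mul e f => e.eval s * f.eval s
  | div e f => e.eval s / f.eval s
  | conj e => star (e.eval s)

/-- The number of operations in an expression. -/
def cost : NumExp → ℕ
  | lit _ => 1
  | I => 1
  | ofNat e => e.cost + 1
  | entry _ i j => i.cost + j.cost + 1
  | add e f => e.cost + f.cost + 1
  | sub e f => e.cost + f.cost + 1
  | mul e f => e.cost + f.cost + 1
  | div e f => e.cost + f.cost + 1
  | conj e => e.cost + 1

end NumExp

/-- Tests: comparison of natural numbers, and of the real parts of complex numbers. -/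
inductive Cond : Type where
  | natEq (e f : NatExp)
  | natLE (e f : NatExp)
  | reLE (e f : NumExp)

namespace Cond

/-- The truth of a test. -/
def Holds (s : Store) : Cond → Prop
  | natEq e f => e.eval s = f.eval s
  | natLE e f => e.eval s ≤ f.eval s
  | reLE e f => (e.eval s).re ≤ (f.eval s).re

/-- The number of operations in a test. -/
def cost : Cond → ℕ
  | natEq e f => e.cost + f.cost + 1
  | natLE e f => e.cost + f.cost + 1
  | reLE e f => e.cost + f.cost + 1

end Cond

/-- The Hadamard tests available to a program, for `⟨u_i|u_j⟩`, `⟨u_i|b⟩` and `⟨v_i|v_j⟩`. -/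
inductive Query : Type where
  | uu (i j : NatExp)
  | ub (i : NatExp)
  | vv (i j : NatExp)

/-- Programs. -/
inductive Prog : Type where
  | skip
  | setNat (v : ℕ) (e : NatExp)
  | ceil (v : ℕ) (e : NumExp)
  | setNum (a : ℕ) (i j : NatExp) (e : NumExp)
  | test (a : ℕ) (i j : NatExp) (ph : Bool) (q : Query)
  | seq (P Q : Prog)
  | ite (c : Cond) (P Q : Prog)
  | loop (v : ℕ) (e : NatExp) (P : Prog)

namespace FactorizedSystem

variable (S : FactorizedSystem)

/-- The circuit with a given index; the empty circuit if the index is out of range. -/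
def lookup {R n : ℕ} (c : Fin R → Circuit n) (i : ℕ) : Circuit n :=
  if h : i < R then c ⟨i, h⟩ else []

/-- The measurement outcome of a Hadamard test. -/
def outcome (s : Store) (ph : Bool) : Query → PMF Bool
  | .uu i j => measureTest ph (lookup S.circU (i.eval s)) (lookup S.circU (j.eval s))
  | .ub i => measureTest ph (lookup S.circU (i.eval s)) S.circB
  | .vv i j => measureTest ph (lookup S.circV (i.eval s)) (lookup S.circV (j.eval s))

/-- The cost of a Hadamard test: the number of gates of its circuit and the classical cost of the
indices. -/
def testCost (s : Store) (ph : Bool) : Query → ℕ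
  | .uu i j => (testGates ph (lookup S.circU (i.eval s)) (lookup S.circU (j.eval s))).length +
      i.cost + j.cost
  | .ub i => (testGates ph (lookup S.circU (i.eval s)) S.circB).length + i.cost
  | .vv i j => (testGates ph (lookup S.circV (i.eval s)) (lookup S.circV (j.eval s))).length +
      i.cost + j.cost

open Classical in
/-- The joint distribution of the final memory and the time that a program takes. A Hadamard test
writes the measured bit into the memory; `loop v e P` runs `P` for `v = 0, 1, …, e - 1`, where `e` is
evaluated at the start. -/
def run : Prog → Store → PMF (Store × ℕ)
  | .skip, s => PMF.pure (s, 1)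
  | .setNat v e, s => PMF.pure (s.setNat v (e.eval s), e.cost + 1)
  | .ceil v e, s => PMF.pure (s.setNat v ⌈(e.eval s).re⌉₊, e.cost + ⌈(e.eval s).re⌉₊ + 1)
  | .setNum a i j e, s =>
      PMF.pure (s.setNum a (i.eval s) (j.eval s) (e.eval s), i.cost + j.cost + e.cost + 1)
  | .test a i j ph q, s => (S.outcome s ph q).bind fun o =>
      PMF.pure (s.setNum a (i.eval s) (j.eval s) (if o then 1 else 0),
        i.cost + j.cost + S.testCost s ph q + 1)
  | .seq P Q, s => (run P s).bind fun o => (run Q o.1).bind fun o' => PMF.pure (o'.1, o.2 + o'.2)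
  | .ite c P Q, s => (if c.Holds s then run P s else run Q s).bind fun o =>
      PMF.pure (o.1, c.cost + o.2)
  | .loop v e P, s =>
      Nat.rec (PMF.pure (s, e.cost + 1))
        (fun k (prev : PMF (Store × ℕ)) => prev.bind fun o =>
          (run P (o.1.setNat v k)).bind fun o' => PMF.pure (o'.1, o.2 + o'.2 + 1))
        (e.eval s)

/-- The memory at the start of a run with accuracy `ε` and confidence parameter `k`. Registers 0 to 3
hold `R`, `N`, `M`, `k`. Arrays 0 and 1 hold the norms `‖u_j‖` and `‖v_j‖`. Array 2 holds `‖b‖`, `ε`,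
and the largest and the smallest nonzero singular values of `A₁` and of `A₂`. All else is zero. -/
def input (ε : ℝ) (k : ℕ) : Store where
  nat v := [S.R, S.N, S.M, k].getD v 0
  num a i j := if j = 0 then
      match a with
      | 0 => if h : i < S.R then (S.normU ⟨i, h⟩ : ℂ) else 0
      | 1 => if h : i < S.R then (S.normV ⟨i, h⟩ : ℂ) else 0
      | 2 => (([S.normB, ε, specNorm S.A₁, minSingularValue S.A₁, specNorm S.A₂,
          minSingularValue S.A₂].getD i 0 : ℝ) : ℂ)
      | _ => 0
    else 0

/-- The output vector `s`, which a program leaves in array 3. -/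
def output (s : Store) : Fin S.R → ℂ := fun j => s.num 3 j 0

end FactorizedSystem

end Hybrid

end

/-! The algorithm solves two systems of normal equations by Richardson iteration, with all inner
products estimated by Hadamard tests. First `y` is approximated with A₁†A₁ y = A₁†b, which is the
least squares problem for A₁; then `t` is approximated with A₂A₂† t = y. The output is s_j = ‖v_j‖
t_j, so that x̂ = A₂†t. The range of A lies in that of A₁, hence the excess residual is at most ‖A₁‖
‖A₂A₂†t − y‖ (`residual_sub_iInf_le`).

Richardson's step z ↦ z − σ⁻²W†Wz is nonexpansive everywhere and contracts on the complement of ker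
W. About κ² L steps therefore reduce the initial error by 2^L (`norm_richardson_pow_le`), while
noise from inexact steps only adds up linearly (`norm_richardson_step_le`). A low rank A₁ does no
harm, because the iteration starts at zero and the initial error is orthogonal to the kernel.

Every row of W†Wy is a weighted sum of inner products. Each term is sampled m times, and an
exponential moment bound for the whole sum (`bound_estimate`) shows that the error of the mean is
governed by ‖W‖ ‖y‖ / √m, without a factor R. With R rows this costs about R² m tests per step, and
the passage from rows to the Euclidean norm costs √R in accuracy.

Let X be of order κ₁κ₂²‖b‖/ε and T the number of steps. Relative precision η = 1/(12 T √R X)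
suffices, so m is of order R T² X² times k + T + L + 3, and the total T R² m carries R³. Logarithms
of X are bounded by √X; then T is of order ε^(-1/2) and m of order ε^(-7/2), which gives ε⁻⁴. The
factor Γ² is not produced by the algorithm; it can be inserted since Γ²κ₂⁴ is bounded below by the
size assumption (`one_le_sq_Γ`).

Programs are analysed by `Bound`: a worst-case bound for the time, an invariant, and a bound for an
expected value, composed like weakest preconditions. Failure probabilities then add up along loops
(`Bound.loop_fail`). -/

noncomputable section

namespace Hybrid

/-! ### The distribution of the Hadamard test -/

section HadamardTest

variable {n : ℕ}

/-- The action of a list of gates, the first of which is applied first. -/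
def applyGates (l : List (Gate n)) (ψ : Bits n → ℂ) : Bits n → ℂ :=
  l.foldl (fun ψ g => g.apply ψ) ψ

/-- The inner product of two vectors of amplitudes. -/
def ampInner (φ ψ : Bits n → ℂ) : ℂ := ∑ x, star (φ x) * ψ x

theorem Gate.apply_smul (g : Gate n) (c : ℂ) (ψ : Bits n → ℂ) :
    g.apply (c • ψ) = c • g.apply ψ := by
  cases g <;> funext x <;>
    simp only [Gate.apply, Pi.smul_apply, smul_eq_mul, Finset.mul_sum] <;>
    exact Finset.sum_congr rfl fun a _ => by ring

theorem Gate.apply_sub (g : Gate n) (φ ψ : Bits n → ℂ) :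
    g.apply (φ - ψ) = g.apply φ - g.apply ψ := by
  cases g <;> funext x <;>
    simp only [Gate.apply, Pi.sub_apply, mul_sub, Finset.sum_sub_distrib]

theorem sum_unitary_mul_inv {ι : Type*} [Fintype ι] [DecidableEq ι]
    (U : Matrix.unitaryGroup ι ℂ) (i : ι) (f : ι → ℂ) :
    ∑ a, U.1 i a * ∑ b, (U⁻¹).1 a b * f b = f i := by
  have h : U.1 * (U⁻¹).1 = 1 := by
    rw [← Submonoid.coe_mul]; simp
  calc ∑ a, U.1 i a * ∑ b, (U⁻¹).1 a b * f b = (U.1 *ᵥ ((U⁻¹).1 *ᵥ f)) i := rfl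
    _ = f i := by rw [Matrix.mulVec_mulVec, h, Matrix.one_mulVec]

theorem update_update_swap {p q : Fin n} (hpq : p ≠ q) (x : Bits n) (a b c d : Bool) :
    Function.update (Function.update (Function.update (Function.update x p a) q b) p c) q d =
      Function.update (Function.update x p c) q d := by
  funext j
  by_cases hq : j = q
  · subst hq; simp
  · by_cases hp : j = p
    · subst hp; simp [hpq]
    · simp [hp, hq]

theorem Gate.apply_inv_apply (g : Gate n) (ψ : Bits n → ℂ) : g.apply (g.inv.apply ψ) = ψ := by
  cases g with
  | one q U =>
    funext x
    simp only [Gate.inv, Gate.apply, Function.update_self, Function.update_idem]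
    rw [sum_unitary_mul_inv U (x q) fun b => ψ (Function.update x q b), Function.update_eq_self]
  | two p q hpq U =>
    funext x
    simp only [Gate.inv, Gate.apply, Function.update_self, Function.update_of_ne hpq,
      update_update_swap hpq]
    rw [sum_unitary_mul_inv U (x p, x q) fun b =>
      ψ (Function.update (Function.update x p b.1) q b.2)]
    simp

theorem applyGates_append (l l' : List (Gate n)) (ψ : Bits n → ℂ) :
    applyGates (l ++ l') ψ = applyGates l' (applyGates l ψ) := List.foldl_append

theorem applyGates_smul (l : List (Gate n)) (c : ℂ) (ψ : Bits n → ℂ) :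
    applyGates l (c • ψ) = c • applyGates l ψ := by
  induction l generalizing ψ with
  | nil => rfl
  | cons g l ih => simp only [applyGates, List.foldl_cons, g.apply_smul] at ih ⊢; exact ih _

theorem applyGates_sub (l : List (Gate n)) (φ ψ : Bits n → ℂ) :
    applyGates l (φ - ψ) = applyGates l φ - applyGates l ψ := by
  induction l generalizing φ ψ with
  | nil => rfl
  | cons g l ih => simp only [applyGates, List.foldl_cons, g.apply_sub] at ih ⊢; exact ih _ _

theorem sum_applyGates (l : List (Gate n)) (ψ : Bits n → ℂ) :
    ∑ x, ‖applyGates l ψ x‖ ^ 2 = ∑ x, ‖ψ x‖ ^ 2 := by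
  induction l generalizing ψ with
  | nil => rfl
  | cons g l ih => exact (ih _).trans (g.sum_apply ψ)

theorem applyGates_invGates (l : List (Gate n)) (ψ : Bits n → ℂ) :
    applyGates l (applyGates (l.reverse.map Gate.inv) ψ) = ψ := by
  induction l generalizing ψ with
  | nil => rfl
  | cons g l ih =>
    rw [List.reverse_cons, List.map_append, applyGates_append]
    change applyGates l (g.apply (g.inv.apply _)) = ψ
    rw [g.apply_inv_apply, ih]

theorem Circuit.state_eq (C : Circuit n) : C.state = applyGates C.gates (ketZero n) := rfl

theorem sum_normSq_ketZero : ∑ x, ‖ketZero n x‖ ^ 2 = 1 := by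
  simp [ketZero, apply_ite]

theorem Circuit.sum_normSq_state (C : Circuit n) : ∑ x, ‖C.state x‖ ^ 2 = 1 := by
  rw [C.state_eq, sum_applyGates, sum_normSq_ketZero]

theorem foldl_controlled (l : List (Gate n)) (ψ : Bool × Bits n → ℂ) :
    (l.map TestGate.controlled).foldl (fun ψ g => g.apply ψ) ψ =
      fun z => if z.1 then applyGates l (fun x => ψ (true, x)) z.2 else ψ z := by
  induction l generalizing ψ with
  | nil =>
    funext z
    rcases z with ⟨_ | _, x⟩ <;> simp [applyGates]
  | cons g l ih =>
    rw [List.map_cons, List.foldl_cons, ih]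
    funext z
    rcases z with ⟨_ | _, x⟩ <;> simp [applyGates, TestGate.apply]

theorem sqrt_two_inv_mul_self : ((√2 : ℝ) : ℂ)⁻¹ * ((√2 : ℝ) : ℂ)⁻¹ = 1 / 2 := by
  rw [← mul_inv, ← Complex.ofReal_mul, Real.mul_self_sqrt (by norm_num)]
  norm_num

/-- The first Hadamard gate splits the state evenly into two branches; for ancilla value 1 the last
one subtracts the branch that passed through the controlled gates and the phase from the untouched
one. -/
theorem testState_true (ph : Bool) (C' C : Circuit n) (x : Bits n) :
    testState ph C' C (true, x) = 1 / 2 * (ketZero n x - (if ph then Complex.I else 1) *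
      applyGates (C.gates ++ C'.invGates) (ketZero n) x) := by
  have h := sqrt_two_inv_mul_self
  set r : ℂ := ((√2 : ℝ) : ℂ)⁻¹ with hr
  have hsm : ∀ l : List (Gate n), applyGates l (fun x => r * ketZero n x) =
      fun x => r * applyGates l (ketZero n) x := fun l => applyGates_smul l r _
  rw [testState, testGates, List.foldl_append, List.foldl_append, List.foldl_cons, List.foldl_nil,
    List.foldl_cons, foldl_controlled]
  cases ph <;> simp [TestGate.apply, hadamard, phase, Matrix.diagonal, ← hr, hsm]
  · linear_combination (ketZero n x - applyGates (C.gates ++ C'.invGates) (ketZero n) x) * h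
  · linear_combination
      (ketZero n x - Complex.I * applyGates (C.gates ++ C'.invGates) (ketZero n) x) * h

theorem sum_normSq_sub_smul (φ ψ : Bits n → ℂ) (hφ : ∑ x, ‖φ x‖ ^ 2 = 1)
    (hψ : ∑ x, ‖ψ x‖ ^ 2 = 1) (c : ℂ) (hc : ‖c‖ = 1) :
    ∑ x, ‖φ x - c * ψ x‖ ^ 2 = 2 - 2 * (c * ampInner φ ψ).re := by
  have h : ∀ x, ‖φ x - c * ψ x‖ ^ 2 =
      ‖φ x‖ ^ 2 + ‖ψ x‖ ^ 2 - 2 * (c * (star (φ x) * ψ x)).re := by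
    intro x
    have hc' : Complex.normSq c = 1 := by rw [Complex.normSq_eq_norm_sq, hc]; norm_num
    rw [← Complex.normSq_eq_norm_sq, ← Complex.normSq_eq_norm_sq, ← Complex.normSq_eq_norm_sq,
      Complex.normSq_sub, Complex.normSq_mul, hc', ← Complex.conj_re (φ x * _)]
    simp only [map_mul, ← Complex.star_def, one_mul, star_star]
    congr 3
    ring
  simp only [h, Finset.sum_sub_distrib, Finset.sum_add_distrib, hφ, hψ, ampInner, Finset.mul_sum,
    Complex.re_sum]
  ring

theorem sum_normSq_testState_true (ph : Bool) (C' C : Circuit n) :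
    ∑ x, ‖testState ph C' C (true, x)‖ ^ 2 =
      (1 - ((if ph then Complex.I else 1) * ampInner C'.state C.state).re) / 2 := by
  set c : ℂ := if ph then Complex.I else 1 with hc
  have hc1 : ‖c‖ = 1 := by rw [hc]; split_ifs <;> simp
  have h1 : ∑ x, ‖testState ph C' C (true, x)‖ ^ 2 =
      1 / 4 * ∑ x, ‖(ketZero n - c • applyGates (C.gates ++ C'.invGates) (ketZero n)) x‖ ^ 2 := by
    rw [Finset.mul_sum]
    refine Finset.sum_congr rfl fun x _ => ?_
    rw [testState_true, ← hc, norm_mul, mul_pow]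
    norm_num
  -- Applying V preserves the norm and cancels V†, so the difference becomes V|0⟩ − c U|0⟩ and only
  -- the overlap of the two prepared states matters.
  have h2 : applyGates C'.gates (ketZero n - c • applyGates (C.gates ++ C'.invGates) (ketZero n)) =
      C'.state - c • C.state := by
    rw [applyGates_sub, applyGates_smul, applyGates_append, Circuit.invGates, applyGates_invGates]
    rfl
  rw [h1, ← sum_applyGates C'.gates, h2]
  simp only [Pi.sub_apply, Pi.smul_apply, smul_eq_mul]
  rw [sum_normSq_sub_smul _ _ C'.sum_normSq_state C.sum_normSq_state c hc1]
  ring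

theorem measureTest_true (ph : Bool) (C' C : Circuit n) :
    measureTest ph C' C true = ENNReal.ofReal
      ((1 - ((if ph then Complex.I else 1) * ampInner C'.state C.state).re) / 2) := by
  rw [← sum_normSq_testState_true]; rfl

theorem norm_ampInner_state_le (C' C : Circuit n) : ‖ampInner C'.state C.state‖ ≤ 1 := by
  have h : ampInner C'.state C.state =
      inner ℂ (WithLp.toLp 2 C'.state : EuclideanSpace ℂ (Bits n)) (WithLp.toLp 2 C.state) := by
    simp [ampInner, PiLp.inner_apply, mul_comm]
  have h1 : ∀ C : Circuit n, ‖(WithLp.toLp 2 C.state : EuclideanSpace ℂ (Bits n))‖ = 1 := by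
    intro C
    rw [EuclideanSpace.norm_eq, Real.sqrt_eq_one]
    exact C.sum_normSq_state
  rw [h]
  refine (norm_inner_le_norm _ _).trans ?_
  rw [h1, h1, one_mul]

theorem measureTest_false (ph : Bool) (C' C : Circuit n) :
    measureTest ph C' C false = ENNReal.ofReal
      ((1 + ((if ph then Complex.I else 1) * ampInner C'.state C.state).re) / 2) := by
  have h := sum_testState ph C' C
  rw [Fintype.sum_prod_type, Fintype.sum_bool, sum_normSq_testState_true] at h
  change ENNReal.ofReal (∑ x, ‖testState ph C' C (false, x)‖ ^ 2) = _
  congr 1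
  linarith

end HadamardTest

/-! ### Prepared vectors -/

theorem encode_injective (N : ℕ) :
    Function.Injective fun i : Fin N => encode (Nat.clog 2 N) i := by
  intro i j h
  have hN := Nat.le_pow_clog (b := 2) (by norm_num) N
  refine Fin.ext (Nat.eq_of_testBit_eq fun q => ?_)
  by_cases hq : q < Nat.clog 2 N
  · exact congrFun h ⟨q, hq⟩
  · have hle : 2 ^ Nat.clog 2 N ≤ 2 ^ q := Nat.pow_le_pow_right (by norm_num) (not_lt.1 hq)
    rw [Nat.testBit_lt_two_pow (by omega), Nat.testBit_lt_two_pow (by omega)]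

theorem sum_encode {N : ℕ} {α : Type*} [AddCommMonoid α] (f : Bits (Nat.clog 2 N) → α)
    (hf : ∀ x, (∀ i : Fin N, encode _ i ≠ x) → f x = 0) :
    ∑ i : Fin N, f (encode _ i) = ∑ x, f x :=
  Finset.sum_of_injOn (fun i : Fin N => encode (Nat.clog 2 N) i) (encode_injective N).injOn
    (fun _ _ => Finset.mem_coe.2 (Finset.mem_univ _))
    (fun x _ hx => hf x fun i hi => hx ⟨i, Finset.mem_coe.2 (Finset.mem_univ _), hi⟩)
    (fun _ _ => rfl)

theorem sum_star_ketOf_mul {N : ℕ} (C' C : Circuit (Nat.clog 2 N)) (hC : PreparesIn N C) :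
    ∑ i, star (ketOf N C' i) * ketOf N C i = ampInner C'.state C.state :=
  sum_encode (fun x => star (C'.state x) * C.state x) fun x hx => by simp [hC x hx]

theorem sum_normSq_ketOf {N : ℕ} (C : Circuit (Nat.clog 2 N)) (hC : PreparesIn N C) :
    ∑ i, ‖ketOf N C i‖ ^ 2 = 1 := by
  rw [← C.sum_normSq_state]
  exact sum_encode (fun x => ‖C.state x‖ ^ 2) fun x hx => by simp [hC x hx]

/-! ### The number of gates of a circuit -/

theorem Gate.wires_nonempty {n : ℕ} (g : Gate n) : g.wires.Nonempty := by
  cases g <;> simp [Gate.wires]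

/-- The witness is the union of all wires; every gate occupies at least one wire. The clause on `t`
is what lets the induction add another gate. -/
theorem length_le_card_of_pairwise_disjoint {n : ℕ} (l : List (Gate n))
    (h : l.Pairwise fun g h => Disjoint g.wires h.wires) :
    ∃ s : Finset (Fin n), l.length ≤ s.card ∧ ∀ t : Finset (Fin n),
      (∀ g ∈ l, Disjoint t g.wires) → Disjoint t s := by
  induction l with
  | nil => exact ⟨∅, by simp, by simp⟩
  | cons g l ih =>
    obtain ⟨hg, hl⟩ := List.pairwise_cons.1 h
    obtain ⟨s, hs, hd⟩ := ih hl
    refine ⟨g.wires ∪ s, ?_, fun t ht => ?_⟩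
    · rw [Finset.card_union_of_disjoint (hd _ hg), List.length_cons]
      have := g.wires_nonempty.card_pos
      omega
    · rw [Finset.disjoint_union_right]
      exact ⟨ht g (by simp), hd t fun g' hg' => ht g' (by simp [hg'])⟩

theorem Layer.length_le {n : ℕ} (l : Layer n) : l.1.length ≤ n := by
  obtain ⟨s, hs, -⟩ := length_le_card_of_pairwise_disjoint l.1 l.2
  exact hs.trans (by simpa using s.card_le_univ)

theorem Circuit.length_gates_le {n : ℕ} (C : Circuit n) : C.gates.length ≤ C.depth * n := by
  induction C with
  | nil => simp [Circuit.gates]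
  | cons l C ih =>
    have := l.length_le
    simp only [Circuit.gates, Circuit.depth, List.flatMap_cons, List.length_append,
      List.length_cons, Nat.add_mul, one_mul] at ih ⊢
    omega

theorem length_testGates_le {n : ℕ} (ph : Bool) (C' C : Circuit n) :
    (testGates ph C' C).length ≤ C.gates.length + C'.gates.length + 3 := by
  cases ph <;> simp [testGates, Circuit.invGates] <;> omega

end Hybrid

/-! ### A calculus of time bounds and expectations for probabilistic programs -/

namespace Hybrid

/-! ### Expected values along runs of a program -/

open scoped ENNReal

/-- The expected value of a function of the final memory and the time. -/
def expect {α : Type*} (μ : PMF α) (f : α → ℝ≥0∞) : ℝ≥0∞ := ∑' o, μ o * f o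

section Expect

variable {α β : Type*}

theorem expect_pure (a : α) (f : α → ℝ≥0∞) : expect (PMF.pure a) f = f a := by
  rw [expect, tsum_eq_single a]
  · simp
  · intro b hb; simp [hb]

theorem expect_bind (μ : PMF α) (κ : α → PMF β) (f : β → ℝ≥0∞) :
    expect (μ.bind κ) f = expect μ fun a => expect (κ a) f := by
  simp only [expect, PMF.bind_apply, ← ENNReal.tsum_mul_left, ← ENNReal.tsum_mul_right]
  rw [ENNReal.tsum_comm]
  simp only [mul_assoc]

theorem expect_mono_of_support (μ : PMF α) {f g : α → ℝ≥0∞} (h : ∀ o ∈ μ.support, f o ≤ g o) :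
    expect μ f ≤ expect μ g := by
  refine ENNReal.tsum_le_tsum fun o => ?_
  by_cases ho : μ o = 0
  · simp [ho]
  · gcongr
    exact h o ((μ.mem_support_iff o).2 ho)

theorem expect_const (μ : PMF α) (c : ℝ≥0∞) : expect μ (fun _ => c) = c := by
  rw [expect, ENNReal.tsum_mul_right, μ.tsum_coe, one_mul]

theorem expect_add (μ : PMF α) (f g : α → ℝ≥0∞) :
    expect μ (fun o => f o + g o) = expect μ f + expect μ g := by
  simp only [expect, mul_add, ENNReal.tsum_add]

theorem expect_const_mul (μ : PMF α) (c : ℝ≥0∞) (f : α → ℝ≥0∞) :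
    expect μ (fun o => c * f o) = c * expect μ f := by
  simp only [expect, mul_left_comm, ENNReal.tsum_mul_left]

end Expect

open Classical in
/-- The indicator of a proposition. -/
def ind (p : Prop) : ℝ≥0∞ := if p then 1 else 0

theorem ind_of_true {p : Prop} (h : p) : ind p = 1 := if_pos h

theorem ind_of_false {p : Prop} (h : ¬p) : ind p = 0 := if_neg h

theorem ind_le_one (p : Prop) : ind p ≤ 1 := by unfold ind; split_ifs <;> simp

theorem ind_mono {p q : Prop} (h : p → q) : ind p ≤ ind q := by
  by_cases hp : p
  · rw [ind_of_true hp, ind_of_true (h hp)]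
  · rw [ind_of_false hp]; exact zero_le

theorem ind_le_add {p q r : Prop} (h : p → q ∨ r) : ind p ≤ ind q + ind r := by
  by_cases hp : p
  · rcases h hp with h | h
    · rw [ind_of_true h]; exact (ind_le_one _).trans le_self_add
    · rw [ind_of_true h]; exact (ind_le_one _).trans le_add_self
  · rw [ind_of_false hp]; exact zero_le

theorem toOuterMeasure_eq_expect {α : Type*} (μ : PMF α) (s : Set α) :
    μ.toOuterMeasure s = expect μ fun o => ind (o ∈ s) := by
  classical
  rw [PMF.toOuterMeasure_apply, expect]
  refine tsum_congr fun o => ?_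
  by_cases h : o ∈ s <;> simp [h, ind]

theorem toOuterMeasure_add_compl {α : Type*} (μ : PMF α) (s : Set α) :
    μ.toOuterMeasure s + μ.toOuterMeasure sᶜ = 1 := by
  rw [toOuterMeasure_eq_expect, toOuterMeasure_eq_expect, ← expect_add, ← expect_const μ 1]
  congr 1
  funext o
  by_cases h : o ∈ s <;> simp [h, ind]

/-- All runs of `P` from the memory `s` stop within time `t` in a memory with property `A`, and the
expected value of `f` at the end is at most `b`. -/
structure Bound (S : FactorizedSystem) (P : Prog) (s : Store) (t : ℕ) (A : Store → Prop)
    (f : Store → ℝ≥0∞) (b : ℝ≥0∞) : Prop where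
  always : ∀ o ∈ (S.run P s).support, o.2 ≤ t ∧ A o.1
  mean : expect (S.run P s) (fun o => f o.1) ≤ b

namespace Bound

variable {S : FactorizedSystem} {P Q : Prog} {s : Store} {t t' : ℕ} {A A' : Store → Prop}
  {f f' : Store → ℝ≥0∞} {b b' : ℝ≥0∞}

theorem weaken (h : Bound S P s t A f b) (ht : t ≤ t') (hA : ∀ s', A s' → A' s')
    (hf : ∀ s', A s' → f' s' ≤ f s') (hb : b ≤ b') : Bound S P s t' A' f' b' where
  always o ho := ⟨(h.always o ho).1.trans ht, hA _ (h.always o ho).2⟩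
  mean := (expect_mono_of_support _ fun o ho => hf _ (h.always o ho).2).trans (h.mean.trans hb)

/-- Expected values are additive. -/
theorem add_mean (h : Bound S P s t A f b) (h' : Bound S P s t' A' f' b') :
    Bound S P s t A (fun s' => f s' + f' s') (b + b') where
  always := h.always
  mean := by rw [expect_add]; exact add_le_add h.mean h'.mean

theorem const_mul_mean (h : Bound S P s t A f b) (c : ℝ≥0∞) :
    Bound S P s t A (fun s' => c * f s') (c * b) where
  always := h.always
  mean := by rw [expect_const_mul]; gcongr; exact h.mean

/-- A constant may be added to the function and its bound. -/
theorem add_const (h : Bound S P s t A f b) (c : ℝ≥0∞) :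
    Bound S P s t A (fun s' => f s' + c) (b + c) where
  always := h.always
  mean := by rw [expect_add, expect_const]; gcongr; exact h.mean

theorem of_pure {s₀ : Store} {t₀ : ℕ} (hP : S.run P s = PMF.pure (s₀, t₀)) (ht : t₀ ≤ t)
    (hA : A s₀) (hf : f s₀ ≤ b) : Bound S P s t A f b where
  always o ho := by
    rw [hP, PMF.mem_support_pure_iff] at ho
    rw [ho]
    exact ⟨ht, hA⟩
  mean := by rw [hP, expect_pure]; exact hf

theorem skip (ht : 1 ≤ t) (hA : A s) (hf : f s ≤ b) : Bound S .skip s t A f b :=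
  of_pure rfl ht hA hf

theorem setNat {v : ℕ} {e : NatExp} (ht : e.cost + 1 ≤ t) (hA : A (s.setNat v (e.eval s)))
    (hf : f (s.setNat v (e.eval s)) ≤ b) : Bound S (.setNat v e) s t A f b :=
  of_pure rfl ht hA hf

theorem ceil {v : ℕ} {e : NumExp} (ht : e.cost + ⌈(e.eval s).re⌉₊ + 1 ≤ t)
    (hA : A (s.setNat v ⌈(e.eval s).re⌉₊)) (hf : f (s.setNat v ⌈(e.eval s).re⌉₊) ≤ b) :
    Bound S (.ceil v e) s t A f b :=
  of_pure rfl ht hA hf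

theorem setNum {a : ℕ} {i j : NatExp} {e : NumExp} (ht : i.cost + j.cost + e.cost + 1 ≤ t)
    (hA : A (s.setNum a (i.eval s) (j.eval s) (e.eval s)))
    (hf : f (s.setNum a (i.eval s) (j.eval s) (e.eval s)) ≤ b) :
    Bound S (.setNum a i j e) s t A f b :=
  of_pure rfl ht hA hf

theorem test {a : ℕ} {i j : NatExp} {ph : Bool} {q : Query}
    (ht : i.cost + j.cost + S.testCost s ph q + 1 ≤ t)
    (hA : ∀ o : Bool, A (s.setNum a (i.eval s) (j.eval s) (if o then 1 else 0)))
    (hf : S.outcome s ph q true * f (s.setNum a (i.eval s) (j.eval s) 1) +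
      S.outcome s ph q false * f (s.setNum a (i.eval s) (j.eval s) 0) ≤ b) :
    Bound S (.test a i j ph q) s t A f b where
  always o ho := by
    simp only [FactorizedSystem.run, PMF.mem_support_bind_iff, PMF.mem_support_pure_iff] at ho
    obtain ⟨x, -, rfl⟩ := ho
    exact ⟨ht, hA x⟩
  mean := by
    simp only [FactorizedSystem.run, expect_bind, expect_pure]
    rw [expect, tsum_fintype, Fintype.sum_bool]
    simpa using hf

/-- The tower property: `f` serves as expectation after `P` and as pointwise bound for what `Q` does
from there. -/
theorem seq (h : Bound S P s t A f b) (h' : ∀ s', A s' → Bound S Q s' t' A' f' (f s')) :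
    Bound S (.seq P Q) s (t + t') A' f' b where
  always o ho := by
    simp only [FactorizedSystem.run, PMF.mem_support_bind_iff, PMF.mem_support_pure_iff] at ho
    obtain ⟨o₁, h₁, o₂, h₂, rfl⟩ := ho
    obtain ⟨ht₁, hA₁⟩ := h.always o₁ h₁
    obtain ⟨ht₂, hA₂⟩ := (h' _ hA₁).always o₂ h₂
    exact ⟨add_le_add ht₁ ht₂, hA₂⟩
  mean := by
    simp only [FactorizedSystem.run, expect_bind, expect_pure]
    exact (expect_mono_of_support _ fun o ho => (h' _ (h.always o ho).2).mean).trans h.mean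

theorem ite {c : Cond} (h : c.Holds s → Bound S P s t A f b)
    (h' : ¬c.Holds s → Bound S Q s t A f b) : Bound S (.ite c P Q) s (c.cost + t) A f b := by
  by_cases hc : c.Holds s
  · refine ⟨fun o ho => ?_, ?_⟩
    · simp only [FactorizedSystem.run, if_pos hc, PMF.mem_support_bind_iff,
        PMF.mem_support_pure_iff] at ho
      obtain ⟨o', ho', rfl⟩ := ho
      exact ⟨Nat.add_le_add_left ((h hc).always o' ho').1 _, ((h hc).always o' ho').2⟩
    · simp only [FactorizedSystem.run, if_pos hc, expect_bind, expect_pure]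
      exact (h hc).mean
  · refine ⟨fun o ho => ?_, ?_⟩
    · simp only [FactorizedSystem.run, if_neg hc, PMF.mem_support_bind_iff,
        PMF.mem_support_pure_iff] at ho
      obtain ⟨o', ho', rfl⟩ := ho
      exact ⟨Nat.add_le_add_left ((h' hc).always o' ho').1 _, ((h' hc).always o' ho').2⟩
    · simp only [FactorizedSystem.run, if_neg hc, expect_bind, expect_pure]
      exact (h' hc).mean

/-- The family `f` is a supermartingale along the rounds, and `A` an invariant under which this has
to be checked. -/
theorem loop {v : ℕ} {e : NatExp} {n : ℕ} (hn : e.eval s = n) (A : ℕ → Store → Prop)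
    (f : ℕ → Store → ℝ≥0∞) (h₀ : A 0 s)
    (h : ∀ k < n, ∀ s', A k s' → Bound S P (s'.setNat v k) t (A (k + 1)) (f (k + 1)) (f k s')) :
    Bound S (.loop v e P) s (e.cost + 1 + n * (t + 1)) (A n) (f n) (f 0 s) := by
  subst hn
  let body : ℕ → PMF (Store × ℕ) := fun n => Nat.rec (PMF.pure (s, e.cost + 1))
    (fun k (prev : PMF (Store × ℕ)) => prev.bind fun o =>
      (S.run P (o.1.setNat v k)).bind fun o' => PMF.pure (o'.1, o.2 + o'.2 + 1)) n
  have key : ∀ k ≤ e.eval s, (∀ o ∈ (body k).support, o.2 ≤ e.cost + 1 + k * (t + 1) ∧ A k o.1) ∧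
      expect (body k) (fun o => f k o.1) ≤ f 0 s := by
    intro k
    induction k with
    | zero =>
      refine fun _ => ⟨fun o ho => ?_, ?_⟩
      · change o ∈ (PMF.pure (s, e.cost + 1)).support at ho
        rw [PMF.mem_support_pure_iff] at ho
        subst ho
        exact ⟨by simp, h₀⟩
      · change expect (PMF.pure (s, e.cost + 1)) _ ≤ _
        rw [expect_pure]
    | succ k ih =>
      intro hk
      obtain ⟨ih₁, ih₂⟩ := ih (by omega)
      have hbody : body (k + 1) = (body k).bind fun o =>
        (S.run P (o.1.setNat v k)).bind fun o' => PMF.pure (o'.1, o.2 + o'.2 + 1) := rfl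
      refine ⟨fun o ho => ?_, ?_⟩
      · simp only [hbody, PMF.mem_support_bind_iff, PMF.mem_support_pure_iff] at ho
        obtain ⟨o₁, h₁, o₂, h₂, rfl⟩ := ho
        obtain ⟨ht₁, hA₁⟩ := ih₁ o₁ h₁
        obtain ⟨ht₂, hA₂⟩ := (h k (by omega) _ hA₁).always o₂ h₂
        refine ⟨?_, hA₂⟩
        rw [Nat.add_mul]
        dsimp only
        omega
      · simp only [hbody, expect_bind, expect_pure]
        exact (expect_mono_of_support _ fun o ho =>
          (h k (by omega) _ (ih₁ o ho).2).mean).trans ih₂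
  exact ⟨(key _ le_rfl).1, (key _ le_rfl).2⟩

/-- A loop each of whose rounds spoils the property `G` with probability at most `p`. -/
theorem loop_fail {v : ℕ} {e : NatExp} {n : ℕ} (hn : e.eval s = n) (A G : ℕ → Store → Prop)
    (p : ℝ≥0∞) (h₀ : A 0 s) (hG : G 0 s)
    (h : ∀ k < n, ∀ s', A k s' → Bound S P (s'.setNat v k) t (A (k + 1))
      (fun s'' => ind ¬G (k + 1) s'') (p + ind ¬G k s')) :
    Bound S (.loop v e P) s (e.cost + 1 + n * (t + 1)) (A n) (fun s' => ind ¬G n s') (n * p) := by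
  -- The supermartingale is the failure indicator plus `p` for each round still to come; its initial
  -- value is the union bound.
  refine (loop hn A (fun k s' => ind (¬G k s') + (n - k : ℕ) * p) h₀ fun k hk s' hs' => ?_).weaken
    le_rfl (fun _ h => h) (fun s' _ => le_self_add) ?_
  · refine ((h k hk s' hs').add_const ((n - (k + 1) : ℕ) * p)).weaken le_rfl (fun _ h => h)
      (fun _ _ => le_rfl) ?_
    rw [add_comm p, add_assoc, ← one_add_mul, ← Nat.cast_one_add]
    gcongr
    omega
  · rw [ind_of_false (not_not.2 hG), zero_add, Nat.sub_zero]

/-- Two programs with failure probabilities, the second of which preserves what it does not use. -/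
theorem seq_fail {G G' : Store → Prop} {p p' : ℝ≥0∞} (h : Bound S P s t A (fun s' => ind ¬G s') p)
    (h' : ∀ s', A s' → Bound S Q s' t' A' (fun s'' => ind ¬G' s'') (p' + ind ¬G s')) :
    Bound S (.seq P Q) s (t + t') A' (fun s'' => ind ¬G' s'') (p + p') :=
  seq (h.add_const p') fun s' hs' => (h' s' hs').weaken le_rfl (fun _ h => h) (fun _ _ => le_rfl)
    (add_comm _ _).le

end Bound

/-- The memories `s` and `s'` agree on the first `n` registers and the first `a` arrays. -/
def Frame (n a : ℕ) (s s' : Store) : Prop :=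
  -- The cut-offs follow the memory layout. Registers 4, 5, 6 hold L, T, m, and 10 to 13 count
  -- steps, rows, columns and samples, from the outermost to the innermost loop. Arrays 5 to 9 hold
  -- the right-hand side, the iterate, the residual, the accumulator and the measured bit.
  (∀ v < n, s'.nat v = s.nat v) ∧ ∀ i < a, s'.num i = s.num i

namespace Frame

variable {n a n' a' : ℕ} {s s' s'' : Store}

theorem refl (n a : ℕ) (s : Store) : Frame n a s s := ⟨fun _ _ => rfl, fun _ _ => rfl⟩

theorem trans (h : Frame n a s s') (h' : Frame n a s' s'') : Frame n a s s'' :=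
  ⟨fun v hv => (h'.1 v hv).trans (h.1 v hv), fun i hi => (h'.2 i hi).trans (h.2 i hi)⟩

theorem mono (h : Frame n a s s') (hn : n' ≤ n) (ha : a' ≤ a) : Frame n' a' s s' :=
  ⟨fun v hv => h.1 v (by omega), fun i hi => h.2 i (by omega)⟩

theorem setNat {v : ℕ} (hv : n ≤ v) (m : ℕ) : Frame n a s (s.setNat v m) :=
  ⟨fun w hw => Function.update_of_ne (by omega) _ _, fun _ _ => rfl⟩

theorem setNum {b : ℕ} (hb : a ≤ b) (i j : ℕ) (z : ℂ) : Frame n a s (s.setNum b i j z) := by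
  refine ⟨fun _ _ => rfl, fun c hc => ?_⟩
  funext i' j'
  exact if_neg fun h => by omega

end Frame

@[simp]
theorem Store.setNat_nat (s : Store) (v m w : ℕ) :
    (s.setNat v m).nat w = if w = v then m else s.nat w := Function.update_apply ..

@[simp]
theorem Store.setNat_num (s : Store) (v m : ℕ) : (s.setNat v m).num = s.num := rfl

@[simp]
theorem Store.setNum_nat (s : Store) (a i j : ℕ) (z : ℂ) : (s.setNum a i j z).nat = s.nat := rfl

@[simp]
theorem Store.setNum_num (s : Store) (a i j : ℕ) (z : ℂ) (a' i' j' : ℕ) :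
    (s.setNum a i j z).num a' i' j' = if a' = a ∧ i' = i ∧ j' = j then z else s.num a' i' j' := rfl

end Hybrid

/-! ### Deterministic analysis: singular values and the iteration -/

namespace Hybrid

/-! ### Extremal singular values -/

section SingularValues

variable {E F : Type*} [NormedAddCommGroup E] [InnerProductSpace ℂ E] [FiniteDimensional ℂ E]
  [NormedAddCommGroup F] [InnerProductSpace ℂ F] [FiniteDimensional ℂ F] (T : E →ₗ[ℂ] F)

/-- Expand ⟨x, T†T x⟩ in an orthonormal eigenbasis of T†T. -/
theorem norm_sq_apply_eq_sum (x : E) :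
    ‖T x‖ ^ 2 = ∑ i : Fin (Module.finrank ℂ E), T.singularValues i ^ 2 *
    ‖(T.isSymmetric_adjoint_comp_self.eigenvectorBasis rfl).repr x i‖ ^ 2 := by
  set e := T.isSymmetric_adjoint_comp_self.eigenvectorBasis rfl with he
  have h : inner ℂ x ((T.adjoint ∘ₗ T) x) = inner ℂ (T x) (T x) := by
    rw [LinearMap.comp_apply, LinearMap.adjoint_inner_right]
  have h' : ((‖T x‖ ^ 2 : ℝ) : ℂ) = ((∑ i : Fin (Module.finrank ℂ E),
      T.singularValues i ^ 2 * ‖e.repr x i‖ ^ 2 : ℝ) : ℂ) := by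
    have h1 : ((‖T x‖ ^ 2 : ℝ) : ℂ) = inner ℂ (T x) (T x) := by
      rw [inner_self_eq_norm_sq_to_K]; norm_cast
    rw [h1, ← h, ← e.repr.inner_map_map, PiLp.inner_apply, Complex.ofReal_sum]
    refine Finset.sum_congr rfl fun i _ => ?_
    rw [he, LinearMap.IsSymmetric.eigenvectorBasis_apply_self_apply, ← he,
      ← T.sq_singularValues_fin rfl i]
    simp only [RCLike.inner_apply, Complex.ofReal_mul, Complex.ofReal_pow]
    rw [mul_assoc, Complex.mul_conj', ← Complex.ofReal_pow (T.singularValues i)]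
    rfl
  exact_mod_cast h'

theorem norm_apply_le_singularValue (x : E) : ‖T x‖ ≤ T.singularValues 0 * ‖x‖ := by
  refine le_of_sq_le_sq ?_ (mul_nonneg (T.singularValues_nonneg 0) (norm_nonneg x))
  set e := T.isSymmetric_adjoint_comp_self.eigenvectorBasis rfl with he
  rw [norm_sq_apply_eq_sum, mul_pow, ← e.repr.norm_map x, EuclideanSpace.norm_sq_eq,
    Finset.mul_sum]
  gcongr with i
  · exact T.singularValues_nonneg _
  · exact T.singularValues_antitone (Nat.zero_le _)

/-- Eigenvectors of T†T with index beyond the rank lie in the kernel, so `x` has no components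
there; all other singular values are at least the one with index rank − 1. -/
theorem singularValue_mul_norm_le {x : E} (hx : x ∈ (LinearMap.ker T)ᗮ) :
    T.singularValues (Module.finrank ℂ (LinearMap.range T) - 1) * ‖x‖ ≤ ‖T x‖ := by
  refine le_of_sq_le_sq ?_ (norm_nonneg _)
  set e := T.isSymmetric_adjoint_comp_self.eigenvectorBasis rfl with he
  rw [norm_sq_apply_eq_sum, mul_pow, ← e.repr.norm_map x, EuclideanSpace.norm_sq_eq,
    Finset.mul_sum, ← he]
  refine Finset.sum_le_sum fun i _ => ?_
  by_cases hi : (i : ℕ) < Module.finrank ℂ (LinearMap.range T)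
  · gcongr
    · exact T.singularValues_nonneg _
    · exact T.singularValues_antitone (by omega)
  · have hz : T.singularValues (i : ℕ) = 0 :=
      T.singularValues_eq_zero_iff_le_finrank_range.2 (not_lt.1 hi)
    have hk : e i ∈ LinearMap.ker T := by
      rw [LinearMap.mem_ker, ← norm_eq_zero, ← sq_eq_zero_iff, norm_sq_apply_eq_sum, ← he]
      refine Finset.sum_eq_zero fun j _ => ?_
      rw [e.repr_self]
      by_cases hj : j = i
      · subst hj; simp [hz]
      · simp [hj]
    have h0 : e.repr x i = 0 := by
      rw [e.repr_apply_apply]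
      exact hx _ hk
    simp [h0]

end SingularValues

/-! ### Richardson iteration for the normal equations -/

section Richardson

variable {E F : Type*} [NormedAddCommGroup E] [InnerProductSpace ℂ E] [FiniteDimensional ℂ E]
  [NormedAddCommGroup F] [InnerProductSpace ℂ F] [FiniteDimensional ℂ F] (W : E →ₗ[ℂ] F)
  {σ ρ : ℝ}

/-- One step of the Richardson iteration for the homogeneous normal equations. -/
def richardson (σ : ℝ) : E →ₗ[ℂ] E :=
  LinearMap.id - (((σ ^ 2)⁻¹ : ℝ) : ℂ) • (W.adjoint ∘ₗ W)

theorem richardson_apply (σ : ℝ) (z : E) :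
    richardson W σ z = z - (((σ ^ 2)⁻¹ : ℝ) : ℂ) • W.adjoint (W z) := rfl

variable {W}

theorem norm_adjoint_apply_le (hσ0 : 0 ≤ σ) (hσ : ∀ y, ‖W y‖ ≤ σ * ‖y‖) (x : F) :
    ‖W.adjoint x‖ ≤ σ * ‖x‖ := by
  by_cases h0 : ‖W.adjoint x‖ = 0
  · rw [h0]; positivity
  · refine le_of_mul_le_mul_right ?_ (lt_of_le_of_ne (norm_nonneg _) (Ne.symm h0))
    calc ‖W.adjoint x‖ * ‖W.adjoint x‖ = ‖inner ℂ (W.adjoint x) (W.adjoint x)‖ := by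
          rw [inner_self_eq_norm_sq_to_K]; simp [sq]
      _ = ‖inner ℂ (W (W.adjoint x)) x‖ := by rw [LinearMap.adjoint_inner_right]
      _ ≤ ‖W (W.adjoint x)‖ * ‖x‖ := norm_inner_le_norm _ _
      _ ≤ σ * ‖W.adjoint x‖ * ‖x‖ := by gcongr; exact hσ _
      _ = σ * ‖x‖ * ‖W.adjoint x‖ := by ring

/-- In the expanded square the cross term is −2‖Wz‖²/σ², and the quadratic term gives back at most
half of it because ‖W†‖ ≤ σ. -/
theorem norm_sq_richardson_le (hσ0 : 0 < σ) (hσ : ∀ y, ‖W y‖ ≤ σ * ‖y‖) (z : E) :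
    ‖richardson W σ z‖ ^ 2 ≤ ‖z‖ ^ 2 - ‖W z‖ ^ 2 / σ ^ 2 := by
  have h1 : (inner ℂ z ((((σ ^ 2)⁻¹ : ℝ) : ℂ) • W.adjoint (W z))).re = ‖W z‖ ^ 2 / σ ^ 2 := by
    rw [inner_smul_right, LinearMap.adjoint_inner_right, inner_self_eq_norm_sq_to_K]
    rw [div_eq_inv_mul, ← Complex.ofReal_re ((σ ^ 2)⁻¹ * ‖W z‖ ^ 2)]
    push_cast
    rfl
  have h2 : ‖(((σ ^ 2)⁻¹ : ℝ) : ℂ) • W.adjoint (W z)‖ ^ 2 ≤ ‖W z‖ ^ 2 / σ ^ 2 := by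
    rw [norm_smul, Complex.norm_real, Real.norm_of_nonneg (by positivity), mul_pow]
    calc (σ ^ 2)⁻¹ ^ 2 * ‖W.adjoint (W z)‖ ^ 2 ≤ (σ ^ 2)⁻¹ ^ 2 * (σ * ‖W z‖) ^ 2 := by
          gcongr; exact norm_adjoint_apply_le hσ0.le hσ _
      _ = ‖W z‖ ^ 2 / σ ^ 2 := by field_simp
  have h3 := norm_sub_sq (𝕜 := ℂ) z ((((σ ^ 2)⁻¹ : ℝ) : ℂ) • W.adjoint (W z))
  rw [richardson_apply, h3]
  simp only [RCLike.re_to_complex, h1]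
  linarith

theorem norm_richardson_le (hσ0 : 0 < σ) (hσ : ∀ y, ‖W y‖ ≤ σ * ‖y‖) (z : E) :
    ‖richardson W σ z‖ ≤ ‖z‖ := by
  refine le_of_sq_le_sq ((norm_sq_richardson_le hσ0 hσ z).trans ?_) (norm_nonneg _)
  have : 0 ≤ ‖W z‖ ^ 2 / σ ^ 2 := by positivity
  linarith

theorem richardson_mem_ker_orthogonal {z : E} (hz : z ∈ (LinearMap.ker W)ᗮ) :
    richardson W σ z ∈ (LinearMap.ker W)ᗮ := by
  rw [richardson_apply]
  refine Submodule.sub_mem _ hz (Submodule.smul_mem _ _ fun u hu => ?_)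
  rw [LinearMap.adjoint_inner_right, LinearMap.mem_ker.1 hu, inner_zero_left]

/-- The complement of the kernel is invariant, and there ‖Wz‖ ≥ ρ‖z‖ turns the decrease of the
previous estimate into a contraction of the squared norm. -/
theorem norm_sq_richardson_pow_le (hσ0 : 0 < σ) (hσ : ∀ y, ‖W y‖ ≤ σ * ‖y‖) (hρ0 : 0 ≤ ρ)
    (hρσ : ρ ≤ σ) (hρ : ∀ y ∈ (LinearMap.ker W)ᗮ, ρ * ‖y‖ ≤ ‖W y‖) {z : E}
    (hz : z ∈ (LinearMap.ker W)ᗮ) (t : ℕ) :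
    (richardson W σ ^ t) z ∈ (LinearMap.ker W)ᗮ ∧
      ‖(richardson W σ ^ t) z‖ ^ 2 ≤ (1 - ρ ^ 2 / σ ^ 2) ^ t * ‖z‖ ^ 2 := by
  have hq : 0 ≤ 1 - ρ ^ 2 / σ ^ 2 := by
    rw [sub_nonneg, div_le_one (by positivity)]; gcongr
  induction t with
  | zero => simpa using hz
  | succ t ih =>
    rw [pow_succ', Module.End.mul_apply]
    refine ⟨richardson_mem_ker_orthogonal ih.1, (norm_sq_richardson_le hσ0 hσ _).trans ?_⟩
    have h := hρ _ ih.1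
    have h2 : ρ ^ 2 / σ ^ 2 * ‖(richardson W σ ^ t) z‖ ^ 2 ≤
        ‖W ((richardson W σ ^ t) z)‖ ^ 2 / σ ^ 2 := by
      rw [div_mul_eq_mul_div, ← mul_pow]; gcongr
    calc _ ≤ (1 - ρ ^ 2 / σ ^ 2) * ‖(richardson W σ ^ t) z‖ ^ 2 := by linarith
      _ ≤ (1 - ρ ^ 2 / σ ^ 2) * ((1 - ρ ^ 2 / σ ^ 2) ^ t * ‖z‖ ^ 2) := by gcongr; exact ih.2
      _ = _ := by ring

/-- After `T ≥ 2 (σ / ρ)² L` steps the error has been divided by `2 ^ L`. -/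
theorem norm_richardson_pow_le (hσ0 : 0 < σ) (hσ : ∀ y, ‖W y‖ ≤ σ * ‖y‖) (hρ0 : 0 < ρ)
    (hρσ : ρ ≤ σ) (hρ : ∀ y ∈ (LinearMap.ker W)ᗮ, ρ * ‖y‖ ≤ ‖W y‖) {z : E}
    (hz : z ∈ (LinearMap.ker W)ᗮ) {T L : ℕ} (hT : 2 * (σ / ρ) ^ 2 * L ≤ T) :
    ‖(richardson W σ ^ T) z‖ ≤ (2 ^ L : ℝ)⁻¹ * ‖z‖ := by
  refine le_of_sq_le_sq (((norm_sq_richardson_pow_le hσ0 hσ hρ0.le hρσ hρ hz T).2).trans ?_)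
    (by positivity)
  rw [mul_pow]
  gcongr
  have hq : 0 ≤ 1 - ρ ^ 2 / σ ^ 2 := by
    rw [sub_nonneg, div_le_one (by positivity)]; gcongr
  calc (1 - ρ ^ 2 / σ ^ 2) ^ T ≤ Real.exp (-(ρ ^ 2 / σ ^ 2)) ^ T := by
        gcongr
        have := Real.add_one_le_exp (-(ρ ^ 2 / σ ^ 2))
        linarith
    _ = Real.exp (-(ρ ^ 2 / σ ^ 2 * T)) := by rw [← Real.exp_nat_mul]; ring_nf
    -- The target is 4^(−L) since squared norms are compared, hence the 2 in the number of steps; e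
    -- ≥ 2 does the rest.
    _ ≤ Real.exp (-(2 * L)) := by
        refine Real.exp_le_exp.2 (neg_le_neg ?_)
        calc (2 * L : ℝ) = ρ ^ 2 / σ ^ 2 * (2 * (σ / ρ) ^ 2 * L) := by field_simp
          _ ≤ _ := by gcongr
    _ = (Real.exp 1 ^ (2 * L))⁻¹ := by
        rw [Real.exp_neg, ← Real.exp_nat_mul]; push_cast; ring_nf
    _ ≤ (2 ^ (2 * L))⁻¹ := by
        gcongr
        have := Real.add_one_le_exp (1 : ℝ)
        linarith
    _ = ((2 ^ L)⁻¹) ^ 2 := by rw [inv_pow, ← pow_mul, mul_comm L]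

/-- The error of an inexact Richardson iteration grows linearly. -/
theorem norm_richardson_step_le (hσ0 : 0 < σ) (hσ : ∀ y, ‖W y‖ ≤ σ * ‖y‖) {η : ℝ} {t : ℕ}
    {y y' z : E} (hy : ‖y - z - (richardson W σ ^ t) (-z)‖ ≤ t * η)
    (hy' : ‖y' - (y + (((σ ^ 2)⁻¹ : ℝ) : ℂ) • (W.adjoint (W z) - W.adjoint (W y)))‖ ≤ η) :
    ‖y' - z - (richardson W σ ^ (t + 1)) (-z)‖ ≤ (t + 1 : ℕ) * η := by
  -- The old deviation passes through a nonexpansive map, so noise inside the kernel is not damped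
  -- but does not grow either.
  have h : y' - z - (richardson W σ ^ (t + 1)) (-z) =
      (y' - (y + (((σ ^ 2)⁻¹ : ℝ) : ℂ) • (W.adjoint (W z) - W.adjoint (W y)))) +
        richardson W σ (y - z - (richardson W σ ^ t) (-z)) := by
    rw [map_sub (richardson W σ), ← Module.End.mul_apply, ← pow_succ', richardson_apply, map_sub,
      map_sub, smul_sub, smul_sub]
    abel
  rw [h]
  refine (norm_add_le _ _).trans ?_
  have := norm_richardson_le hσ0 hσ (y - z - (richardson W σ ^ t) (-z))
  rw [Nat.cast_succ, add_mul, one_mul]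
  linarith

theorem norm_richardson_pow_apply_le (hσ0 : 0 < σ) (hσ : ∀ y, ‖W y‖ ≤ σ * ‖y‖) (t : ℕ) (z : E) :
    ‖(richardson W σ ^ t) z‖ ≤ ‖z‖ := by
  induction t with
  | zero => simp
  | succ t ih =>
    rw [pow_succ', Module.End.mul_apply]
    exact (norm_richardson_le hσ0 hσ _).trans ih

/-- Keeps the noisy iterates in a ball, on which the sampling error is under control. Solution,
remaining initial error and accumulated noise contribute at most `Y` each. -/
theorem norm_le_of_richardson (hσ0 : 0 < σ) (hσ : ∀ y, ‖W y‖ ≤ σ * ‖y‖) {η Y : ℝ} {t : ℕ}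
    {y z : E} (hy : ‖y - z - (richardson W σ ^ t) (-z)‖ ≤ t * η) (hz : ‖z‖ ≤ Y)
    (hη : t * η ≤ Y) : ‖y‖ ≤ 3 * Y := by
  have h1 := norm_richardson_pow_apply_le hσ0 hσ t (-z)
  rw [norm_neg] at h1
  calc ‖y‖ = ‖(y - z - (richardson W σ ^ t) (-z)) + (richardson W σ ^ t) (-z) + z‖ := by
        congr 1; abel
    _ ≤ ‖y - z - (richardson W σ ^ t) (-z)‖ + ‖(richardson W σ ^ t) (-z)‖ + ‖z‖ := norm_add₃_le
    _ ≤ 3 * Y := by linarith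

/-- The minimum norm solution of a least squares problem. -/
theorem exists_leastSquares (W : E →ₗ[ℂ] F) (b : F) : ∃ y ∈ (LinearMap.ker W)ᗮ,
    W.adjoint (W y) = W.adjoint b ∧ ‖W y‖ ≤ ‖b‖ ∧ ∀ y', ‖W y - b‖ ≤ ‖W y' - b‖ := by
  obtain ⟨y₀, hy₀⟩ : ∃ y₀, W y₀ = (LinearMap.range W).starProjection b :=
    LinearMap.mem_range.1 (Submodule.starProjection_apply_mem _ b)
  -- Removing the kernel component does not change the image and puts the solution where the
  -- iteration contracts.
  set y := (LinearMap.ker W)ᗮ.starProjection y₀ with hy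
  have hWy : W y = (LinearMap.range W).starProjection b := by
    rw [← hy₀, ← sub_eq_zero, ← map_sub, ← LinearMap.mem_ker, ← neg_mem_iff, neg_sub]
    have := Submodule.sub_starProjection_mem_orthogonal (K := (LinearMap.ker W)ᗮ) y₀
    rwa [Submodule.orthogonal_orthogonal] at this
  have horth : b - W y ∈ (LinearMap.range W)ᗮ := by
    rw [hWy]; exact Submodule.sub_starProjection_mem_orthogonal b
  refine ⟨y, Submodule.starProjection_apply_mem _ _, ?_, ?_, fun y' => ?_⟩
  · rw [← sub_eq_zero, ← map_sub]
    refine ext_inner_left ℂ fun v => ?_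
    rw [LinearMap.adjoint_inner_right, inner_zero_right, ← neg_sub, inner_neg_right,
      horth _ (LinearMap.mem_range_self W v), neg_zero]
  · rw [hWy]; exact Submodule.norm_starProjection_apply_le _ _
  · have h : inner ℂ (W y' - W y) (W y - b) = 0 := by
      rw [← map_sub, ← neg_sub b, inner_neg_right, horth _ (LinearMap.mem_range_self W _), neg_zero]
    have h2 := norm_add_sq_eq_norm_sq_add_norm_sq_of_inner_eq_zero _ _ h
    rw [sub_add_sub_cancel] at h2
    refine le_of_sq_le_sq ?_ (norm_nonneg _)
    nlinarith [mul_self_nonneg ‖W y' - W y‖]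

/-- The normal equations are solvable if all singular values are positive. -/
theorem exists_adjoint_apply_eq (hρ0 : 0 < ρ) (hρ : ∀ y, ρ * ‖y‖ ≤ ‖W y‖) (g : E) :
    ∃ y, W.adjoint (W y) = g ∧ ρ ^ 2 * ‖y‖ ≤ ‖g‖ := by
  have key : ∀ y, ρ ^ 2 * ‖y‖ ≤ ‖W.adjoint (W y)‖ := by
    intro y
    by_cases hy : y = 0
    · simp [hy]
    refine le_of_mul_le_mul_right ?_ (norm_pos_iff.2 hy)
    calc ρ ^ 2 * ‖y‖ * ‖y‖ = (ρ * ‖y‖) ^ 2 := by ring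
      _ ≤ ‖W y‖ ^ 2 := by gcongr; exact hρ y
      _ = ‖inner ℂ (W y) (W y)‖ := by rw [inner_self_eq_norm_sq_to_K]; simp
      _ = ‖inner ℂ (W.adjoint (W y)) y‖ := by rw [LinearMap.adjoint_inner_left]
      _ ≤ _ := norm_inner_le_norm _ _
  have hinj : Function.Injective (W.adjoint ∘ₗ W) := by
    rw [← LinearMap.ker_eq_bot, LinearMap.ker_eq_bot']
    intro y hy
    have := key y
    rw [show W.adjoint (W y) = 0 from hy, norm_zero] at this
    by_contra h
    have : 0 < ρ ^ 2 * ‖y‖ := mul_pos (by positivity) (norm_pos_iff.2 h)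
    linarith
  obtain ⟨y, hy⟩ := LinearMap.surjective_of_injective hinj g
  exact ⟨y, hy, by rw [← hy]; exact key y⟩

/-- A lower bound for the adjoint of a surjective map. -/
theorem mul_norm_le_norm_adjoint (hW : Function.Surjective W)
    (hρ : ∀ y ∈ (LinearMap.ker W)ᗮ, ρ * ‖y‖ ≤ ‖W y‖) (x : F) : ρ * ‖x‖ ≤ ‖W.adjoint x‖ := by
  rcases le_or_gt ρ 0 with h0 | h0
  · exact (mul_nonpos_of_nonpos_of_nonneg h0 (norm_nonneg _)).trans (norm_nonneg _)
  obtain ⟨y₀, rfl⟩ := hW x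
  -- The preimage is moved to the complement of the kernel, where `hρ` applies; then ‖Wy‖² = ⟨W†Wy,
  -- y⟩ and Cauchy–Schwarz finish.
  set y := (LinearMap.ker W)ᗮ.starProjection y₀ with hy
  have hWy : W y₀ = W y := by
    rw [← sub_eq_zero, ← map_sub, ← LinearMap.mem_ker]
    have := Submodule.sub_starProjection_mem_orthogonal (K := (LinearMap.ker W)ᗮ) y₀
    rwa [Submodule.orthogonal_orthogonal] at this
  rw [hWy]
  by_cases hz : W y = 0
  · simp [hz]
  have hpos : 0 < ‖W y‖ := norm_pos_iff.2 hz
  refine le_of_mul_le_mul_right ?_ hpos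
  calc ρ * ‖W y‖ * ‖W y‖ = ρ * ‖inner ℂ (W y) (W y)‖ := by
        rw [inner_self_eq_norm_sq_to_K]; simp [sq, mul_assoc]
    _ = ρ * ‖inner ℂ (W.adjoint (W y)) y‖ := by rw [LinearMap.adjoint_inner_left]
    _ ≤ ρ * (‖W.adjoint (W y)‖ * ‖y‖) := by gcongr; exact norm_inner_le_norm _ _
    _ = ‖W.adjoint (W y)‖ * (ρ * ‖y‖) := by ring
    _ ≤ ‖W.adjoint (W y)‖ * ‖W y‖ := by
        gcongr; exact hρ y (Submodule.starProjection_apply_mem _ _)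

end Richardson

/-! ### Matrices with prepared columns -/

/-- The matrix with columns `w j • |C j⟩`. -/
def columnMatrix {N R : ℕ} (w : Fin R → ℝ) (C : Fin R → Circuit (Nat.clog 2 N)) :
    Matrix (Fin N) (Fin R) ℂ :=
  Matrix.of fun i j => (w j : ℂ) * ketOf N (C j) i

section ColumnMatrix

variable {N R : ℕ} {w : Fin R → ℝ} {C : Fin R → Circuit (Nat.clog 2 N)}

theorem norm_toLp_ketOf (C : Circuit (Nat.clog 2 N)) (hC : PreparesIn N C) :
    ‖WithLp.toLp 2 (ketOf N C)‖ = 1 := by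
  rw [EuclideanSpace.norm_eq, Real.sqrt_eq_one]
  exact sum_normSq_ketOf C hC

theorem columnMatrix_single (j : Fin R) :
    (columnMatrix w C).toEuclideanLin (EuclideanSpace.single j 1) =
      (w j : ℂ) • WithLp.toLp 2 (ketOf N (C j)) := by
  ext i
  simp [Matrix.toLpLin_apply, columnMatrix]

/-- Columns are images of unit vectors, and prepared states have norm one. -/
theorem weight_le (hw : ∀ j, 0 ≤ w j) (hC : ∀ j, PreparesIn N (C j)) {σ : ℝ}
    (hσ : ∀ y, ‖(columnMatrix w C).toEuclideanLin y‖ ≤ σ * ‖y‖) (j : Fin R) : w j ≤ σ := by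
  have h := hσ (EuclideanSpace.single j 1)
  rw [columnMatrix_single, norm_smul, norm_toLp_ketOf _ (hC j)] at h
  simpa [abs_of_nonneg (hw j)] using h

theorem le_weight (hw : ∀ j, 0 ≤ w j) (hC : ∀ j, PreparesIn N (C j)) {ρ : ℝ}
    (hρ : ∀ y, ρ * ‖y‖ ≤ ‖(columnMatrix w C).toEuclideanLin y‖) (j : Fin R) : ρ ≤ w j := by
  have h := hρ (EuclideanSpace.single j 1)
  rw [columnMatrix_single, norm_smul, norm_toLp_ketOf _ (hC j)] at h
  simpa [abs_of_nonneg (hw j)] using h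

theorem adjoint_columnMatrix_apply (x : EuclideanSpace ℂ (Fin N)) (i : Fin R) :
    (columnMatrix w C).toEuclideanLin.adjoint x i = w i * ∑ k, star (ketOf N (C i) k) * x k := by
  rw [← Matrix.toEuclideanLin_conjTranspose_eq_adjoint]
  simp [Matrix.toLpLin_apply, columnMatrix, Matrix.mulVec, dotProduct, Finset.mul_sum, mul_assoc]

theorem gram_columnMatrix_apply (hC : ∀ j, PreparesIn N (C j)) (y : EuclideanSpace ℂ (Fin R))
    (i : Fin R) :
    (columnMatrix w C).toEuclideanLin.adjoint ((columnMatrix w C).toEuclideanLin y) i =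
      w i * ∑ j, w j * y j * ampInner (C i).state (C j).state := by
  rw [adjoint_columnMatrix_apply]
  congr 1
  simp only [Matrix.toLpLin_apply, columnMatrix, Matrix.mulVec, dotProduct, Matrix.of_apply,
    Finset.mul_sum, ← sum_star_ketOf_mul _ _ (hC _)]
  rw [Finset.sum_comm]
  exact Finset.sum_congr rfl fun j _ => Finset.sum_congr rfl fun k _ => by ring

end ColumnMatrix

/-! ### Spectral norm and smallest nonzero singular value of a matrix -/

section Matrix

variable {N M : ℕ} (A : Matrix (Fin N) (Fin M) ℂ)

theorem rank_eq_finrank_range_toEuclideanLin :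
    A.rank = Module.finrank ℂ (LinearMap.range A.toEuclideanLin) :=
  A.rank_eq_finrank_range_toLin (EuclideanSpace.basisFun _ ℂ).toBasis
    (EuclideanSpace.basisFun _ ℂ).toBasis

theorem norm_toEuclideanLin_le (y : EuclideanSpace ℂ (Fin M)) :
    ‖A.toEuclideanLin y‖ ≤ specNorm A * ‖y‖ := norm_apply_le_singularValue _ y

theorem specNorm_nonneg : 0 ≤ specNorm A := LinearMap.singularValues_nonneg _ _

theorem minSingularValue_nonneg : 0 ≤ minSingularValue A := LinearMap.singularValues_nonneg _ _

theorem minSingularValue_le_specNorm : minSingularValue A ≤ specNorm A :=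
  LinearMap.singularValues_antitone _ (Nat.zero_le _)

theorem minSingularValue_mul_norm_le {y : EuclideanSpace ℂ (Fin M)}
    (hy : y ∈ (LinearMap.ker A.toEuclideanLin)ᗮ) :
    minSingularValue A * ‖y‖ ≤ ‖A.toEuclideanLin y‖ := by
  rw [minSingularValue, rank_eq_finrank_range_toEuclideanLin]
  exact singularValue_mul_norm_le _ hy

theorem minSingularValue_pos (h : 0 < specNorm A) : 0 < minSingularValue A := by
  rw [specNorm, LinearMap.singularValues_pos_iff_lt_finrank_range] at h
  rw [minSingularValue, LinearMap.singularValues_pos_iff_lt_finrank_range,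
    rank_eq_finrank_range_toEuclideanLin]
  omega

theorem eq_zero_of_specNorm_eq_zero (h : specNorm A = 0) : A = 0 := by
  have : A.toEuclideanLin = 0 := LinearMap.ext fun y => by
    have := norm_toEuclideanLin_le A y
    rw [h, zero_mul] at this
    exact norm_le_zero_iff.1 this
  exact (LinearEquiv.map_eq_zero_iff _).1 this

end Matrix

end Hybrid

/-! ### Concentration of the sampled sums -/

namespace Hybrid

open scoped ENNReal

/-! ### Exponential moments -/

/-- For a centred variable the linear term averages out, which leaves a subgaussian bound. Near zero
it follows from e^x ≤ 1 + x + x². -/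
theorem exp_le_add_exp_sq (x : ℝ) : Real.exp x ≤ x + Real.exp (x ^ 2) := by
  have h1 := Real.add_one_le_exp (x ^ 2)
  rcases le_or_gt |x| 1 with h | h
  · have := (abs_le.1 (Real.abs_exp_sub_one_sub_id_le h)).2
    linarith
  · rcases lt_abs.1 h with h | h
    · have : Real.exp x ≤ Real.exp (x ^ 2) := Real.exp_le_exp.2 (by nlinarith)
      linarith
    · have : Real.exp x ≤ 1 := Real.exp_le_one_iff.2 (by linarith)
      nlinarith

/-- The exponential moments of a centred random variable with values `1 - ν` and `-1 - ν`. -/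
theorem two_point_mgf_le {ν : ℝ} (hν : |ν| ≤ 1) (a : ℝ) :
    (1 - ν) / 2 * Real.exp (a * (-1 - ν)) + (1 + ν) / 2 * Real.exp (a * (1 - ν)) ≤
      Real.exp (4 * a ^ 2) := by
  obtain ⟨h1, h2⟩ := abs_le.1 hν
  -- Both values ±1 − ν have modulus at most 2, whence the 4.
  have e1 : Real.exp ((a * (-1 - ν)) ^ 2) ≤ Real.exp (4 * a ^ 2) := by
    refine Real.exp_le_exp.2 ?_
    rw [mul_pow, mul_comm]
    gcongr
    nlinarith
  have e2 : Real.exp ((a * (1 - ν)) ^ 2) ≤ Real.exp (4 * a ^ 2) := by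
    refine Real.exp_le_exp.2 ?_
    rw [mul_pow, mul_comm]
    gcongr
    nlinarith
  have e3 := (exp_le_add_exp_sq (a * (-1 - ν))).trans (add_le_add_right e1 _)
  have e4 := (exp_le_add_exp_sq (a * (1 - ν))).trans (add_le_add_right e2 _)
  have h3 : 0 ≤ (1 - ν) / 2 := by linarith
  have h4 : 0 ≤ (1 + ν) / 2 := by linarith
  calc _ ≤ (1 - ν) / 2 * (a * (-1 - ν) + Real.exp (4 * a ^ 2)) +
        (1 + ν) / 2 * (a * (1 - ν) + Real.exp (4 * a ^ 2)) := by gcongr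
    _ = _ := by ring

/-! ### Estimation of weighted sums of inner products -/

variable {S : FactorizedSystem}

/-- The inner product that a Hadamard test estimates. -/
def Query.mean (S : FactorizedSystem) (s : Store) : Query → ℂ
  | .uu i j => ampInner (FactorizedSystem.lookup S.circU (i.eval s)).state
      (FactorizedSystem.lookup S.circU (j.eval s)).state
  | .ub i => ampInner (FactorizedSystem.lookup S.circU (i.eval s)).state S.circB.state
  | .vv i j => ampInner (FactorizedSystem.lookup S.circV (i.eval s)).state
      (FactorizedSystem.lookup S.circV (j.eval s)).state

theorem Query.norm_mean_le (s : Store) (q : Query) : ‖q.mean S s‖ ≤ 1 := by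
  cases q <;> exact norm_ampInner_state_le _ _

/-- The factor by which the inner product is multiplied in the Hadamard test. -/
def testPhase (ph : Bool) : ℂ := if ph then Complex.I else 1

theorem outcome_true (s : Store) (ph : Bool) (q : Query) :
    S.outcome s ph q true = ENNReal.ofReal ((1 - (testPhase ph * q.mean S s).re) / 2) := by
  cases q <;> exact measureTest_true _ _ _

theorem outcome_false (s : Store) (ph : Bool) (q : Query) :
    S.outcome s ph q false = ENNReal.ofReal ((1 + (testPhase ph * q.mean S s).re) / 2) := by
  cases q <;> exact measureTest_false _ _ _

theorem abs_re_testPhase_mul_le (ph : Bool) {μ : ℂ} (hμ : ‖μ‖ ≤ 1) :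
    |(testPhase ph * μ).re| ≤ 1 := by
  refine (Complex.abs_re_le_norm _).trans ?_
  rw [norm_mul]
  cases ph <;> simpa [testPhase] using hμ

/-- The exponential potential of the accumulator in array 8. -/
def potential (w : ℂ) (β : ℝ) (s : Store) : ℝ≥0∞ :=
  ENNReal.ofReal (Real.exp ((w * s.num 8 0 0).re + β))

/-- The number zero as an expression. -/
abbrev zeroExp : NatExp := .lit 0

/-- One Hadamard test whose outcome, as a sign, is multiplied by `e` and added to array 8. -/
def halfSample (ph : Bool) (q : Query) (e : NumExp) : Prog :=
  .seq (.test 9 zeroExp zeroExp ph q)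
    (.setNum 8 zeroExp zeroExp (.add (.entry 8 zeroExp zeroExp)
      (.mul e (.sub (.lit 1) (.mul (.lit 2) (.entry 9 zeroExp zeroExp))))))

/-- Outcome 0 counts as +1 and outcome 1 as −1, so the mean sign is ν = Re(phase · μ). With a =
Re(wd), averaging over the outcome raises the exponent by at most aν + 4a². -/
theorem bound_halfSample {ph : Bool} {q : Query} {e : NumExp} {s : Store} {d μ w : ℂ} {g : ℕ}
    (β : ℝ) (hd : ∀ s', Frame 13 8 s s' → e.eval s' = d) (hμ : q.mean S s = μ)
    (hg : S.testCost s ph q ≤ g) :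
    Bound S (halfSample ph q e) s (g + e.cost + 20) (Frame 13 8 s) (potential w β)
      (potential w (β + ((w * d).re * (testPhase ph * μ).re + 4 * (w * d).re ^ 2)) s) := by
  have hF : ∀ z, Frame 13 8 s (s.setNum 9 0 0 z) := fun z => Frame.setNum (by norm_num) _ _ _
  refine (Bound.seq (t := g + 3) (t' := e.cost + 17) (A := fun s' =>
    ∃ o : Bool, s' = s.setNum 9 0 0 (if o then 1 else 0)) (A' := Frame 13 8 s)
    (f' := potential w β) (f := fun s' => potential w (β + (w * (d * (1 - 2 * s'.num 9 0 0))).re) s)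
    (Bound.test ?_ (fun o => ⟨o, rfl⟩) ?_) ?_).weaken (by omega) (fun _ h => h)
      (fun _ _ => le_rfl) le_rfl
  · simp only [NatExp.cost]; omega
  · rw [outcome_true, outcome_false, hμ]
    set ν := (testPhase ph * μ).re with hν
    have hν1 : |ν| ≤ 1 := abs_re_testPhase_mul_le ph (hμ ▸ q.norm_mean_le s)
    obtain ⟨h1, h2⟩ := abs_le.1 hν1
    have key := two_point_mgf_le hν1 (w * d).re
    simp only [potential, NatExp.eval, Store.setNum_num, if_true, and_self]
    rw [← ENNReal.ofReal_mul (by linarith), ← ENNReal.ofReal_mul (by linarith),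
      ← ENNReal.ofReal_add (mul_nonneg (by linarith) (Real.exp_pos _).le)
        (mul_nonneg (by linarith) (Real.exp_pos _).le)]
    refine ENNReal.ofReal_le_ofReal ?_
    set x := (w * s.num 8 0 0).re
    set a := (w * d).re
    have r1 : (w * (d * (1 - 2 * 1))).re = -a := by
      rw [show w * (d * (1 - 2 * 1)) = -(w * d) by ring, Complex.neg_re]
    have r2 : (w * (d * (1 - 2 * 0))).re = a := by
      rw [show w * (d * (1 - 2 * 0)) = w * d by ring]
    simp only [r1, r2]
    calc _ = Real.exp (x + β + a * ν) * ((1 - ν) / 2 * Real.exp (a * (-1 - ν)) +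
          (1 + ν) / 2 * Real.exp (a * (1 - ν))) := by
          rw [mul_add, mul_left_comm, mul_left_comm (Real.exp (x + β + a * ν)), ← Real.exp_add,
            ← Real.exp_add]
          ring_nf
      _ ≤ Real.exp (x + β + a * ν) * Real.exp (4 * a ^ 2) := by gcongr
      _ = _ := by rw [← Real.exp_add]; ring_nf
  · rintro s' ⟨o, rfl⟩
    refine Bound.setNum ?_ ?_ ?_
    · simp only [NatExp.cost, NumExp.cost]; omega
    · exact (hF _).trans (Frame.setNum (by norm_num) _ _ _)
    · simp only [potential, NumExp.eval, NatExp.eval, hd _ (hF _), Store.setNum_num]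
      refine ENNReal.ofReal_le_ofReal (Real.exp_le_exp.2 (le_of_eq ?_))
      simp [mul_add]
      ring

/-- Estimates of the real and the imaginary part of an inner product, multiplied by `e`. -/
def sample (q : Query) (e : NumExp) : Prog :=
  .seq (halfSample false q e) (halfSample true q (.mul (.mul (.lit (-1)) .I) e))

/-- The test with phase has mean −Im μ, which the weight −i d turns into i d Im μ; together with d
Re μ this is dμ. The variance terms Re(wd)² and Im(wd)² add up to |wd|². -/
theorem bound_sample {q : Query} {e : NumExp} {s : Store} {d μ w : ℂ} {g : ℕ}
    (β : ℝ) (hd : ∀ s', Frame 13 8 s s' → e.eval s' = d)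
    (hμ : ∀ s', Frame 13 8 s s' → q.mean S s' = μ) (hg : ∀ s' ph, S.testCost s' ph q ≤ g) :
    Bound S (sample q e) s (2 * g + 2 * e.cost + 44) (Frame 13 8 s) (potential w β)
      (potential w (β + ((w * (d * μ)).re + 4 * (‖w‖ ^ 2 * ‖d‖ ^ 2))) s) := by
  refine (Bound.seq (f := potential w (β + ((w * (-1 * Complex.I * d)).re *
      (testPhase true * μ).re + 4 * (w * (-1 * Complex.I * d)).re ^ 2)))
    (bound_halfSample (μ := μ) _ hd (hμ s (Frame.refl _ _ _)) (hg _ _)) fun s' hs' => 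
    (bound_halfSample (μ := μ) (d := -1 * Complex.I * d) (g := g) β (fun s'' hs'' => ?_)
      (hμ s' hs') (hg _ _)).weaken le_rfl (fun _ h => hs'.trans h) (fun _ _ => le_rfl)
        le_rfl).weaken ?_ (fun _ h => h) (fun _ _ => le_rfl) (le_of_eq ?_)
  · simp [NumExp.eval, hd s'' (hs'.trans hs'')]
  · simp only [NumExp.cost]; omega
  · have h : ‖w‖ ^ 2 * ‖d‖ ^ 2 = (w * d).re ^ 2 + (w * d).im ^ 2 := by
      rw [← mul_pow, ← norm_mul, ← Complex.normSq_eq_norm_sq, Complex.normSq_apply]; ring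
    have h1 : w * (-1 * Complex.I * d) = -Complex.I * (w * d) := by ring
    have h2 : w * (d * μ) = w * d * μ := by ring
    simp only [potential, h, h1, h2, testPhase]
    generalize w * d = z
    congr 2
    simp
    ring

/-- The program that adds up `m` estimates of each of `J` inner products with weights `e`, where `m`
is the content of register 6 and the indices are produced in register 12. -/
def estimate (J : NatExp) (q : Query) (e : NumExp) : Prog :=
  .seq (.setNum 8 zeroExp zeroExp (.lit 0)) (.loop 12 J (.loop 13 (.reg 6) (sample q e)))

/-- A bound for the time of `estimate`. -/
def estimateTime (J m g : ℕ) : ℕ := 10 + J * (3 + m * (2 * g + 75))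

theorem bound_estimate_potential {J : NatExp} {q : Query} {e : NumExp} {s : Store} {n m g : ℕ}
    {d μ : ℕ → ℂ} (w : ℂ) (hJ : J.eval (s.setNum 8 0 0 0) = n) (hJc : J.cost = 1)
    (hm : s.nat 6 = m) (he : e.cost ≤ 15)
    (hd : ∀ j < n, ∀ s', Frame 12 8 s s' → s'.nat 12 = j → e.eval s' = d j)
    (hμ : ∀ j < n, ∀ s', Frame 12 8 s s' → s'.nat 12 = j → q.mean S s' = μ j)
    (hg : ∀ s' ph, S.testCost s' ph q ≤ g) :
    Bound S (estimate J q e) s (estimateTime n m g) (Frame 12 8 s) (potential w 0)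
      (ENNReal.ofReal (Real.exp ((w * (m * ∑ j ∈ Finset.range n, d j * μ j)).re +
        4 * (‖w‖ ^ 2 * (m * ∑ j ∈ Finset.range n, ‖d j‖ ^ 2))))) := by
  set γ : ℕ → ℝ := fun j => (w * (d j * μ j)).re + 4 * (‖w‖ ^ 2 * ‖d j‖ ^ 2) with hγ
  refine (Bound.seq (t := 5) (t' := 2 + n * (2 + m * (2 * g + 75) + 1))
    (A := fun s' => s' = s.setNum 8 0 0 0) (A' := Frame 12 8 s)
    (f' := potential w 0) (f := fun s' => potential w (∑ j ∈ Finset.Ico 0 n, m * γ j) s')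
    (Bound.setNum (by simp [NatExp.cost, NumExp.cost]) (by simp [NumExp.eval, NatExp.eval])
      le_rfl) ?_).weaken ?_ (fun _ h => h) (fun _ _ => le_rfl) (le_of_eq ?_)
  · rintro s' rfl
    have hF : Frame 12 8 s (s.setNum 8 0 0 0) := Frame.setNum (by norm_num) _ _ _
    refine (Bound.loop (t := 2 + m * (2 * g + 75)) hJ (fun _ => Frame 12 8 s)
      -- The exponent contains in advance the growth `γ j` of all samples still to be taken, which
      -- makes the potential a supermartingale.
      (fun k => potential w (∑ j ∈ Finset.Ico k n, m * γ j)) hF fun k hk s₁ hs₁ => ?_).weaken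
        (by simp [hJc]) (fun _ h => h) (fun _ _ => by simp) le_rfl
    have hF₁ : Frame 12 8 s₁ (s₁.setNat 12 k) := Frame.setNat le_rfl _
    have h6 : (NatExp.reg 6).eval (s₁.setNat 12 k) = m := by
      simp [NatExp.eval, hs₁.1 6 (by norm_num), hm]
    refine (Bound.loop (t := 2 * g + 2 * e.cost + 44) h6 (fun _ => Frame 13 8 (s₁.setNat 12 k))
      (fun l => potential w ((∑ j ∈ Finset.Ico (k + 1) n, m * γ j) + ((m : ℝ) - l) * γ k))
      (Frame.refl _ _ _) fun l hl s₂ hs₂ => ?_).weaken ?_ ?_ ?_ ?_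
    · have hF₂ : Frame 13 8 s₂ (s₂.setNat 13 l) := Frame.setNat le_rfl _
      have hF₃ : ∀ s', Frame 13 8 (s₂.setNat 13 l) s' → Frame 12 8 s s' ∧ s'.nat 12 = k := by
        intro s' hs'
        have h := (hs₂.trans hF₂).trans hs'
        exact ⟨(hs₁.trans hF₁).trans (h.mono (by norm_num) le_rfl), by simp [h.1 12 (by norm_num)]⟩
      refine (bound_sample (d := d k) (μ := μ k) _ (fun s' hs' => hd k hk _ (hF₃ _ hs').1
        (hF₃ _ hs').2) (fun s' hs' => hμ k hk _ (hF₃ _ hs').1 (hF₃ _ hs').2) hg).weaken le_rfl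
          (fun _ h => (hs₂.trans hF₂).trans h) (fun _ _ => le_rfl) (le_of_eq ?_)
      simp only [potential, Store.setNat_num]
      congr 3
      push_cast
      ring
    · have := Nat.mul_le_mul_left m (show 2 * g + 2 * e.cost + 44 + 1 ≤ 2 * g + 75 by omega)
      simp only [NatExp.cost]
      omega
    · exact fun _ h => (hs₁.trans hF₁).trans (h.mono (by norm_num) le_rfl)
    · intro _ _; simp
    · simp only [potential, Store.setNat_num, Nat.cast_zero, sub_zero]
      rw [Finset.sum_eq_sum_Ico_succ_bot hk, add_comm (m * γ k)]
  · rw [estimateTime]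
    ring_nf
    omega
  · have h0 : (s.setNum 8 0 0 0).num 8 0 0 = 0 := by simp
    simp only [potential, NatExp.eval, NumExp.eval, Rat.cast_zero, h0, mul_zero, Complex.zero_re,
      zero_add]
    congr 2
    rw [← Finset.range_eq_Ico, ← Finset.mul_sum, hγ, Finset.sum_add_distrib, mul_left_comm w,
      ← Complex.ofReal_natCast, Complex.re_ofReal_mul, Finset.mul_sum (a := w), Complex.re_sum,
      ← Finset.mul_sum, ← Finset.mul_sum]
    ring

/-- The exponential Markov inequality, before expectations are taken. -/
theorem ind_le_potential {w z : ℂ} {h lam : ℝ} (hl : 0 ≤ lam) (s : Store) :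
    ind (h < (w * (s.num 8 0 0 - z)).re) ≤
      ENNReal.ofReal (Real.exp (-((lam * w) * z).re - lam * h)) * potential (lam * w) 0 s := by
  by_cases hh : h < (w * (s.num 8 0 0 - z)).re
  · rw [ind_of_true hh, potential, ← ENNReal.ofReal_mul (Real.exp_pos _).le, ← Real.exp_add,
      ENNReal.one_le_ofReal, Real.one_le_exp_iff]
    have : lam * h ≤ lam * (w * (s.num 8 0 0 - z)).re := by gcongr
    rw [← Complex.re_ofReal_mul, mul_sub, mul_sub, Complex.sub_re] at this
    rw [mul_assoc, mul_assoc]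
    linarith
  · rw [ind_of_false hh]; exact zero_le

theorem norm_le_of_directions {z : ℂ} {h : ℝ} (h1 : (1 * z).re ≤ h) (h2 : (-1 * z).re ≤ h)
    (h3 : (Complex.I * z).re ≤ h) (h4 : (-Complex.I * z).re ≤ h) : ‖z‖ ≤ 2 * h := by
  simp at h1 h2 h3 h4
  refine (Complex.norm_le_abs_re_add_abs_im z).trans ?_
  have := abs_le.2 ⟨neg_le.1 h2, h1⟩
  have := abs_le.2 ⟨neg_le.1 h3, h4⟩
  linarith

/-- The estimate is accurate with high probability. -/
theorem bound_estimate {J : NatExp} {q : Query} {e : NumExp} {s : Store} {n m g : ℕ}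
    {d μ : ℕ → ℂ} {V h : ℝ} (hJ : J.eval (s.setNum 8 0 0 0) = n) (hJc : J.cost = 1)
    (hm : s.nat 6 = m) (he : e.cost ≤ 15)
    (hd : ∀ j < n, ∀ s', Frame 12 8 s s' → s'.nat 12 = j → e.eval s' = d j)
    (hμ : ∀ j < n, ∀ s', Frame 12 8 s s' → s'.nat 12 = j → q.mean S s' = μ j)
    (hg : ∀ s' ph, S.testCost s' ph q ≤ g) (hV : 0 < V) (hh : 0 ≤ h) :
    Bound S (estimate J q e) s (estimateTime n m g) (Frame 12 8 s)
      (fun s' => ind ¬(m * ∑ j ∈ Finset.range n, ‖d j‖ ^ 2 ≤ V →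
        ‖s'.num 8 0 0 - m * ∑ j ∈ Finset.range n, d j * μ j‖ ≤ 2 * h))
      (4 * ENNReal.ofReal (Real.exp (-(h ^ 2 / (16 * V))))) := by
  set z := m * ∑ j ∈ Finset.range n, d j * μ j with hz
  -- The weights are fixed by the memory at the start; if they exceed the variance budget, the event
  -- to be bounded is empty.
  by_cases hV' : m * ∑ j ∈ Finset.range n, ‖d j‖ ^ 2 ≤ V
  swap
  · refine ((bound_estimate_potential 0 hJ hJc hm he hd hμ hg).const_mul_mean 0).weaken le_rfl
      (fun _ h => h) (fun s' _ => ?_) (by simp)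
    rw [ind_of_false (by tauto)]; exact zero_le
  have key : ∀ w : ℂ, ‖w‖ = 1 → Bound S (estimate J q e) s (estimateTime n m g) (Frame 12 8 s)
      (fun s' => ind (h < (w * (s'.num 8 0 0 - z)).re))
      (ENNReal.ofReal (Real.exp (-(h ^ 2 / (16 * V))))) := by
    intro w hw
    -- λ = h/(8V) minimizes the exponent 4λ²V − λh.
    have hl : 0 ≤ h / (8 * V) := by positivity
    refine ((bound_estimate_potential ((h / (8 * V) : ℝ) * w) hJ hJc hm he hd hμ
      hg).const_mul_mean _).weaken le_rfl (fun _ h => h) (fun s' _ => ind_le_potential hl s') ?_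
    rw [← ENNReal.ofReal_mul (Real.exp_pos _).le, ← Real.exp_add]
    refine ENNReal.ofReal_le_ofReal (Real.exp_le_exp.2 ?_)
    rw [← hz, norm_mul, hw, mul_one, Complex.norm_real, Real.norm_of_nonneg hl]
    have h1 : 4 * ((h / (8 * V)) ^ 2 * (m * ∑ j ∈ Finset.range n, ‖d j‖ ^ 2)) ≤
        4 * ((h / (8 * V)) ^ 2 * V) := by gcongr
    have h2 : 4 * ((h / (8 * V)) ^ 2 * V) - h / (8 * V) * h = -(h ^ 2 / (16 * V)) := by
      field_simp; ring
    linarith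
  -- Four directions control real and imaginary part from both sides, which costs the factor 4 and
  -- the 2 in 2h.
  refine ((((key 1 (by simp)).add_mean (key (-1) (by simp))).add_mean
    (key Complex.I (by simp))).add_mean (key (-Complex.I) (by simp))).weaken le_rfl
      (fun _ h => h) (fun s' _ => ?_) (le_of_eq (by ring))
  by_cases hbad : ‖s'.num 8 0 0 - z‖ ≤ 2 * h
  · rw [ind_of_false (by tauto)]; exact zero_le
  · refine (ind_le_one _).trans ?_
    by_contra! hlt
    refine hbad (norm_le_of_directions ?_ ?_ ?_ ?_) <;> by_contra! hc
    all_goals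
      refine absurd hlt (not_lt.2 ?_)
      rw [ind_of_true hc]
    · exact le_add_right (le_add_right le_self_add)
    · exact le_add_right (le_add_right le_add_self)
    · exact le_add_right le_add_self
    · exact le_add_self

end Hybrid

/-! ### Noisy Richardson iteration -/

namespace Hybrid

open scoped ENNReal

/-! ### The iteration as a program -/

variable {S : FactorizedSystem}

/-- For deterministic pieces of program, whose postcondition settles the expectation. -/
theorem Bound.of_always {P : Prog} {s : Store} {t : ℕ} {A : Store → Prop} {f₀ f : Store → ℝ≥0∞}
    {b₀ b : ℝ≥0∞} (h : Bound S P s t A f₀ b₀) (hf : ∀ s', A s' → f s' ≤ b) :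
    Bound S P s t A f b where
  always := h.always
  mean := (expect_mono_of_support _ fun o ho => hf _ (h.always o ho).2).trans
    (expect_const _ b).le

/-- The program that computes in array 7 an estimate of `g - G y`, where `g` is in array 5, `y` is in
array 6 and `G` is the Gram matrix of vectors with norms in array `a` and inner products `Q`. -/
def residualProg (a : ℕ) (Q : NatExp → NatExp → Query) : Prog :=
  .loop 11 (.reg 0) (.seq
    (estimate (.reg 0) (Q (.reg 11) (.reg 12))
      (.mul (.entry a (.reg 12) zeroExp) (.entry 6 (.reg 12) zeroExp)))
    (.setNum 7 (.reg 11) zeroExp (.sub (.entry 5 (.reg 11) zeroExp)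
      (.div (.mul (.entry a (.reg 11) zeroExp) (.entry 8 zeroExp zeroExp)) (.ofNat (.reg 6))))))

/-- The program that adds the vector in array 7, divided by the square of entry `c` of array 2, to
the vector in array 6. -/
def updateProg (c : ℕ) : Prog :=
  .loop 11 (.reg 0) (.setNum 6 (.reg 11) zeroExp (.add (.entry 6 (.reg 11) zeroExp)
    (.div (.entry 7 (.reg 11) zeroExp)
      (.mul (.entry 2 (.lit c) zeroExp) (.entry 2 (.lit c) zeroExp)))))

/-- The Richardson iteration, with the number of steps in register 5. -/
def solveProg (a : ℕ) (Q : NatExp → NatExp → Query) (c : ℕ) : Prog :=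
  .loop 10 (.reg 5) (.seq (residualProg a Q) (updateProg c))

/-- The vector in the first column of an array. -/
def Store.vec (s : Store) (a R : ℕ) : EuclideanSpace ℂ (Fin R) :=
  WithLp.toLp 2 fun i => s.num a i 0

theorem Store.vec_apply (s : Store) (a R : ℕ) (i : Fin R) : s.vec a R i = s.num a i 0 := rfl

theorem Frame.vec_eq {n a : ℕ} {s s' : Store} (h : Frame n a s s') {b : ℕ} (hb : b < a) (R : ℕ) :
    s'.vec b R = s.vec b R := by
  unfold Store.vec; rw [h.2 b hb]

/-- The tests `Q` give the inner products of the states prepared by `C`, with at most `g` steps per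
test. -/
structure IsGramQuery (S : FactorizedSystem) {N : ℕ} (Q : NatExp → NatExp → Query)
    (C : Fin S.R → Circuit (Nat.clog 2 N)) (g : ℕ) : Prop where
  mean : ∀ (s : Store) (i j : Fin S.R), s.nat 11 = i → s.nat 12 = j →
    (Q (.reg 11) (.reg 12)).mean S s = ampInner (C i).state (C j).state
  cost : ∀ (s : Store) (ph : Bool), S.testCost s ph (Q (.reg 11) (.reg 12)) ≤ g

section Solve

variable {N : ℕ} {a m g : ℕ} {Q : NatExp → NatExp → Query} {w : Fin S.R → ℝ}
  {C : Fin S.R → Circuit (Nat.clog 2 N)} {s : Store}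

/-- All terms of a row are sampled into one accumulator, so only the sum of the squared weights
enters and the accuracy does not degrade with R. The failure probabilities of the R rows add up. -/
theorem bound_residualProg (ha : a < 6) (hQ : IsGramQuery S Q C g) (hR : s.nat 0 = S.R)
    (hw : ∀ i : Fin S.R, s.num a i 0 = w i) (hw0 : ∀ i, 0 ≤ w i) (hm : s.nat 6 = m) (hm0 : 0 < m)
    {v η : ℝ} (hv : 0 < v) (hη : 0 ≤ η) :
    Bound S (residualProg a Q) s (2 + S.R * (estimateTime S.R m g + 20)) (Frame 11 7 s)
      (fun s' => ind ¬(∑ j : Fin S.R, ‖(w j : ℂ) * s.num 6 j 0‖ ^ 2 ≤ v → ∀ i : Fin S.R,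
        ‖s'.num 7 i 0 - (s.num 5 i 0 - w i * ∑ j : Fin S.R,
          w j * s.num 6 j 0 * ampInner (C i).state (C j).state)‖ ≤ w i * (2 * η)))
      (S.R * (4 * ENNReal.ofReal (Real.exp (-(m * η ^ 2 / (16 * v)))))) := by
  have hm0' : (0 : ℝ) < m := by exact_mod_cast hm0
  refine (Bound.loop_fail (n := S.R) (t := estimateTime S.R m g + 19)
    (show NatExp.eval s (.reg 0) = S.R from hR) (fun _ => Frame 11 7 s)
    (fun k s' => ∑ j : Fin S.R, ‖(w j : ℂ) * s.num 6 j 0‖ ^ 2 ≤ v → ∀ i : Fin S.R, (i : ℕ) < k →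
      ‖s'.num 7 i 0 - (s.num 5 i 0 - w i * ∑ j : Fin S.R,
          w j * s.num 6 j 0 * ampInner (C i).state (C j).state)‖ ≤ w i * (2 * η)) _
    (Frame.refl _ _ _) (fun _ i hi => absurd hi (Nat.not_lt_zero _)) fun k hk s' hs' => ?_).weaken
      (by simp [NatExp.cost]) (fun _ h => h) (fun s' _ => ind_mono ?_) le_rfl
  swap
  · exact fun h h' => h fun hV i => h' hV i i.2
  set s₁ := s'.setNat 11 k with hs₁
  have hF₁ : Frame 11 7 s s₁ := hs'.trans (Frame.setNat le_rfl _)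
  let d : ℕ → ℂ := fun j => s.num a j 0 * s.num 6 j 0
  let μ : ℕ → ℂ := fun j => if h : j < S.R then
    ampInner (C ⟨k, hk⟩).state (C ⟨j, h⟩).state else 0
  -- Variance budget and deviation both scale with m: the accumulator holds m times the row, and
  -- h²/(16V) becomes mη²/(16v).
  have hest := bound_estimate (S := S) (J := .reg 0) (q := Q (.reg 11) (.reg 12))
    (e := .mul (.entry a (.reg 12) zeroExp) (.entry 6 (.reg 12) zeroExp)) (s := s₁) (n := S.R)
    (m := m) (g := g) (d := d) (μ := μ) (V := m * v) (h := m * η)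
    (by simp [NatExp.eval, hF₁.1 0 (by norm_num), hR]) rfl (by rw [hF₁.1 6 (by norm_num), hm])
    (by simp [NumExp.cost, NatExp.cost]) ?_ ?_ hQ.cost (by positivity) (by positivity)
  rotate_left
  · intro j _ s₂ hs₂ hj
    simp only [NumExp.eval, NatExp.eval, hj, d]
    rw [hs₂.2 a (by omega), hs₂.2 6 (by norm_num), hF₁.2 a (by omega), hF₁.2 6 (by norm_num)]
  · intro j hj s₂ hs₂ hj'
    have h11 : s₂.nat 11 = k := by rw [hs₂.1 11 (by norm_num)]; simp [hs₁]
    simp only [μ, dif_pos hj]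
    exact hQ.mean s₂ ⟨k, hk⟩ ⟨j, hj⟩ h11 hj'
  have hsum1 : ∑ j ∈ Finset.range S.R, ‖d j‖ ^ 2 = ∑ j : Fin S.R, ‖(w j : ℂ) * s.num 6 j 0‖ ^ 2 := by
    rw [Finset.sum_range]
    simp only [d, hw]
  have hsum2 : ∑ j ∈ Finset.range S.R, d j * μ j = ∑ j : Fin S.R,
      w j * s.num 6 j 0 * ampInner (C ⟨k, hk⟩).state (C j).state := by
    rw [Finset.sum_range]
    simp only [d, μ, hw, Fin.is_lt, dif_pos, Fin.eta]
  rw [hsum1, hsum2] at hest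
  have hexp : (m * η) ^ 2 / (16 * (m * v)) = m * η ^ 2 / (16 * v) := by field_simp
  rw [hexp] at hest
  refine (Bound.seq (t' := 19) (hest.add_const _) fun s₂ hs₂ => Bound.setNum ?_ ?_ ?_).weaken le_rfl
    (fun _ h => h) (fun _ _ => le_rfl) le_rfl
  · simp [NatExp.cost, NumExp.cost]
  · exact (hF₁.trans (hs₂.mono (by norm_num) (by norm_num))).trans (Frame.setNum le_rfl _ _ _)
  · refine ind_le_add ?_
    contrapose!
    rintro ⟨h1, h2⟩ hV i hi
    have h11 : s₂.nat 11 = k := by rw [hs₂.1 11 (by norm_num)]; simp [hs₁]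
    have h6 : s₂.nat 6 = m := by rw [hs₂.1 6 (by norm_num), hF₁.1 6 (by norm_num), hm]
    simp only [NatExp.eval, NumExp.eval, Store.setNum_num, h11, h6, true_and, and_true]
    split_ifs with hik
    · have hik' : i = ⟨k, hk⟩ := Fin.ext hik
      subst hik'
      have h3 := h1 (by gcongr)
      rw [hs₂.2 5 (by norm_num), hs₂.2 a (by omega), hF₁.2 5 (by norm_num), hF₁.2 a (by omega)]
      have hwk := hw ⟨k, hk⟩
      dsimp only at hwk
      rw [hwk]
      set X : ℂ := ∑ j : Fin S.R, w j * s.num 6 j 0 * ampInner (C ⟨k, hk⟩).state (C j).state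
      have hmc : (m : ℂ) ≠ 0 := by exact_mod_cast hm0.ne'
      have e : s.num 5 k 0 - (w ⟨k, hk⟩ : ℂ) * s₂.num 8 0 0 / m -
          (s.num 5 k 0 - (w ⟨k, hk⟩ : ℂ) * X) =
          -((w ⟨k, hk⟩ : ℂ) * ((s₂.num 8 0 0 - m * X) / m)) := by field_simp; ring
      rw [e, norm_neg, norm_mul, Complex.norm_real, Real.norm_of_nonneg (hw0 _), norm_div,
        Complex.norm_natCast]
      have := hw0 ⟨k, hk⟩
      gcongr
      rw [div_le_iff₀ hm0']
      linarith
    · rw [hs₂.2 7 (by norm_num)]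
      exact h2 hV i (by omega)

theorem bound_updateProg {c : ℕ} {σ : ℝ} (hR : s.nat 0 = S.R) (hσ : s.num 2 c 0 = σ) :
    Bound S (updateProg c) s (2 + S.R * 21)
      (fun s' => Frame 11 6 s s' ∧ ∀ i : Fin S.R,
        s'.num 6 i 0 = s.num 6 i 0 + s.num 7 i 0 / (σ * σ)) (fun _ => 0) 0 := by
  refine (Bound.loop (n := S.R) (t := 20) (show NatExp.eval s (.reg 0) = S.R from hR)
    (fun k s' => Frame 11 6 s s' ∧ s'.num 7 = s.num 7 ∧
    ∀ i : Fin S.R, s'.num 6 i 0 = if (i : ℕ) < k then s.num 6 i 0 + s.num 7 i 0 / (σ * σ)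
      else s.num 6 i 0) (fun _ _ => 0) ⟨Frame.refl _ _ _, rfl, by simp⟩
    fun k hk s' hs' => Bound.setNum ?_ ?_ le_rfl).weaken (by simp [NatExp.cost])
      (fun s' h => ⟨h.1, fun i => by rw [h.2.2 i, if_pos i.2]⟩) (fun _ _ => le_rfl) le_rfl
  · simp [NatExp.cost, NumExp.cost]
  · obtain ⟨hF, h7, h6⟩ := hs'
    refine ⟨(hF.trans (Frame.setNat le_rfl _)).trans (Frame.setNum le_rfl _ _ _), ?_, fun i => ?_⟩
    · rw [← h7]
      funext i j
      simp
    · simp only [NatExp.eval, NumExp.eval, Store.setNum_num, Store.setNat_nat, if_true,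
        Store.setNat_num, true_and, and_true]
      by_cases hik : (i : ℕ) = k
      · rw [if_pos hik, if_pos (by omega), ← hik, h6, if_neg (by omega), h7,
          hF.2 2 (by norm_num), hσ]
      · rw [if_neg hik, h6]
        by_cases h : (i : ℕ) < k
        · rw [if_pos h, if_pos (by omega)]
        · rw [if_neg h, if_neg (by omega)]

/-- A bound for the time of one step of the iteration. -/
def stepTime (R m g : ℕ) : ℕ := 4 + R * (estimateTime R m g + 41)

/-- In the ball of radius 3Y the squared weights sum to at most (3σY)², as every w_j ≤ σ. A row
error w_i · 6σYη, divided by σ², is at most 6Yη, and R rows give √R. -/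
theorem bound_step {c : ℕ} {σ Y η : ℝ} (ha : a < 6) (hQ : IsGramQuery S Q C g)
    (hC : ∀ j, PreparesIn N (C j)) (hR : s.nat 0 = S.R) (hw : ∀ i : Fin S.R, s.num a i 0 = w i)
    (hw0 : ∀ i, 0 ≤ w i) (hm : s.nat 6 = m) (hm0 : 0 < m) (hc : s.num 2 c 0 = σ) (hσ0 : 0 < σ)
    (hσ : ∀ y, ‖(columnMatrix w C).toEuclideanLin y‖ ≤ σ * ‖y‖) (hY : 0 < Y) (hη : 0 ≤ η) :
    Bound S (.seq (residualProg a Q) (updateProg c)) s (stepTime S.R m g) (Frame 11 6 s)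
      (fun s' => ind ¬(‖s.vec 6 S.R‖ ≤ 3 * Y → ‖s'.vec 6 S.R - (s.vec 6 S.R +
        (((σ ^ 2)⁻¹ : ℝ) : ℂ) • (s.vec 5 S.R - (columnMatrix w C).toEuclideanLin.adjoint
          ((columnMatrix w C).toEuclideanLin (s.vec 6 S.R))))‖ ≤ √S.R * (6 * Y * η)))
      (S.R * (4 * ENNReal.ofReal (Real.exp (-(m * η ^ 2 / 16))))) := by
  have hres := bound_residualProg (η := 3 * σ * Y * η) (v := (3 * σ * Y) ^ 2) ha hQ hR hw hw0 hm hm0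
    (by positivity) (by positivity)
  have he : m * (3 * σ * Y * η) ^ 2 / (16 * (3 * σ * Y) ^ 2) = m * η ^ 2 / 16 := by field_simp
  rw [he] at hres
  refine (Bound.seq hres fun s₁ hs₁ => ((bound_updateProg (σ := σ)
    (by rw [hs₁.1 0 (by norm_num), hR]) (by rw [hs₁.2 2 (by norm_num), hc])).of_always
      (f := fun s' => ind ¬(‖s.vec 6 S.R‖ ≤ 3 * Y → ‖s'.vec 6 S.R - (s.vec 6 S.R +
        (((σ ^ 2)⁻¹ : ℝ) : ℂ) • (s.vec 5 S.R - (columnMatrix w C).toEuclideanLin.adjoint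
          ((columnMatrix w C).toEuclideanLin (s.vec 6 S.R))))‖ ≤ √S.R * (6 * Y * η)))
      fun s₂ hs₂ => ind_mono (mt ?_)).weaken le_rfl
        (fun s₂ hs₂ => (hs₁.mono le_rfl (by norm_num)).trans hs₂.1) (fun _ _ => le_rfl)
        le_rfl).weaken (le_of_eq (by rw [stepTime]; ring)) (fun _ h => h) (fun _ _ => le_rfl) le_rfl
  intro hgood hy
  have hws := weight_le hw0 hC hσ
  have hsum : ∑ j : Fin S.R, ‖(w j : ℂ) * s.num 6 j 0‖ ^ 2 ≤ (3 * σ * Y) ^ 2 := by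
    calc _ ≤ ∑ j : Fin S.R, σ ^ 2 * ‖s.vec 6 S.R j‖ ^ 2 := by
          gcongr with j
          rw [norm_mul, mul_pow, Complex.norm_real, Real.norm_of_nonneg (hw0 j), s.vec_apply]
          have := hw0 j
          gcongr
          exact hws j
      _ = σ ^ 2 * ‖s.vec 6 S.R‖ ^ 2 := by rw [← Finset.mul_sum, EuclideanSpace.norm_sq_eq]
      _ ≤ σ ^ 2 * (3 * Y) ^ 2 := by gcongr
      _ = _ := by ring
  have hg := hgood hsum
  rw [← Real.sqrt_sq (show 0 ≤ 6 * Y * η by positivity), ← Real.sqrt_mul (by positivity),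
    EuclideanSpace.norm_eq]
  refine Real.sqrt_le_sqrt ?_
  calc _ ≤ ∑ _i : Fin S.R, (6 * Y * η) ^ 2 := by
        refine Finset.sum_le_sum fun i _ => ?_
        gcongr
        have h1 := hg i
        simp only [PiLp.sub_apply, PiLp.add_apply, PiLp.smul_apply, Store.vec_apply,
          gram_columnMatrix_apply hC, hs₂.2 i, hs₁.2 6 (by norm_num), smul_eq_mul]
        set X := s.num 5 i 0 - w i * ∑ j : Fin S.R,
          w j * s.num 6 j 0 * ampInner (C i).state (C j).state
        have e : s.num 6 i 0 + s₁.num 7 i 0 / (σ * σ) -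
            (s.num 6 i 0 + (((σ ^ 2)⁻¹ : ℝ) : ℂ) * X) =
            (((σ ^ 2)⁻¹ : ℝ) : ℂ) * (s₁.num 7 i 0 - X) := by
          push_cast
          rw [div_eq_inv_mul, sq]
          ring
        rw [e, norm_mul, Complex.norm_real, Real.norm_of_nonneg (by positivity)]
        calc _ ≤ (σ ^ 2)⁻¹ * (σ * (2 * (3 * σ * Y * η))) := by
              gcongr
              exact h1.trans (by gcongr; exact hws i)
          _ = 6 * Y * η := by field_simp; ring
    _ = _ := by simp

/-- The vector `z` need only solve the equations up to a defect, which counts as a second error η'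
in each step; hence 2η'. Inductively, small accumulated noise keeps the iterate in the ball that
`bound_step` requires. -/
theorem bound_solveProg {c T : ℕ} {σ Y η η' : ℝ} (ha : a < 5) (hQ : IsGramQuery S Q C g)
    (hC : ∀ j, PreparesIn N (C j)) (hR : s.nat 0 = S.R) (hw : ∀ i : Fin S.R, s.num a i 0 = w i)
    (hw0 : ∀ i, 0 ≤ w i) (hm : s.nat 6 = m) (hm0 : 0 < m) (hc : s.num 2 c 0 = σ) (hσ0 : 0 < σ)
    (hσ : ∀ y, ‖(columnMatrix w C).toEuclideanLin y‖ ≤ σ * ‖y‖) (hY : 0 < Y) (hη : 0 ≤ η)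
    (hT : s.nat 5 = T) (h0 : s.vec 6 S.R = 0) (hη' : √S.R * (6 * Y * η) ≤ η') 
    (z : EuclideanSpace ℂ (Fin S.R)) (hTY : T * (2 * η') ≤ Y) :
    Bound S (solveProg a Q c) s (2 + T * (stepTime S.R m g + 1)) (Frame 10 6 s)
      (fun s' => ind ¬(‖z‖ ≤ Y → ‖(((σ ^ 2)⁻¹ : ℝ) : ℂ) • (s.vec 5 S.R -
        (columnMatrix w C).toEuclideanLin.adjoint ((columnMatrix w C).toEuclideanLin z))‖ ≤ η' →
        ‖s'.vec 6 S.R - z - (richardson (columnMatrix w C).toEuclideanLin σ ^ T) (-z)‖ ≤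
          T * (2 * η')))
      (T * (S.R * (4 * ENNReal.ofReal (Real.exp (-(m * η ^ 2 / 16)))))) := by
  have hη'0 : 0 ≤ η' := le_trans (by positivity) hη'
  refine (Bound.loop_fail (n := T) (t := stepTime S.R m g)
    (show NatExp.eval s (.reg 5) = T from hT) (fun _ => Frame 10 6 s)
    (fun t s' => ‖z‖ ≤ Y → ‖(((σ ^ 2)⁻¹ : ℝ) : ℂ) • (s.vec 5 S.R -
        (columnMatrix w C).toEuclideanLin.adjoint ((columnMatrix w C).toEuclideanLin z))‖ ≤ η' →
        ‖s'.vec 6 S.R - z - (richardson (columnMatrix w C).toEuclideanLin σ ^ t) (-z)‖ ≤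
          t * (2 * η')) _ (Frame.refl _ _ _) (fun _ _ => by simp [h0])
    fun t ht s' hs' => ?_).weaken (by simp [NatExp.cost]) (fun _ h => h) (fun _ _ => le_rfl) le_rfl
  have hF : Frame 10 6 s (s'.setNat 10 t) := hs'.trans (Frame.setNat le_rfl _)
  refine ((bound_step (s := s'.setNat 10 t) (c := c) (σ := σ) (w := w) (C := C) (by omega) hQ hC
    (by rw [hF.1 0 (by norm_num), hR]) (fun i => by rw [hF.2 a (by omega), hw]) hw0
    (by rw [hF.1 6 (by norm_num), hm]) hm0 (by rw [hF.2 2 (by norm_num), hc]) hσ0 hσ hY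
    hη).add_const _).weaken le_rfl (fun s'' h => hF.trans (h.mono (by norm_num) le_rfl))
      (fun s'' _ => ind_le_add ?_) le_rfl
  contrapose!
  rintro ⟨h1, h2⟩ hz hg
  have h3 := h2 hz hg
  have h4 : (t : ℝ) * (2 * η') ≤ Y := by
    refine le_trans ?_ hTY
    have : (t : ℝ) ≤ T := by exact_mod_cast ht.le
    gcongr
  have hvec : (s'.setNat 10 t).vec 6 S.R = s'.vec 6 S.R := rfl
  have h5 := h1 (by rw [hvec]; exact norm_le_of_richardson hσ0 hσ h3 hz h4)
  rw [hF.vec_eq (b := 5) (by norm_num), hvec] at h5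
  refine norm_richardson_step_le hσ0 hσ h3 ?_
  set G := (columnMatrix w C).toEuclideanLin
  set τ : ℂ := (((σ ^ 2)⁻¹ : ℝ) : ℂ)
  have e : s''.vec 6 S.R - (s'.vec 6 S.R + τ • (G.adjoint (G z) - G.adjoint (G (s'.vec 6 S.R)))) =
      (s''.vec 6 S.R - (s'.vec 6 S.R + τ • (s.vec 5 S.R - G.adjoint (G (s'.vec 6 S.R))))) +
        τ • (s.vec 5 S.R - G.adjoint (G z)) := by
    simp only [smul_sub]; abel
  rw [e]
  refine (norm_add_le _ _).trans ?_
  linarith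

end Solve

end Hybrid

/-! ### Right-hand side, copying and output; accuracy of a solve -/

namespace Hybrid

open scoped ENNReal

variable {S : FactorizedSystem}

/-! ### Further parts of the program -/

/-- The program that estimates the inner products of the `u_i` with `b` in array 5. -/
def rhsProg : Prog :=
  .loop 11 (.reg 0) (.seq
    (estimate (.lit 1) (.ub (.reg 11)) (.entry 2 zeroExp zeroExp))
    (.setNum 5 (.reg 11) zeroExp
      (.div (.mul (.entry 0 (.reg 11) zeroExp) (.entry 8 zeroExp zeroExp)) (.ofNat (.reg 6)))))

/-- The program that moves the vector in array 6 to array 5. -/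
def moveProg : Prog :=
  .loop 11 (.reg 0) (.seq (.setNum 5 (.reg 11) zeroExp (.entry 6 (.reg 11) zeroExp))
    (.setNum 6 (.reg 11) zeroExp (.lit 0)))

/-- The program that multiplies the vector in array 6 with the norms of the `v_j`. -/
def outProg : Prog :=
  .loop 11 (.reg 0) (.setNum 3 (.reg 11) zeroExp
    (.mul (.entry 1 (.reg 11) zeroExp) (.entry 6 (.reg 11) zeroExp)))

theorem lookup_of_lt {R n : ℕ} (c : Fin R → Circuit n) (i : Fin R) :
    FactorizedSystem.lookup c i = c i := dif_pos i.2

theorem length_gates_lookup_le {R n q : ℕ} (c : Fin R → Circuit n)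
    (h : ∀ j, (c j).gates.length ≤ q) (i : ℕ) :
    (FactorizedSystem.lookup c i).gates.length ≤ q := by
  unfold FactorizedSystem.lookup
  split_ifs
  · exact h _
  · exact Nat.zero_le _

theorem isGramQuery_uu {q : ℕ} (h : ∀ j, (S.circU j).gates.length ≤ q) :
    IsGramQuery S Query.uu S.circU (2 * q + 5) where
  mean s i j hi hj := by
    simp only [Query.mean, NatExp.eval, hi, hj, lookup_of_lt]
  cost s ph := by
    simp only [FactorizedSystem.testCost, NatExp.cost]
    have := length_testGates_le ph (FactorizedSystem.lookup S.circU (NatExp.eval s (.reg 11)))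
      (FactorizedSystem.lookup S.circU (NatExp.eval s (.reg 12)))
    have := length_gates_lookup_le S.circU h (NatExp.eval s (.reg 11))
    have := length_gates_lookup_le S.circU h (NatExp.eval s (.reg 12))
    omega

theorem isGramQuery_vv {q : ℕ} (h : ∀ j, (S.circV j).gates.length ≤ q) :
    IsGramQuery S Query.vv S.circV (2 * q + 5) where
  mean s i j hi hj := by
    simp only [Query.mean, NatExp.eval, hi, hj, lookup_of_lt]
  cost s ph := by
    simp only [FactorizedSystem.testCost, NatExp.cost]
    have := length_testGates_le ph (FactorizedSystem.lookup S.circV (NatExp.eval s (.reg 11)))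
      (FactorizedSystem.lookup S.circV (NatExp.eval s (.reg 12)))
    have := length_gates_lookup_le S.circV h (NatExp.eval s (.reg 11))
    have := length_gates_lookup_le S.circV h (NatExp.eval s (.reg 12))
    omega

theorem testCost_ub_le {q : ℕ} (h : ∀ j, (S.circU j).gates.length ≤ q)
    (hb : S.circB.gates.length ≤ q) (s : Store) (ph : Bool) :
    S.testCost s ph (.ub (.reg 11)) ≤ 2 * q + 5 := by
  simp only [FactorizedSystem.testCost, NatExp.cost]
  have := length_testGates_le ph (FactorizedSystem.lookup S.circU (NatExp.eval s (.reg 11)))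
    S.circB
  have := length_gates_lookup_le S.circU h (NatExp.eval s (.reg 11))
  omega

theorem A₁_eq_columnMatrix : S.A₁ = columnMatrix S.normU S.circU := rfl

theorem conjTranspose_A₂ : S.A₂ᴴ = columnMatrix S.normV S.circV := by
  ext i j
  simp [FactorizedSystem.A₂, columnMatrix, Matrix.conjTranspose_apply]

theorem norm_toLp_b : ‖WithLp.toLp 2 S.b‖ = S.normB := by
  have : WithLp.toLp 2 S.b = (S.normB : ℂ) • WithLp.toLp 2 (ketOf S.N S.circB) := rfl
  rw [this, norm_smul, norm_toLp_ketOf _ S.preparesB]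
  simp [abs_of_pos S.normB_pos]

theorem adjoint_A₁_b (i : Fin S.R) : S.A₁.toEuclideanLin.adjoint (WithLp.toLp 2 S.b) i =
    S.normU i * (S.normB * ampInner (S.circU i).state S.circB.state) := by
  rw [A₁_eq_columnMatrix, adjoint_columnMatrix_apply, ← sum_star_ketOf_mul _ _ S.preparesB]
  congr 1
  rw [Finset.mul_sum]
  exact Finset.sum_congr rfl fun k _ => mul_left_comm _ _ _

variable {s : Store} {m g : ℕ}

/-- A row is a single inner product with weight ‖b‖, so the variance budget is m‖b‖². -/
theorem bound_rhsProg {σ η : ℝ} (hg : ∀ s ph, S.testCost s ph (.ub (.reg 11)) ≤ g)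
    (hR : s.nat 0 = S.R) (hw : ∀ i : Fin S.R, s.num 0 i 0 = S.normU i)
    (hB : s.num 2 0 0 = S.normB) (hm : s.nat 6 = m) (hm0 : 0 < m) (hη : 0 ≤ η) (hσ0 : 0 ≤ σ)
    (hσ : ∀ j, S.normU j ≤ σ) :
    Bound S rhsProg s (2 + S.R * (estimateTime 1 m g + 20))
      (fun s' => Frame 11 5 s s' ∧ s'.num 6 = s.num 6)
      (fun s' => ind ¬(‖s'.vec 5 S.R - S.A₁.toEuclideanLin.adjoint (WithLp.toLp 2 S.b)‖ ≤
        √S.R * (2 * σ * S.normB * η)))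
      (S.R * (4 * ENNReal.ofReal (Real.exp (-(m * η ^ 2 / 16))))) := by
  have hm0' : (0 : ℝ) < m := by exact_mod_cast hm0
  have hBpos := S.normB_pos
  refine (Bound.loop_fail (n := S.R) (t := estimateTime 1 m g + 19)
    (show NatExp.eval s (.reg 0) = S.R from hR) (fun _ s' => Frame 11 5 s s' ∧ s'.num 6 = s.num 6)
    (fun k s' => ∀ i : Fin S.R, (i : ℕ) < k →
      ‖s'.num 5 i 0 - S.normU i * (S.normB * ampInner (S.circU i).state S.circB.state)‖ ≤
        2 * σ * S.normB * η) _
    ⟨Frame.refl _ _ _, rfl⟩ (fun i hi => absurd hi (Nat.not_lt_zero _))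
    fun k hk s' hs' => ?_).weaken
      (by simp [NatExp.cost]) (fun _ h => h) (fun s' _ => ind_mono (mt ?_)) le_rfl
  swap
  · intro h
    rw [← Real.sqrt_sq (show 0 ≤ 2 * σ * S.normB * η by positivity),
      ← Real.sqrt_mul (by positivity), EuclideanSpace.norm_eq]
    refine Real.sqrt_le_sqrt ?_
    calc _ ≤ ∑ _i : Fin S.R, (2 * σ * S.normB * η) ^ 2 := by
          refine Finset.sum_le_sum fun i _ => ?_
          gcongr
          rw [PiLp.sub_apply, Store.vec_apply, adjoint_A₁_b]
          exact h i i.2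
      _ = _ := by simp
  set s₁ := s'.setNat 11 k with hs₁
  have hF₁ : Frame 11 5 s s₁ := hs'.1.trans (Frame.setNat le_rfl _)
  set μ := ampInner (S.circU ⟨k, hk⟩).state S.circB.state
  have hest := bound_estimate (S := S) (J := .lit 1) (q := .ub (.reg 11))
    (e := .entry 2 zeroExp zeroExp) (s := s₁) (n := 1)
    (m := m) (g := g) (d := fun _ => S.normB) (μ := fun _ => μ) (V := m * S.normB ^ 2)
    (h := m * (S.normB * η))
    rfl rfl (by rw [hF₁.1 6 (by norm_num), hm])
    (by simp [NumExp.cost, NatExp.cost])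
    (fun j _ s₂ hs₂ _ => by
      simp only [NumExp.eval, NatExp.eval]
      rw [hs₂.2 2 (by norm_num), hF₁.2 2 (by norm_num), hB])
    (fun j _ s₂ hs₂ _ => by
      have h11 : s₂.nat 11 = k := by rw [hs₂.1 11 (by norm_num)]; simp [hs₁]
      simp only [Query.mean, NatExp.eval, h11]
      rw [lookup_of_lt S.circU ⟨k, hk⟩]) hg (by positivity) (by positivity)
  have hexp : (m * (S.normB * η)) ^ 2 / (16 * (m * S.normB ^ 2)) = m * η ^ 2 / 16 := by field_simp
  rw [hexp] at hest
  refine (Bound.seq (t' := 19) (hest.add_const _) fun s₂ hs₂ => Bound.setNum ?_ ?_ ?_).weaken le_rfl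
    (fun _ h => h) (fun _ _ => le_rfl) le_rfl
  · simp [NatExp.cost, NumExp.cost]
  · refine ⟨(hF₁.trans (hs₂.mono (by norm_num) (by norm_num))).trans (Frame.setNum le_rfl _ _ _), ?_⟩
    rw [← hs'.2]
    funext i j
    simp [hs₂.2 6, hs₁]
  · refine ind_le_add ?_
    contrapose!
    rintro ⟨h1, h2⟩ i hi
    have h11 : s₂.nat 11 = k := by rw [hs₂.1 11 (by norm_num)]; simp [hs₁]
    have h6 : s₂.nat 6 = m := by rw [hs₂.1 6 (by norm_num), hF₁.1 6 (by norm_num), hm]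
    simp only [NatExp.eval, NumExp.eval, Store.setNum_num, h11, h6, true_and, and_true]
    split_ifs with hik
    · have hik' : i = ⟨k, hk⟩ := Fin.ext hik
      subst hik'
      have h3 := h1 (by simp)
      rw [hs₂.2 0 (by norm_num), hF₁.2 0 (by norm_num)]
      have hwk := hw ⟨k, hk⟩
      dsimp only at hwk
      rw [hwk]
      simp only [Finset.range_one, Finset.sum_singleton] at h3
      have hmc : (m : ℂ) ≠ 0 := by exact_mod_cast hm0.ne'
      have e : (S.normU ⟨k, hk⟩ : ℂ) * s₂.num 8 0 0 / m - S.normU ⟨k, hk⟩ * (S.normB * μ) =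
          (S.normU ⟨k, hk⟩ : ℂ) * ((s₂.num 8 0 0 - m * (S.normB * μ)) / m) := by field_simp
      have hu := S.normU_nonneg ⟨k, hk⟩
      rw [e, norm_mul, Complex.norm_real, Real.norm_of_nonneg hu, norm_div, Complex.norm_natCast]
      calc _ ≤ σ * (2 * (S.normB * η)) := by
            gcongr
            · exact hσ _
            · rw [div_le_iff₀ hm0']
              linarith
        _ = _ := by ring
    · rw [hs₂.2 5 (by norm_num)]
      exact h2 i (by omega)

theorem bound_moveProg (hR : s.nat 0 = S.R) :
    Bound S moveProg s (2 + S.R * 20)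
      (fun s' => Frame 11 5 s s' ∧ s'.vec 5 S.R = s.vec 6 S.R ∧ s'.vec 6 S.R = 0)
      (fun _ => 0) 0 := by
  refine (Bound.loop (n := S.R) (t := 19) (show NatExp.eval s (.reg 0) = S.R from hR)
    (fun k s' => Frame 11 5 s s' ∧ ∀ i : Fin S.R,
      ((i : ℕ) < k → s'.num 5 i 0 = s.num 6 i 0 ∧ s'.num 6 i 0 = 0) ∧
      (k ≤ (i : ℕ) → s'.num 6 i 0 = s.num 6 i 0))
    (fun _ _ => 0) ⟨Frame.refl _ _ _, by simp⟩
    fun k hk s' hs' => Bound.seq (t := 8) (t' := 11) (A := fun s'' => s'' = (s'.setNat 11 k).setNum 5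
      k 0 (s'.num 6 k 0)) (f := fun _ => 0) (Bound.setNum ?_ ?_ le_rfl) ?_).weaken
      (by simp [NatExp.cost])
      (fun s' h => ⟨h.1, ?_, ?_⟩) (fun _ _ => le_rfl) le_rfl
  · simp [NatExp.cost, NumExp.cost]
  · simp [NatExp.eval, NumExp.eval]
  · rintro s'' rfl
    refine Bound.setNum ?_ ⟨?_, fun i => ⟨fun hi => ?_, fun hi => ?_⟩⟩ le_rfl
    · simp [NatExp.cost, NumExp.cost]
    · exact ((hs'.1.trans (Frame.setNat le_rfl _)).trans (Frame.setNum le_rfl _ _ _)).trans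
        (Frame.setNum (by norm_num) _ _ _)
    · simp only [NatExp.eval, NumExp.eval, Store.setNum_num, Store.setNat_nat, Store.setNum_nat,
        if_true, Store.setNat_num, true_and, and_true]
      by_cases hik : (i : ℕ) = k
      · simp [hik, (hs'.2 ⟨k, hk⟩).2 le_rfl]
      · simpa [hik] using (hs'.2 i).1 (by omega)
    · have hik : (i : ℕ) ≠ k := by omega
      simpa [NatExp.eval, hik] using (hs'.2 i).2 (by omega)
  · ext i
    exact ((h.2 i).1 i.2).1
  · ext i
    exact ((h.2 i).1 i.2).2

theorem bound_outProg (hR : s.nat 0 = S.R) (hw : ∀ i : Fin S.R, s.num 1 i 0 = S.normV i) :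
    Bound S outProg s (2 + S.R * 20)
      (fun s' => ∀ i, S.output s' i = S.normV i * s.vec 6 S.R i) (fun _ => 0) 0 := by
  refine (Bound.loop (n := S.R) (t := 19) (show NatExp.eval s (.reg 0) = S.R from hR)
    (fun k s' => s'.num 1 = s.num 1 ∧ s'.num 6 = s.num 6 ∧ ∀ i : Fin S.R,
      (i : ℕ) < k → s'.num 3 i 0 = s.num 1 i 0 * s.num 6 i 0)
    (fun _ _ => 0) ⟨rfl, rfl, by simp⟩
    fun k hk s' hs' => Bound.setNum ?_ ⟨?_, ?_, fun i hi => ?_⟩ le_rfl).weaken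
      (by simp [NatExp.cost])
      (fun s' h i => ?_) (fun _ _ => le_rfl) le_rfl
  · simp [NatExp.cost, NumExp.cost]
  · rw [← hs'.1]; funext i j; simp
  · rw [← hs'.2.1]; funext i j; simp
  · by_cases hik : (i : ℕ) = k
    · simp [NatExp.eval, NumExp.eval, hik, hs'.1, hs'.2.1]
    · simpa [NatExp.eval, hik] using hs'.2.2 i (by omega)
  · rw [FactorizedSystem.output, h.2.2 i i.2, hw]
    rfl

/-! ### Accuracy of the iteration -/

/-- Half of the error is accumulated noise, kept below Y/X by the choice of η; the other half is the
truncation error 2^(−L)‖z‖. -/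
theorem bound_solveProg_accurate {N a : ℕ} {Q : NatExp → NatExp → Query} {w : Fin S.R → ℝ}
    {C : Fin S.R → Circuit (Nat.clog 2 N)} {c T L : ℕ} {σ ρ Y η X : ℝ} (ha : a < 5)
    (hQ : IsGramQuery S Q C g) (hC : ∀ j, PreparesIn N (C j)) (hR : s.nat 0 = S.R)
    (hw : ∀ i : Fin S.R, s.num a i 0 = w i)
    (hw0 : ∀ i, 0 ≤ w i) (hm : s.nat 6 = m) (hm0 : 0 < m) (hc : s.num 2 c 0 = σ) (hσ0 : 0 < σ)
    (hσ : ∀ y, ‖(columnMatrix w C).toEuclideanLin y‖ ≤ σ * ‖y‖) (hρ0 : 0 < ρ) (hρσ : ρ ≤ σ)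
    (hρ : ∀ y ∈ (LinearMap.ker (columnMatrix w C).toEuclideanLin)ᗮ,
      ρ * ‖y‖ ≤ ‖(columnMatrix w C).toEuclideanLin y‖) (hY : 0 < Y) (hη : 0 ≤ η)
    (hT : s.nat 5 = T) (h0 : s.vec 6 S.R = 0) (hX : 1 ≤ X) (hLX : X ≤ 2 ^ L)
    (hTL : 2 * (σ / ρ) ^ 2 * L ≤ T) (hηX : 12 * T * √S.R * η * X ≤ 1)
    (z : EuclideanSpace ℂ (Fin S.R))
    (hz : z ∈ (LinearMap.ker (columnMatrix w C).toEuclideanLin)ᗮ) :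
    Bound S (solveProg a Q c) s (2 + T * (stepTime S.R m g + 1)) (Frame 10 6 s)
      (fun s' => ind ¬(‖z‖ ≤ Y → ‖(((σ ^ 2)⁻¹ : ℝ) : ℂ) • (s.vec 5 S.R -
        (columnMatrix w C).toEuclideanLin.adjoint ((columnMatrix w C).toEuclideanLin z))‖ ≤
          √S.R * (6 * Y * η) → ‖s'.vec 6 S.R - z‖ ≤ 2 * Y / X))
      (T * (S.R * (4 * ENNReal.ofReal (Real.exp (-(m * η ^ 2 / 16)))))) := by
  have hX0 : 0 < X := by linarith
  have h1 : T * (2 * (√S.R * (6 * Y * η))) ≤ Y / X := by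
    rw [le_div_iff₀ hX0]
    calc _ = Y * (12 * T * √S.R * η * X) := by ring
      _ ≤ Y * 1 := by gcongr
      _ = Y := mul_one Y
  refine (bound_solveProg (σ := σ) (w := w) (C := C) ha hQ hC hR hw hw0 hm hm0 hc hσ0 hσ hY hη hT
    h0 le_rfl z (h1.trans (div_le_self hY.le hX))).weaken le_rfl (fun _ h => h)
      (fun s' _ => ind_mono (mt fun h hzY hrhs => ?_)) le_rfl
  have h2 := h hzY hrhs
  have h3 := norm_richardson_pow_le hσ0 hσ hρ0 hρσ hρ (neg_mem hz) hTL
  rw [norm_neg] at h3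
  calc ‖s'.vec 6 S.R - z‖ = ‖(s'.vec 6 S.R - z -
        (richardson (columnMatrix w C).toEuclideanLin σ ^ T) (-z)) +
        (richardson (columnMatrix w C).toEuclideanLin σ ^ T) (-z)‖ := by rw [sub_add_cancel]
    _ ≤ Y / X + (2 ^ L)⁻¹ * ‖z‖ := (norm_add_le _ _).trans (add_le_add (h2.trans h1) h3)
    _ ≤ Y / X + X⁻¹ * Y := by gcongr
    _ = 2 * Y / X := by ring

end Hybrid

namespace Hybrid

open scoped ENNReal

/-! ### The parameters of the algorithm -/

namespace FactorizedSystem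

variable (S : FactorizedSystem)

/-- The factor by which the iteration has to reduce the error. -/
def reduction (ε : ℝ) : ℝ :=
  -- The errors of the second and first solve contribute 6 + 2 = 8. The summand 1 makes X > 1 when
  -- A₁ ≠ 0, so that L and T are positive.
  1 + 8 * condNumber S.A₁ * (condNumber S.A₂ * condNumber S.A₂) * S.normB / ε

/-- The binary logarithm of `R` times the reduction factor, rounded up. -/
def logReduction (ε : ℝ) : ℕ := Nat.clog 2 ⌈S.R * S.reduction ε⌉₊

/-- The number of steps of the iteration. -/
def steps (ε : ℝ) : ℕ := ⌈2 * (condNumber S.A₁ * condNumber S.A₁ +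
  -- A single number of steps that is large enough for both matrices.
  condNumber S.A₂ * condNumber S.A₂) * S.logReduction ε⌉₊

/-- The number of samples for each inner product. -/
def samples (ε : ℝ) (k : ℕ) : ℕ := ⌈2304 * S.R * ((S.steps ε * S.steps ε) *
  -- 2304 = 16 · 12²: with η = 1/(12 T √R X) this makes mη²/16 at least k + T + L + 3.
  (S.reduction ε * S.reduction ε)) * ((k + S.steps ε + S.logReduction ε + 3 : ℕ) : ℝ)⌉₊

end FactorizedSystem

/-- An entry of array 2. -/
abbrev inputExp (i : ℕ) : NumExp := .entry 2 (.lit i) zeroExp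

/-- The condition number of the first matrix. -/
abbrev cond₁Exp : NumExp := .div (inputExp 2) (inputExp 3)

/-- The condition number of the second matrix. -/
abbrev cond₂Exp : NumExp := .div (inputExp 4) (inputExp 5)

/-- The program that computes the reduction factor in array 4, its logarithm in register 4, the
number of steps in register 5 and the number of samples in register 6. -/
def paramProg : Prog :=
  .seq (.setNum 4 zeroExp zeroExp (.add (.lit 1) (.div (.mul (.mul (.mul (.lit 8) cond₁Exp)
    (.mul cond₂Exp cond₂Exp)) (inputExp 0)) (inputExp 1))))
  (.seq (.ceil 7 (.mul (.ofNat (.reg 0)) (.entry 4 zeroExp zeroExp)))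
  (.seq (.setNum 4 (.lit 1) zeroExp (.lit 1))
  (.seq (.loop 10 (.reg 7) (.ite (.reLE (.mul (.ofNat (.reg 0)) (.entry 4 zeroExp zeroExp))
      (.entry 4 (.lit 1) zeroExp)) .skip
    (.seq (.setNum 4 (.lit 1) zeroExp (.mul (.lit 2) (.entry 4 (.lit 1) zeroExp)))
      (.setNat 4 (.add (.reg 4) (.lit 1))))))
  (.seq (.ceil 5 (.mul (.mul (.lit 2) (.add (.mul cond₁Exp cond₁Exp) (.mul cond₂Exp cond₂Exp)))
    (.ofNat (.reg 4))))
  (.ceil 6 (.mul (.mul (.mul (.lit 2304) (.ofNat (.reg 0)))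
    (.mul (.mul (.ofNat (.reg 5)) (.ofNat (.reg 5)))
      (.mul (.entry 4 zeroExp zeroExp) (.entry 4 zeroExp zeroExp))))
    (.ofNat (.add (.add (.add (.reg 3) (.reg 5)) (.reg 4)) (.lit 3)))))))))

variable {S : FactorizedSystem} {s : Store} {ε : ℝ} {k : ℕ}

/-- This comparison is what the program tests while it finds the logarithm by doubling. -/
theorem two_pow_le_iff (i : ℕ) :
    S.R * S.reduction ε ≤ (2 : ℝ) ^ i ↔ S.logReduction ε ≤ i := by
  rw [FactorizedSystem.logReduction, Nat.clog_le_iff_le_pow (by norm_num), Nat.ceil_le]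
  norm_cast

theorem bound_paramProg :
    Bound S paramProg (S.input ε k) (400 + 42 * ⌈S.R * S.reduction ε⌉₊ + S.steps ε +
        S.samples ε k)
      (fun s' => Frame 4 4 (S.input ε k) s' ∧ s'.num 6 = (S.input ε k).num 6 ∧
        s'.nat 5 = S.steps ε ∧ s'.nat 6 = S.samples ε k) (fun _ => 0) 0 := by
  set s := S.input ε k with hs
  set X := S.reduction ε with hX
  set L := S.logReduction ε with hL
  set n := ⌈S.R * X⌉₊ with hn
  have hLn : L ≤ n := by
    rw [hL, FactorizedSystem.logReduction, Nat.clog_le_iff_le_pow (by norm_num)]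
    exact Nat.lt_two_pow_self.le
  have hin : ∀ i, s.num 2 i 0 = (([S.normB, ε, specNorm S.A₁, minSingularValue S.A₁, specNorm S.A₂,
          minSingularValue S.A₂].getD i 0 : ℝ) : ℂ) := fun i => by
    simp [hs, FactorizedSystem.input]
  have h0 : s.nat 0 = S.R := rfl
  have h3 : s.nat 3 = k := rfl
  have h4 : s.nat 4 = 0 := rfl
  have hc₁ : (cond₁Exp.eval s) = (condNumber S.A₁ : ℂ) := by
    simp [NumExp.eval, NatExp.eval, hin, condNumber]
  have hc₂ : (cond₂Exp.eval s) = (condNumber S.A₂ : ℂ) := by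
    simp [NumExp.eval, NatExp.eval, hin, condNumber]
  have hc₁' : ∀ s', Frame 4 4 s s' → cond₁Exp.eval s' = (condNumber S.A₁ : ℂ) := fun s' h => by
    rw [← hc₁]; simp only [NumExp.eval, NatExp.eval, h.2 2 (by norm_num)]
  have hc₂' : ∀ s', Frame 4 4 s s' → cond₂Exp.eval s' = (condNumber S.A₂ : ℂ) := fun s' h => by
    rw [← hc₂]; simp only [NumExp.eval, NatExp.eval, h.2 2 (by norm_num)]
  have tExp_eval : ∀ s', Frame 4 4 s s' → s'.nat 4 = min n L →
      ⌈(NumExp.eval s' (.mul (.mul (.lit 2) (.add (.mul cond₁Exp cond₁Exp)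
        (.mul cond₂Exp cond₂Exp))) (.ofNat (.reg 4)))).re⌉₊ = S.steps ε := by
    intro s' hF h4'
    have e : NumExp.eval s' (.mul (.mul (.lit 2) (.add (.mul cond₁Exp cond₁Exp)
        (.mul cond₂Exp cond₂Exp))) (.ofNat (.reg 4))) = ((2 * (condNumber S.A₁ * condNumber S.A₁ +
          condNumber S.A₂ * condNumber S.A₂) * L : ℝ) : ℂ) := by
      have e₁ := hc₁' s' hF
      have e₂ := hc₂' s' hF
      simp only [NumExp.eval] at e₁ e₂ ⊢
      rw [e₁, e₂]
      simp [NatExp.eval, h4', hLn]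
    rw [e, Complex.ofReal_re]
    rfl
  have mExp_eval : ∀ s', Frame 4 4 s s' → s'.num 4 0 0 = X → s'.nat 4 = L →
      s'.nat 5 = S.steps ε → ⌈(NumExp.eval s' (.mul (.mul (.mul (.lit 2304) (.ofNat (.reg 0)))
        (.mul (.mul (.ofNat (.reg 5)) (.ofNat (.reg 5)))
          (.mul (.entry 4 zeroExp zeroExp) (.entry 4 zeroExp zeroExp))))
        (.ofNat (.add (.add (.add (.reg 3) (.reg 5)) (.reg 4)) (.lit 3))))).re⌉₊ =
        S.samples ε k := by
    intro s' hF hx h4' h5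
    have e : NumExp.eval s' (.mul (.mul (.mul (.lit 2304) (.ofNat (.reg 0)))
        (.mul (.mul (.ofNat (.reg 5)) (.ofNat (.reg 5)))
          (.mul (.entry 4 zeroExp zeroExp) (.entry 4 zeroExp zeroExp))))
        (.ofNat (.add (.add (.add (.reg 3) (.reg 5)) (.reg 4)) (.lit 3)))) =
        ((2304 * S.R * ((S.steps ε * S.steps ε) * (X * X)) *
          ((k + S.steps ε + L + 3 : ℕ) : ℝ) : ℝ) : ℂ) := by
      simp [NumExp.eval, NatExp.eval, h4', h5, hx, hF.1 0, hF.1 3, h0, h3]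
    rw [e, Complex.ofReal_re]
    rfl
  refine (Bound.seq (t := 40) (f := fun _ => 0) (A := fun s' => Frame 4 4 s s' ∧
    s'.num 6 = s.num 6 ∧ s'.num 4 0 0 = X ∧ s'.nat 4 = 0)
    (Bound.setNum (by simp [NatExp.cost, NumExp.cost]) ⟨Frame.setNum le_rfl _ _ _, ?_, ?_, ?_⟩ le_rfl)
    fun s₁ hs₁ => Bound.seq (t := 7 + n) (f := fun _ => 0) (A := fun s' => Frame 4 4 s s' ∧
      s'.num 6 = s.num 6 ∧ s'.num 4 0 0 = X ∧ s'.nat 4 = 0 ∧ s'.nat 7 = n)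
    (Bound.ceil ?_ ?_ le_rfl)
    fun s₂ hs₂ => Bound.seq (t := 8) (f := fun _ => 0) (A := fun s' => Frame 4 4 s s' ∧
      s'.num 6 = s.num 6 ∧ s'.num 4 0 0 = X ∧ s'.nat 4 = 0 ∧ s'.nat 7 = n ∧ s'.num 4 1 0 = 1)
    (Bound.setNum (by simp [NatExp.cost, NumExp.cost]) ?_ le_rfl)
    fun s₃ hs₃ => Bound.seq (f := fun _ => 0) (A := fun s' => Frame 4 4 s s' ∧
      s'.num 6 = s.num 6 ∧ s'.num 4 0 0 = X ∧ s'.nat 4 = min n L ∧ s'.num 4 1 0 = 2 ^ min n L)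
    -- The counter stops changing once it reaches L, and L ≤ n, so the n rounds are enough.
    (Bound.loop (t := 40) (n := n) ?_ (fun i s' => Frame 4 4 s s' ∧
      s'.num 6 = s.num 6 ∧ s'.num 4 0 0 = X ∧ s'.nat 4 = min i L ∧ s'.num 4 1 0 = 2 ^ min i L)
      (fun _ _ => 0) ?_ ?_)
    fun s₄ hs₄ => Bound.seq (t := 60 + S.steps ε) (f := fun _ => 0) (A := fun s' => Frame 4 4 s s' ∧
      s'.num 6 = s.num 6 ∧ s'.num 4 0 0 = X ∧ s'.nat 4 = L ∧ s'.nat 5 = S.steps ε)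
    (Bound.ceil ?_ ?_ le_rfl)
    fun s₅ hs₅ => Bound.ceil (t := 60 + S.samples ε k) ?_ ?_ le_rfl).weaken ?_ (fun _ h => h)
      (fun _ _ => le_rfl) le_rfl
  · funext i j; simp
  · have := hin 0
    have := hin 1
    simp only [NatExp.eval, Store.setNum_num, and_self, if_true]
    simp only [NumExp.eval] at hc₁ hc₂ ⊢
    rw [hc₁, hc₂, hX, FactorizedSystem.reduction]
    simp [NatExp.eval, hin]
  · simpa using h4
  · obtain ⟨hF, h6, hx, h4'⟩ := hs₁
    have hev : NumExp.eval s₁ (.mul (.ofNat (.reg 0)) (.entry 4 zeroExp zeroExp)) =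
        ((S.R * X : ℝ) : ℂ) := by
      simp [NumExp.eval, NatExp.eval, hx, hF.1 0, h0]
    rw [hev, Complex.ofReal_re]
    simp only [NatExp.cost, NumExp.cost]
    omega
  · obtain ⟨hF, h6, hx, h4'⟩ := hs₁
    have hev : NumExp.eval s₁ (.mul (.ofNat (.reg 0)) (.entry 4 zeroExp zeroExp)) =
        ((S.R * X : ℝ) : ℂ) := by
      simp [NumExp.eval, NatExp.eval, hx, hF.1 0, h0]
    rw [hev, Complex.ofReal_re]
    exact ⟨hF.trans (Frame.setNat (by norm_num) _), h6, hx, by simpa using h4', by simp [hn]⟩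
  · obtain ⟨hF, h6, hx, h4', h7⟩ := hs₂
    refine ⟨hF.trans (Frame.setNum le_rfl _ _ _), ?_, by simpa [NatExp.eval] using hx, by simpa,
      by simpa, by simp [NatExp.eval, NumExp.eval]⟩
    rw [← h6]; funext i j; simp
  · exact hs₃.2.2.2.2.1
  · obtain ⟨hF, h6, hx, h4', h7, h1⟩ := hs₃
    exact ⟨hF, h6, hx, by simpa using h4', by simpa using h1⟩
  · rintro i hi s' ⟨hF, h6, hx, h4', h1⟩
    have hcond : Cond.Holds (s'.setNat 10 i) (.reLE (.mul (.ofNat (.reg 0))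
        (.entry 4 zeroExp zeroExp)) (.entry 4 (.lit 1) zeroExp)) ↔ L ≤ min i L := by
      have hev : NumExp.eval (s'.setNat 10 i) (.mul (.ofNat (.reg 0)) (.entry 4 zeroExp zeroExp)) =
          ((S.R * X : ℝ) : ℂ) := by
        simp [NumExp.eval, NatExp.eval, hx, hF.1 0, h0]
      have hev' : NumExp.eval (s'.setNat 10 i) (.entry 4 (.lit 1) zeroExp) =
          ((2 ^ min i L : ℝ) : ℂ) := by
        simp [NumExp.eval, NatExp.eval, h1]
      rw [Cond.Holds, hev, hev', Complex.ofReal_re, Complex.ofReal_re, two_pow_le_iff]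
    refine (Bound.ite (t := 18) (fun h => Bound.skip (by norm_num) ?_ le_rfl)
      (fun h => Bound.seq (t := 12) (t' := 6) (f := fun _ => 0) (A := fun s'' =>
        s'' = (s'.setNat 10 i).setNum 4 1 0 (2 * 2 ^ min i L))
        (Bound.setNum ?_ ?_ le_rfl) ?_)).weaken
          (by simp [Cond.cost, NatExp.cost, NumExp.cost]) (fun _ h => h) (fun _ _ => le_rfl) le_rfl
    · rw [hcond] at h
      have e : min (i + 1) L = min i L := by omega
      rw [e]
      exact ⟨hF.trans (Frame.setNat (by norm_num) _), h6, hx, by simpa using h4', h1⟩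
    · simp [NatExp.cost, NumExp.cost]
    · simp [NatExp.eval, NumExp.eval, h1]
    · rintro s'' rfl
      rw [hcond] at h
      have e : min (i + 1) L = min i L + 1 := by omega
      rw [e]
      refine Bound.setNat (by simp [NatExp.cost]) ⟨((hF.trans (Frame.setNat (by norm_num) _)).trans
        (Frame.setNum le_rfl _ _ _)).trans (Frame.setNat le_rfl _), ?_, by simpa using hx,
        by simp [NatExp.eval, h4'], by simp [pow_succ, mul_comm]⟩ le_rfl
      rw [← h6]; funext i j; simp
  · obtain ⟨hF, h6, hx, h4', h1⟩ := hs₄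
    have hev := tExp_eval s₄ hF h4'
    rw [hev]
    simp only [NatExp.cost, NumExp.cost]
    omega
  · obtain ⟨hF, h6, hx, h4', h1⟩ := hs₄
    rw [tExp_eval s₄ hF h4']
    exact ⟨hF.trans (Frame.setNat (by norm_num) _), h6, hx, by simp [h4', hLn], by simp⟩
  · obtain ⟨hF, h6, hx, h4', h5⟩ := hs₅
    rw [mExp_eval s₅ hF hx h4' h5]
    simp only [NatExp.cost, NumExp.cost]
    omega
  · obtain ⟨hF, h6, hx, h4', h5⟩ := hs₅
    rw [mExp_eval s₅ hF hx h4' h5]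
    exact ⟨hF.trans (Frame.setNat (by norm_num) _), h6, by simpa using h5, by simp⟩
  · simp only [NatExp.cost]
    omega

end Hybrid

/-! ### Assembly and correctness of the algorithm -/

namespace Hybrid

open scoped ENNReal

variable {S : FactorizedSystem} {s s' : Store} {ε : ℝ} {k : ℕ}

/-! ### The algorithm -/

/-- The hybrid algorithm. -/
def mainProg : Prog :=
  -- If A₁ = 0 then every output is optimal, and the iteration would divide by ‖A₁‖².
  .ite (.reLE (inputExp 2) (.lit 0)) .skip
    (.seq (.seq (.seq (.seq (.seq paramProg rhsProg) (solveProg 0 .uu 2)) moveProg)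
      (solveProg 1 .vv 4)) outProg)

/-- The memory holds the input and the numbers of steps and of samples. -/
structure Ready (S : FactorizedSystem) (ε : ℝ) (k : ℕ) (s : Store) : Prop where
  frame : Frame 4 3 (S.input ε k) s
  steps : s.nat 5 = S.steps ε
  samples : s.nat 6 = S.samples ε k

namespace Ready

theorem trans (h : Ready S ε k s) (h' : Frame 10 5 s s') : Ready S ε k s' where
  frame := h.frame.trans (h'.mono (by norm_num) (by norm_num))
  steps := (h'.1 5 (by norm_num)).trans h.steps
  samples := (h'.1 6 (by norm_num)).trans h.samples

theorem rank (h : Ready S ε k s) : s.nat 0 = S.R := h.frame.1 0 (by norm_num)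

theorem normU (h : Ready S ε k s) (i : Fin S.R) : s.num 0 i 0 = S.normU i := by
  rw [h.frame.2 0 (by norm_num)]; simp [FactorizedSystem.input]

theorem normV (h : Ready S ε k s) (i : Fin S.R) : s.num 1 i 0 = S.normV i := by
  rw [h.frame.2 1 (by norm_num)]; simp [FactorizedSystem.input]

theorem normB (h : Ready S ε k s) : s.num 2 0 0 = S.normB := by
  rw [h.frame.2 2 (by norm_num)]; simp [FactorizedSystem.input]

theorem specNorm₁ (h : Ready S ε k s) : s.num 2 2 0 = specNorm S.A₁ := by
  rw [h.frame.2 2 (by norm_num)]; simp [FactorizedSystem.input]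

theorem specNorm₂ (h : Ready S ε k s) : s.num 2 4 0 = specNorm S.A₂ := by
  rw [h.frame.2 2 (by norm_num)]; simp [FactorizedSystem.input]

end Ready

/-! ### The second factor -/

theorem toEuclideanLin_columnMatrix_normV :
    (columnMatrix S.normV S.circV).toEuclideanLin = S.A₂.toEuclideanLin.adjoint := by
  rw [← conjTranspose_A₂, Matrix.toEuclideanLin_conjTranspose_eq_adjoint]

theorem adjoint_columnMatrix_normV :
    (columnMatrix S.normV S.circV).toEuclideanLin.adjoint = S.A₂.toEuclideanLin := by
  rw [toEuclideanLin_columnMatrix_normV, LinearMap.adjoint_adjoint]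

theorem surjective_A₂ (h : S.A₂.rank = S.R) : Function.Surjective S.A₂.toEuclideanLin := by
  rw [← LinearMap.range_eq_top]
  refine Submodule.eq_top_of_finrank_eq ?_
  rw [← rank_eq_finrank_range_toEuclideanLin, h, finrank_euclideanSpace_fin]

theorem norm_columnMatrix_normV_le (y : EuclideanSpace ℂ (Fin S.R)) :
    ‖(columnMatrix S.normV S.circV).toEuclideanLin y‖ ≤ specNorm S.A₂ * ‖y‖ := by
  rw [toEuclideanLin_columnMatrix_normV]
  exact norm_adjoint_apply_le (specNorm_nonneg _) (norm_toEuclideanLin_le _) y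

/-- Full rank makes A₂ surjective, so its adjoint is bounded below on the whole space and A₂A₂† is
invertible. -/
theorem le_norm_columnMatrix_normV (h : S.A₂.rank = S.R) (y : EuclideanSpace ℂ (Fin S.R)) :
    minSingularValue S.A₂ * ‖y‖ ≤ ‖(columnMatrix S.normV S.circV).toEuclideanLin y‖ := by
  rw [toEuclideanLin_columnMatrix_normV]
  exact mul_norm_le_norm_adjoint (surjective_A₂ h) (fun _ => minSingularValue_mul_norm_le _) y

theorem specNorm_A₂_pos (hR : 0 < S.R) (h : S.A₂.rank = S.R) : 0 < specNorm S.A₂ := by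
  refine lt_of_le_of_ne (specNorm_nonneg _) fun h0 => ?_
  rw [eq_zero_of_specNorm_eq_zero _ h0.symm, Matrix.rank_zero] at h
  omega

theorem one_le_condNumber {N M : ℕ} (A : Matrix (Fin N) (Fin M) ℂ) (h : 0 < specNorm A) :
    1 ≤ condNumber A := by
  rw [condNumber, one_le_div (minSingularValue_pos _ h)]
  exact minSingularValue_le_specNorm _

/-! ### The residual -/

theorem residual_eq (x : Fin S.M → ℂ) : S.residual x =
    ‖S.A₁.toEuclideanLin (S.A₂.toEuclideanLin (WithLp.toLp 2 x)) - WithLp.toLp 2 S.b‖ := by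
  rw [FactorizedSystem.residual, FactorizedSystem.A, ← Matrix.mulVec_mulVec]
  rfl

theorem toLp_combine {σ : Fin S.R → ℂ} {t : EuclideanSpace ℂ (Fin S.R)}
    (h : ∀ i, σ i = S.normV i * t i) :
    WithLp.toLp 2 (S.combine σ) = (columnMatrix S.normV S.circV).toEuclideanLin t := by
  ext i
  simp only [FactorizedSystem.combine, Matrix.toLpLin_apply, columnMatrix, Matrix.mulVec,
    dotProduct, Matrix.of_apply, Finset.sum_apply, Pi.smul_apply, smul_eq_mul, h]
  exact Finset.sum_congr rfl fun j _ => by ring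

/-- The accuracy of an approximate solution of both systems of normal equations. -/
theorem residual_sub_iInf_le {y : EuclideanSpace ℂ (Fin S.R)}
    (hy : ∀ y', ‖S.A₁.toEuclideanLin y - WithLp.toLp 2 S.b‖ ≤
      ‖S.A₁.toEuclideanLin y' - WithLp.toLp 2 S.b‖) {σ : Fin S.R → ℂ}
    {t : EuclideanSpace ℂ (Fin S.R)} (hσ : ∀ i, σ i = S.normV i * t i)
    (ht : specNorm S.A₁ * ‖(columnMatrix S.normV S.circV).toEuclideanLin.adjoint
      ((columnMatrix S.normV S.circV).toEuclideanLin t) - y‖ ≤ ε) :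
    S.residual (S.combine σ) - ⨅ x, S.residual x ≤ ε := by
  -- Each Ax is of the form A₁y', so the least squares value of A₁ is a lower bound.
  have h1 : ‖S.A₁.toEuclideanLin y - WithLp.toLp 2 S.b‖ ≤ ⨅ x, S.residual x :=
    le_ciInf fun x => by rw [residual_eq]; exact hy _
  have h2 := norm_toEuclideanLin_le S.A₁ ((columnMatrix S.normV S.circV).toEuclideanLin.adjoint
      ((columnMatrix S.normV S.circV).toEuclideanLin t) - y)
  rw [residual_eq, toLp_combine hσ, ← adjoint_columnMatrix_normV]
  set z := (columnMatrix S.normV S.circV).toEuclideanLin.adjoint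
      ((columnMatrix S.normV S.circV).toEuclideanLin t)
  have h3 : S.A₁.toEuclideanLin z - WithLp.toLp 2 S.b = S.A₁.toEuclideanLin (z - y) +
      (S.A₁.toEuclideanLin y - WithLp.toLp 2 S.b) := by rw [map_sub]; abel
  have h4 := norm_add_le (S.A₁.toEuclideanLin (z - y))
    (S.A₁.toEuclideanLin y - WithLp.toLp 2 S.b)
  rw [h3]
  linarith

/-! ### The failure probability -/

/-- R is absorbed by e^L, the number of steps by e^T, the constant 8 by e³, and e^k ≥ 2^k remains.
-/
theorem two_pow_mul_exp_le (R k T L : ℕ) (hR : (R : ℝ) ≤ 2 ^ L) :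
    4 * R * (1 + 2 * T) * Real.exp (-(k + T + L + 3)) ≤ (1 / 2 : ℝ) ^ k := by
  have h1 : (2 : ℝ) ≤ Real.exp 1 := by
    have := Real.add_one_le_exp (1 : ℝ)
    linarith
  have hpow : ∀ n : ℕ, (2 : ℝ) ^ n ≤ Real.exp n := fun n => by
    rw [← mul_one (n : ℝ), Real.exp_nat_mul]; gcongr
  have h3 : (8 : ℝ) ≤ Real.exp 3 := by
    have := hpow 3
    norm_num at this
    exact this
  have hT := Real.add_one_le_exp (T : ℝ)
  have e : Real.exp (k + T + L + 3) = Real.exp k * (Real.exp T * Real.exp L * Real.exp 3) := by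
    rw [← Real.exp_add, ← Real.exp_add, ← Real.exp_add]; ring_nf
  rw [Real.exp_neg, ← div_eq_mul_inv, div_le_iff₀ (Real.exp_pos _), e, ← mul_assoc, one_div,
    inv_pow]
  have hk : 1 ≤ ((2 : ℝ) ^ k)⁻¹ * Real.exp k := by
    rw [← div_eq_inv_mul, one_le_div (by positivity)]; exact hpow k
  calc (4 * R * (1 + 2 * T) : ℝ) ≤ 4 * 2 ^ L * (2 * (T + 1)) := by gcongr; linarith
    _ = ((T : ℝ) + 1) * 2 ^ L * 8 := by ring
    _ ≤ 1 * (Real.exp T * Real.exp L * Real.exp 3) := by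
        rw [one_mul]; gcongr; exact hpow L
    _ ≤ _ := by gcongr

/-- The time that the algorithm needs. -/
def mainTime (S : FactorizedSystem) (ε : ℝ) (k q : ℕ) : ℕ :=
  10 + ((400 + 42 * ⌈S.R * S.reduction ε⌉₊ + S.steps ε + S.samples ε k) +
    (2 + S.R * (estimateTime 1 (S.samples ε k) (2 * q + 5) + 20)) +
    (2 + S.steps ε * (stepTime S.R (S.samples ε k) (2 * q + 5) + 1)) + (2 + S.R * 20) +
    (2 + S.steps ε * (stepTime S.R (S.samples ε k) (2 * q + 5) + 1)) + (2 + S.R * 20))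

theorem bound_mainProg {q : ℕ} (hR : 0 < S.R) (hrank : S.A₂.rank = S.R) (hε : 0 < ε)
    (hU : ∀ j, (S.circU j).gates.length ≤ q) (hV : ∀ j, (S.circV j).gates.length ≤ q)
    (hBq : S.circB.gates.length ≤ q) :
    Bound S mainProg (S.input ε k) (mainTime S ε k q) (fun _ => True)
      (fun s' => ind ¬(S.residual (S.combine (S.output s')) - ⨅ x, S.residual x ≤ ε))
      (ENNReal.ofReal ((1 / 2 : ℝ) ^ k)) := by
  have hcond : Cond.Holds (S.input ε k) (.reLE (inputExp 2) (.lit 0)) ↔ specNorm S.A₁ ≤ 0 := by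
    simp [Cond.Holds, NumExp.eval, NatExp.eval, FactorizedSystem.input]
  refine (Bound.ite (t := mainTime S ε k q - 10) (fun h => ?_) (fun h => ?_)).weaken
    (by simp [Cond.cost, NumExp.cost, NatExp.cost, mainTime]) (fun _ h => h)
    (fun _ _ => le_rfl) le_rfl
  · refine Bound.skip (by rw [mainTime]; omega) trivial ?_
    have hA : S.A = 0 := by
      rw [FactorizedSystem.A, eq_zero_of_specNorm_eq_zero _
        (le_antisymm (hcond.1 h) (specNorm_nonneg _)), Matrix.zero_mul]
    rw [ind_of_false]
    · exact zero_le
    · rw [not_not]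
      have : ∀ x, S.residual x = ‖WithLp.toLp 2 (-S.b)‖ := fun x => by
        rw [FactorizedSystem.residual, hA, Matrix.zero_mulVec, zero_sub]
      simp only [this, ciInf_const, sub_self]
      exact hε.le
  rw [hcond, not_le] at h
  set σ₁ := specNorm S.A₁
  set ρ₁ := minSingularValue S.A₁
  set σ₂ := specNorm S.A₂
  set ρ₂ := minSingularValue S.A₂
  set B := S.normB
  set X := S.reduction ε with hX
  set L := S.logReduction ε with hL
  set T := S.steps ε with hT
  set m := S.samples ε k with hm
  have hσ₂ : 0 < σ₂ := specNorm_A₂_pos hR hrank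
  have hρ₁ : 0 < ρ₁ := minSingularValue_pos _ h
  have hρ₂ : 0 < ρ₂ := minSingularValue_pos _ hσ₂
  have hB : 0 < B := S.normB_pos
  have hκ₁ : 1 ≤ condNumber S.A₁ := one_le_condNumber _ h
  have hκ₂ : 1 ≤ condNumber S.A₂ := one_le_condNumber _ hσ₂
  have hR1 : (1 : ℝ) ≤ S.R := by exact_mod_cast hR
  have hX1 : 1 < X := by
    rw [hX, FactorizedSystem.reduction, lt_add_iff_pos_right]
    positivity
  have hRX : S.R * X ≤ 2 ^ L := (two_pow_le_iff L).2 le_rfl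
  have hXL : X ≤ 2 ^ L := le_trans (le_mul_of_one_le_left (by linarith) hR1) hRX
  have hRL : (S.R : ℝ) ≤ 2 ^ L := le_trans (le_mul_of_one_le_right (by linarith) hX1.le) hRX
  have hL0 : 0 < L := by
    by_contra h0
    rw [Nat.eq_zero_of_not_pos h0, pow_zero] at hXL
    linarith
  have hTL : 2 * (condNumber S.A₁ * condNumber S.A₁ + condNumber S.A₂ * condNumber S.A₂) * L ≤ T :=
    Nat.le_ceil _
  have hL0' : (0 : ℝ) < L := by exact_mod_cast hL0
  have hT0 : (0 : ℝ) < T := lt_of_lt_of_le (by positivity) hTL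
  have hTL₁ : 2 * (σ₁ / ρ₁) ^ 2 * L ≤ T := by
    refine le_trans ?_ hTL
    rw [sq]
    gcongr
    exact le_add_of_nonneg_right (by positivity)
  have hTL₂ : 2 * (σ₂ / ρ₂) ^ 2 * L ≤ T := by
    refine le_trans ?_ hTL
    rw [sq]
    gcongr
    exact le_add_of_nonneg_left (by positivity)
  have hmge : 2304 * S.R * ((T * T) * (X * X)) * ((k + T + L + 3 : ℕ) : ℝ) ≤ m := Nat.le_ceil _
  have hm0 : 0 < m := by
    have : (0 : ℝ) < m := lt_of_lt_of_le (by positivity) hmge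
    exact_mod_cast this
  set η : ℝ := 1 / (12 * T * √S.R * X) with hη
  have hsR : 0 < √(S.R : ℝ) := Real.sqrt_pos.2 (by linarith)
  have hη0 : 0 ≤ η := by positivity
  have hηX : 12 * T * √S.R * η * X ≤ 1 := by
    rw [hη]; exact le_of_eq (by field_simp)
  set E : ℝ≥0∞ := ENNReal.ofReal (Real.exp (-(m * η ^ 2 / 16))) with hE
  -- The union bound over the right-hand side and the T steps of each solve, with R rows and four
  -- directions every time.
  have hEle : S.R * (4 * E) + T * (S.R * (4 * E)) + T * (S.R * (4 * E)) ≤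
      ENNReal.ofReal ((1 / 2 : ℝ) ^ k) := by
    have h1 : Real.exp (-(m * η ^ 2 / 16)) ≤ Real.exp (-(k + T + L + 3)) := by
      refine Real.exp_le_exp.2 (neg_le_neg ?_)
      have hη2 : η ^ 2 / 16 = 1 / (2304 * S.R * ((T * T) * (X * X))) := by
        rw [hη, div_pow, mul_pow, mul_pow, mul_pow, Real.sq_sqrt (by positivity)]
        field_simp
        norm_num
      rw [mul_div_assoc, hη2, mul_one_div, le_div_iff₀ (by positivity)]
      refine le_trans (le_of_eq ?_) hmge
      push_cast
      ring
    have h2 : S.R * (4 * E) + T * (S.R * (4 * E)) + T * (S.R * (4 * E)) =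
        ENNReal.ofReal (4 * S.R * (1 + 2 * T) * Real.exp (-(m * η ^ 2 / 16))) := by
      have e4 : (4 : ℝ≥0∞) = ENNReal.ofReal 4 := by simp
      rw [hE, e4, ← ENNReal.ofReal_natCast S.R, ← ENNReal.ofReal_natCast T,
        ← ENNReal.ofReal_mul (by norm_num), ← ENNReal.ofReal_mul (by positivity),
        ← ENNReal.ofReal_mul (by positivity), ← ENNReal.ofReal_add (by positivity) (by positivity),
        ← ENNReal.ofReal_add (by positivity) (by positivity)]
      congr 1
      ring
    rw [h2]
    refine ENNReal.ofReal_le_ofReal (le_trans ?_ (two_pow_mul_exp_le S.R k T L hRL))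
    gcongr
  obtain ⟨y, hyk, hyn, hyb, hymin⟩ := exists_leastSquares S.A₁.toEuclideanLin (WithLp.toLp 2 S.b)
  set Y₁ := B / ρ₁ with hY₁
  have hY₁0 : 0 < Y₁ := by positivity
  have hyY : ‖y‖ ≤ Y₁ := by
    rw [hY₁, le_div_iff₀ hρ₁, mul_comm]
    rw [norm_toLp_b] at hyb
    exact (minSingularValue_mul_norm_le _ hyk).trans hyb
  -- The second solve receives a vector of norm at most 3Y₁, namely `y` up to an error 2Y₁/X, and
  -- A₂A₂† ≥ ρ₂².
  set Y₂ := 3 * Y₁ / ρ₂ ^ 2 with hY₂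
  have hY₂0 : 0 < Y₂ := by positivity
  have hσU : ∀ y, ‖(columnMatrix S.normU S.circU).toEuclideanLin y‖ ≤ σ₁ * ‖y‖ :=
    norm_toEuclideanLin_le S.A₁
  have hseq₁ : Bound S (.seq paramProg rhsProg) (S.input ε k)
      ((400 + 42 * ⌈S.R * X⌉₊ + T + m) + (2 + S.R * (estimateTime 1 m (2 * q + 5) + 20)))
      (fun s' => Ready S ε k s' ∧ s'.vec 6 S.R = 0)
      (fun s' => ind ¬(‖s'.vec 5 S.R - S.A₁.toEuclideanLin.adjoint (WithLp.toLp 2 S.b)‖ ≤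
        √S.R * (2 * σ₁ * B * η))) (S.R * (4 * E)) := by
    refine Bound.seq (f := fun _ => S.R * (4 * E)) (bound_paramProg.of_always fun _ _ => le_rfl)
      fun s₁ hs₁ => ?_
    obtain ⟨hF, h6, hsteps, hsamples⟩ := hs₁
    have hready : Ready S ε k s₁ := ⟨hF.mono le_rfl (by norm_num), hsteps, hsamples⟩
    refine (bound_rhsProg (σ := σ₁) (testCost_ub_le hU hBq) hready.rank hready.normU hready.normB
      hsamples hm0 hη0 h.le (weight_le S.normU_nonneg S.preparesU hσU)).weaken le_rfl
      (fun s₂ hs₂ => ⟨hready.trans (hs₂.1.mono (by norm_num) le_rfl), ?_⟩) (fun _ _ => le_rfl)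
      le_rfl
    ext i
    rw [Store.vec_apply, hs₂.2, h6]
    simp [FactorizedSystem.input]
  have hseq₂ := Bound.seq_fail hseq₁ (Q := solveProg 0 .uu 2)
    (t' := 2 + T * (stepTime S.R m (2 * q + 5) + 1)) (p' := T * (S.R * (4 * E)))
    (A' := Ready S ε k) (G' := fun s' => ‖s'.vec 6 S.R - y‖ ≤ 2 * Y₁ / X) fun s₂ hs₂ => by
      refine ((bound_solveProg_accurate (σ := σ₁) (ρ := ρ₁) (w := S.normU) (C := S.circU) (Y := Y₁)
        (by norm_num) (isGramQuery_uu hU) S.preparesU hs₂.1.rank hs₂.1.normU S.normU_nonneg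
        hs₂.1.samples hm0 hs₂.1.specNorm₁ h hσU hρ₁ (minSingularValue_le_specNorm _)
        (fun y hy => minSingularValue_mul_norm_le S.A₁ hy) hY₁0 hη0 hs₂.1.steps hs₂.2 hX1.le hXL
        hTL₁ hηX y hyk).add_const _).weaken le_rfl
        (fun s₃ hs₃ => hs₂.1.trans (hs₃.mono le_rfl (by norm_num)))
        (fun s₃ _ => ind_le_add ?_) le_rfl
      contrapose!
      rintro ⟨h1, h2⟩
      refine h1 hyY ?_
      change ‖_ • (s₂.vec 5 S.R - S.A₁.toEuclideanLin.adjoint (S.A₁.toEuclideanLin y))‖ ≤ _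
      rw [hyn, norm_smul, Complex.norm_real, Real.norm_of_nonneg (by positivity)]
      -- The error of the right-hand side, divided by σ₁², thus stays below the error allowed in one
      -- step.
      have hBY : B / σ₁ ≤ Y₁ := by
        rw [hY₁]
        gcongr
        exact minSingularValue_le_specNorm _
      calc _ ≤ (σ₁ ^ 2)⁻¹ * (√S.R * (2 * σ₁ * B * η)) := by gcongr
        _ = √S.R * (2 * (B / σ₁) * η) := by field_simp
        _ ≤ √S.R * (6 * Y₁ * η) := by
            gcongr
            norm_num
  have hseq₃ := Bound.seq_fail hseq₂ (Q := moveProg) (t' := 2 + S.R * 20) (p' := 0)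
    (A' := fun s' => Ready S ε k s' ∧ s'.vec 6 S.R = 0)
    (G' := fun s' => ‖s'.vec 5 S.R - y‖ ≤ 2 * Y₁ / X) fun s₃ hs₃ => by
      rw [zero_add]
      exact ((bound_moveProg hs₃.rank).of_always fun s₄ hs₄ => (by rw [hs₄.2.1])).weaken le_rfl
        (fun s₄ hs₄ => ⟨hs₃.trans (hs₄.1.mono (by norm_num) le_rfl), hs₄.2.2⟩)
        (fun _ _ => le_rfl) le_rfl
  have hseq₄ := Bound.seq_fail hseq₃ (Q := solveProg 1 .vv 4)
    (t' := 2 + T * (stepTime S.R m (2 * q + 5) + 1)) (p' := T * (S.R * (4 * E)))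
    (A' := Ready S ε k)
    (G' := fun s' => σ₁ * ‖(columnMatrix S.normV S.circV).toEuclideanLin.adjoint
      ((columnMatrix S.normV S.circV).toEuclideanLin (s'.vec 6 S.R)) - y‖ ≤ ε)
    fun s₄ hs₄ => by
      have hlow := le_norm_columnMatrix_normV hrank
      obtain ⟨z, hz, hzn⟩ := exists_adjoint_apply_eq hρ₂ hlow (s₄.vec 5 S.R)
      have hzk : z ∈ (LinearMap.ker (columnMatrix S.normV S.circV).toEuclideanLin)ᗮ := by
        intro u hu
        have h1 := hlow u
        rw [LinearMap.mem_ker.1 hu, norm_zero] at h1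
        have : ‖u‖ ≤ 0 := nonpos_of_mul_nonpos_right h1 hρ₂
        rw [norm_le_zero_iff.1 this, inner_zero_left]
      refine ((bound_solveProg_accurate (σ := σ₂) (ρ := ρ₂) (w := S.normV) (C := S.circV) (Y := Y₂)
        (by norm_num) (isGramQuery_vv hV) S.preparesV hs₄.1.rank hs₄.1.normV S.normV_nonneg
        hs₄.1.samples hm0 hs₄.1.specNorm₂ hσ₂ norm_columnMatrix_normV_le hρ₂
        (minSingularValue_le_specNorm _) (fun y _ => hlow y) hY₂0 hη0 hs₄.1.steps hs₄.2 hX1.le hXL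
        hTL₂ hηX z hzk).add_const _).weaken le_rfl
        (fun s₅ hs₅ => hs₄.1.trans (hs₅.mono le_rfl (by norm_num)))
        (fun s₅ _ => ind_le_add ?_) le_rfl
      contrapose!
      rintro ⟨h1, h2⟩
      have hg : ‖s₄.vec 5 S.R‖ ≤ 3 * Y₁ := by
        have h3 : 2 * Y₁ / X ≤ 2 * Y₁ := div_le_self (by positivity) hX1.le
        have h4 := norm_add_le (s₄.vec 5 S.R - y) y
        rw [sub_add_cancel] at h4
        linarith
      have hzY : ‖z‖ ≤ Y₂ := by
        rw [hY₂, le_div_iff₀ (by positivity), mul_comm]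
        exact hzn.trans hg
      have h5 := h1 hzY (by rw [hz, sub_self, smul_zero, norm_zero]; positivity)
      set W := (columnMatrix S.normV S.circV).toEuclideanLin
      have h6 : ‖W.adjoint (W (s₅.vec 6 S.R - z))‖ ≤ σ₂ * (σ₂ * (2 * Y₂ / X)) := by
        refine (norm_adjoint_apply_le hσ₂.le norm_columnMatrix_normV_le _).trans ?_
        gcongr
        refine (norm_columnMatrix_normV_le _).trans ?_
        gcongr
      have e : W.adjoint (W (s₅.vec 6 S.R)) - y =
          W.adjoint (W (s₅.vec 6 S.R - z)) + (s₄.vec 5 S.R - y) := by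
        rw [← hz, map_sub, map_sub]; abel
      have hX0 : 0 < X := by linarith
      have hκ₁' : condNumber S.A₁ = σ₁ / ρ₁ := rfl
      have hκ₂' : condNumber S.A₂ = σ₂ / ρ₂ := rfl
      have hκ₂2 : 1 ≤ condNumber S.A₂ * condNumber S.A₂ := one_le_mul_of_one_le_of_one_le hκ₂ hκ₂
      calc σ₁ * ‖W.adjoint (W (s₅.vec 6 S.R)) - y‖
          ≤ σ₁ * (σ₂ * (σ₂ * (2 * Y₂ / X)) + 2 * Y₁ / X) := by
            rw [e]
            gcongr
            exact (norm_add_le _ _).trans (add_le_add h6 h2)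
        _ = condNumber S.A₁ * B * (6 * (condNumber S.A₂ * condNumber S.A₂) + 2 * 1) / X := by
            rw [hκ₁', hκ₂', hY₂, hY₁]
            field_simp
            ring
        _ ≤ condNumber S.A₁ * B * (6 * (condNumber S.A₂ * condNumber S.A₂) +
              2 * (condNumber S.A₂ * condNumber S.A₂)) / X := by gcongr
        _ ≤ ε := by
            rw [div_le_iff₀ hX0, hX, FactorizedSystem.reduction, mul_one_add,
              mul_div_cancel₀ _ hε.ne']
            linarith
  have hseq₅ := Bound.seq_fail hseq₄ (Q := outProg) (t' := 2 + S.R * 20) (p' := 0)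
    (A' := fun _ => True)
    (G' := fun s' => S.residual (S.combine (S.output s')) - ⨅ x, S.residual x ≤ ε)
    fun s₅ hs₅ => by
      rw [zero_add]
      refine ((bound_outProg hs₅.rank hs₅.normV).of_always fun s₆ hs₆ => ind_mono (mt fun hG => ?_)).weaken
        le_rfl (fun _ _ => trivial) (fun _ _ => le_rfl) le_rfl
      exact residual_sub_iInf_le hymin hs₆ hG
  refine hseq₅.weaken (by rw [mainTime, Nat.add_sub_cancel_left]) (fun _ h => h) (fun _ _ => le_rfl) ?_
  rw [add_zero, add_zero]
  exact hEle

end Hybrid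

namespace Hybrid

open scoped ENNReal

variable {S : FactorizedSystem} {ε : ℝ} {k : ℕ}

/-! ### The running time -/

theorem mainTime_le (hR : 0 < S.R) (hX : 0 ≤ S.reduction ε) (q : ℕ) :
    (mainTime S ε k q : ℝ) ≤ 42 * (S.R * S.reduction ε) + 1000 * ((S.steps ε + 1) * S.R ^ 2 *
      (S.samples ε k + 1) * (q + 1)) := by
  have hceil : (⌈S.R * S.reduction ε⌉₊ : ℝ) < S.R * S.reduction ε + 1 :=
    Nat.ceil_lt_add_one (by positivity)
  set T := S.steps ε
  set m := S.samples ε k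
  have key : mainTime S ε k q ≤ 42 * ⌈S.R * S.reduction ε⌉₊ +
      (900 * ((T + 1) * S.R ^ 2 * (m + 1) * (q + 1))) := by
    have H : ∀ a b c d, a ≤ T + 1 → b ≤ S.R ^ 2 → c ≤ m + 1 → d ≤ q + 1 →
        a * b * c * d ≤ (T + 1) * S.R ^ 2 * (m + 1) * (q + 1) := fun a b c d ha hb hc hd =>
      Nat.mul_le_mul (Nat.mul_le_mul (Nat.mul_le_mul ha hb) hc) hd
    have h1 : 1 ≤ S.R ^ 2 := Nat.one_le_pow _ _ hR
    have h2 : S.R ≤ S.R ^ 2 := Nat.le_self_pow (by norm_num) _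
    have b0 := H 1 1 1 1 (by omega) h1 (by omega) (by omega)
    have b1 := H 1 S.R 1 1 (by omega) h2 (by omega) (by omega)
    have b2 := H 1 S.R m 1 (by omega) h2 (by omega) (by omega)
    have b3 := H 1 S.R m q (by omega) h2 (by omega) (by omega)
    have b4 := H 1 1 m 1 (by omega) h1 (by omega) (by omega)
    have b5 := H T 1 1 1 (by omega) h1 (by omega) (by omega)
    have b6 := H T S.R 1 1 (by omega) h2 (by omega) (by omega)
    have b7 := H T (S.R ^ 2) 1 1 (by omega) le_rfl (by omega) (by omega)
    have b8 := H T (S.R ^ 2) m 1 (by omega) le_rfl (by omega) (by omega)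
    have b9 := H T (S.R ^ 2) m q (by omega) le_rfl (by omega) (by omega)
    -- Every monomial is at most the product of the largest factors, and the coefficients in the
    -- bracket add up to 880.
    have hexp : mainTime S ε k q = 42 * ⌈S.R * S.reduction ε⌉₊ + (420 * (1 * 1 * 1 * 1) +
        73 * (1 * S.R * 1 * 1) + 85 * (1 * S.R * m * 1) + 4 * (1 * S.R * m * q) +
        1 * (1 * 1 * m * 1) + 11 * (T * 1 * 1 * 1) + 102 * (T * S.R * 1 * 1) +
        6 * (T * S.R ^ 2 * 1 * 1) + 170 * (T * S.R ^ 2 * m * 1) +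
        8 * (T * S.R ^ 2 * m * q)) := by
      rw [mainTime, stepTime, estimateTime, estimateTime]
      ring
    rw [hexp]
    linarith
  have key' : (mainTime S ε k q : ℝ) ≤ 42 * ⌈S.R * S.reduction ε⌉₊ +
      (900 * ((T + 1) * S.R ^ 2 * (m + 1) * (q + 1))) := by exact_mod_cast key
  have h1 : (1 : ℝ) ≤ (T + 1) * S.R ^ 2 * (m + 1) * (q + 1) := by
    have : 1 ≤ (T + 1) * S.R ^ 2 * (m + 1) * (q + 1) :=
      Nat.one_le_iff_ne_zero.2 (by positivity)
    exact_mod_cast this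
  linarith

/-- Trading log X for √X turns the logarithmic factors into half powers of 1/ε, which the exponent 4
can afford. -/
theorem logReduction_le (hR : 0 < S.R) (hX : 1 ≤ S.reduction ε) :
    (S.logReduction ε : ℝ) ≤ 1 + 2 * Real.log S.R + 4 * √(S.reduction ε) := by
  have hR1 : (1 : ℝ) ≤ S.R := by exact_mod_cast hR
  have hlogR := Real.log_nonneg hR1
  rcases Nat.eq_zero_or_pos (S.logReduction ε) with h | h
  · rw [h, Nat.cast_zero]
    positivity
  have h1 : (2 : ℝ) ^ (S.logReduction ε - 1) ≤ S.R * S.reduction ε := by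
    by_contra! hlt
    have := (two_pow_le_iff _).1 hlt.le
    omega
  have h2 := Real.log_le_log (by positivity) h1
  rw [Real.log_pow, Real.log_mul (by positivity) (by positivity), Nat.cast_pred h] at h2
  have h3 : Real.log (S.reduction ε) ≤ 2 * √(S.reduction ε) := by
    have := Real.log_le_sub_one_of_pos (Real.sqrt_pos.2 (by linarith : 0 < S.reduction ε))
    rw [Real.log_sqrt (by linarith)] at this
    linarith
  have h4 := Real.log_two_gt_d9
  have h5 : ((S.logReduction ε : ℝ) - 1) * (1 / 2) ≤ (S.logReduction ε - 1) * Real.log 2 := by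
    have : (1 : ℝ) ≤ S.logReduction ε := by exact_mod_cast h
    gcongr
    linarith
  linarith

/-- A bound for the running time in terms of a common bound `z` of all parameters and of
`f = 1 / √ε`. -/
theorem exists_mainTime_le {c : ℝ} (hc : 0 < c) : ∃ K : ℝ, 0 ≤ K ∧ ∀ (S : FactorizedSystem)
    (z f : ℝ) (k q : ℕ), 0 < S.R → 0 < k → √c ≤ f → 1 ≤ z → condNumber S.A₁ ≤ z →
    condNumber S.A₂ ≤ z → S.normB ≤ z → Real.log S.R ≤ z →
    (mainTime S ((f ^ 2)⁻¹) k q : ℝ) ≤ K * (k * S.R ^ 3 * z ^ 24 * f ^ 8 * (q + 1)) := by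
  set d := √c with hd
  have hd0 : 0 < d := Real.sqrt_pos.2 hc
  set C₁ := 8 + (d ^ 2)⁻¹ with hC₁
  set C₂ := 3 * d⁻¹ + 4 * √C₁ with hC₂
  set C₃ := 4 * C₂ + 2 * d⁻¹ with hC₃
  set C₄ := C₃ + C₂ + 4 * d⁻¹ with hC₄
  set C₅ := 2304 * (C₃ ^ 2 * C₁ ^ 2) * C₄ + 2 * (d ^ 7)⁻¹ with hC₅
  have hC₁0 : 0 < C₁ := by positivity
  have hC₂0 : 0 < C₂ := by positivity
  have hC₃0 : 0 < C₃ := by positivity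
  have hC₄0 : 0 < C₄ := by positivity
  have hC₅0 : 0 < C₅ := by positivity
  refine ⟨42 * C₁ * (d ^ 6)⁻¹ + 1000 * (C₃ * C₅), by positivity, ?_⟩
  intro S z f k q hR hk hdf hz hκ₁ hκ₂ hB hlog
  have hf : 0 < f := hd0.trans_le hdf
  have hR1 : (1 : ℝ) ≤ S.R := by exact_mod_cast hR
  have hk1 : (1 : ℝ) ≤ k := by exact_mod_cast hk
  have hκ₁0 : 0 ≤ condNumber S.A₁ := div_nonneg (specNorm_nonneg _) (minSingularValue_nonneg _)
  have hκ₂0 : 0 ≤ condNumber S.A₂ := div_nonneg (specNorm_nonneg _) (minSingularValue_nonneg _)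
  have hB0 := S.normB_pos.le
  -- Since f ≥ √c and z ≥ 1, lower powers can be raised at the price of a constant that depends on c
  -- only.
  have hone : ∀ a b : ℕ, 1 ≤ (d ^ b)⁻¹ * (z ^ a * f ^ b) := fun a b => by
    have h1 : 1 ≤ (d ^ b)⁻¹ * f ^ b := by
      rw [← div_eq_inv_mul, one_le_div (by positivity)]; gcongr
    have h2 : 1 ≤ z ^ a := one_le_pow₀ hz
    calc (1 : ℝ) ≤ ((d ^ b)⁻¹ * f ^ b) * z ^ a := one_le_mul_of_one_le_of_one_le h1 h2
      _ = _ := by ring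
  set ε := (f ^ 2)⁻¹ with hε
  set X := S.reduction ε with hX
  set L := S.logReduction ε with hL
  set T := S.steps ε with hT
  set m := S.samples ε k with hm
  have hX1 : 1 ≤ X := by
    rw [hX, FactorizedSystem.reduction, le_add_iff_nonneg_right]; positivity
  have hXle : X ≤ C₁ * (z ^ 4 * f ^ 2) := by
    have h := hone 4 2
    rw [hX, FactorizedSystem.reduction, hε, div_inv_eq_mul]
    calc _ ≤ (d ^ 2)⁻¹ * (z ^ 4 * f ^ 2) + 8 * z * (z * z) * z * f ^ 2 := by gcongr
      _ = _ := by rw [hC₁]; ring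
  have hsqrt : √X ≤ √C₁ * (z ^ 2 * f) := by
    rw [Real.sqrt_le_left (by positivity), mul_pow, Real.sq_sqrt hC₁0.le]
    exact hXle.trans (le_of_eq (by ring))
  have hLle : L ≤ C₂ * (z ^ 2 * f) := by
    have h := hone 1 1
    have h' := logReduction_le hR hX1
    calc (L : ℝ) ≤ z * 1 + 2 * z + 4 * (√C₁ * (z ^ 2 * f)) := by linarith
      _ = 3 * z * 1 + 4 * (√C₁ * (z ^ 2 * f)) := by ring
      _ ≤ 3 * z * ((d ^ 1)⁻¹ * (z ^ 1 * f ^ 1)) + 4 * (√C₁ * (z ^ 2 * f)) := by gcongr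
      _ = _ := by rw [hC₂, pow_one]; ring
  have hTle : (T : ℝ) + 1 ≤ C₃ * (z ^ 4 * f) := by
    have h := hone 4 1
    have h1 : (T : ℝ) < 2 * (condNumber S.A₁ * condNumber S.A₁ +
        condNumber S.A₂ * condNumber S.A₂) * L + 1 := Nat.ceil_lt_add_one (by positivity)
    calc (T : ℝ) + 1 ≤ 2 * (condNumber S.A₁ * condNumber S.A₁ +
          condNumber S.A₂ * condNumber S.A₂) * L + 2 * 1 := by linarith
      _ ≤ 2 * (z * z + z * z) * (C₂ * (z ^ 2 * f)) + 2 * ((d ^ 1)⁻¹ * (z ^ 4 * f ^ 1)) := by gcongr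
      _ = _ := by rw [hC₃, pow_one]; ring
  have hsum : ((k + T + L + 3 : ℕ) : ℝ) ≤ k * (C₄ * (z ^ 4 * f)) := by
    have h := hone 4 1
    have h1 : (L : ℝ) ≤ C₂ * (z ^ 4 * f) := hLle.trans (by
      gcongr
      norm_num)
    have h2 : (1 : ℝ) + T + L + 3 ≤ C₄ * (z ^ 4 * f) := by
      calc (1 : ℝ) + T + L + 3 = (T + 1) + L + 3 * 1 := by ring
        _ ≤ C₃ * (z ^ 4 * f) + C₂ * (z ^ 4 * f) + 4 * ((d ^ 1)⁻¹ * (z ^ 4 * f ^ 1)) := by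
            gcongr; norm_num
        _ = _ := by rw [hC₄, pow_one]; ring
    have h3 : (0 : ℝ) ≤ (k - 1) * (T + L + 3) := mul_nonneg (by linarith) (by positivity)
    calc ((k + T + L + 3 : ℕ) : ℝ) = k + T + L + 3 := by push_cast; ring
      _ ≤ k * (1 + T + L + 3) := by linarith
      _ ≤ _ := by gcongr
  -- T²X² contributes z¹⁶f⁶ and the sum k + T + L + 3 contributes k z⁴f.
  have hmle : (m : ℝ) + 1 ≤ C₅ * (k * S.R * (z ^ 20 * f ^ 7)) := by
    have h := hone 20 7
    have h1 : (m : ℝ) < 2304 * S.R * ((T * T) * (X * X)) * ((k + T + L + 3 : ℕ) : ℝ) + 1 :=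
      Nat.ceil_lt_add_one (by positivity)
    have hT' : (T : ℝ) ≤ C₃ * (z ^ 4 * f) := by linarith
    have h2 : (1 : ℝ) ≤ k * S.R := one_le_mul_of_one_le_of_one_le hk1 hR1
    calc (m : ℝ) + 1 ≤ 2304 * S.R * ((T * T) * (X * X)) * ((k + T + L + 3 : ℕ) : ℝ) +
          2 * (1 * 1) := by linarith
      _ ≤ 2304 * S.R * (((C₃ * (z ^ 4 * f)) * (C₃ * (z ^ 4 * f))) *
            ((C₁ * (z ^ 4 * f ^ 2)) * (C₁ * (z ^ 4 * f ^ 2)))) * (k * (C₄ * (z ^ 4 * f))) +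
          2 * ((k * S.R) * ((d ^ 7)⁻¹ * (z ^ 20 * f ^ 7))) := by gcongr
      _ = _ := by rw [hC₅]; ring
  have hlow : C₁ * (z ^ 4 * f ^ 2) * S.R ≤
      C₁ * (d ^ 6)⁻¹ * (k * S.R ^ 3 * z ^ 24 * f ^ 8 * (q + 1)) := by
    have h := hone 20 6
    have h2 : (1 : ℝ) ≤ k * S.R ^ 2 * (q + 1) := by
      have : 1 ≤ k * S.R ^ 2 * (q + 1) := Nat.one_le_iff_ne_zero.2 (by positivity)
      exact_mod_cast this
    calc _ = C₁ * (z ^ 4 * f ^ 2) * S.R * 1 * 1 := by ring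
      _ ≤ C₁ * (z ^ 4 * f ^ 2) * S.R * ((d ^ 6)⁻¹ * (z ^ 20 * f ^ 6)) * (k * S.R ^ 2 * (q + 1)) := by
          gcongr
      _ = _ := by ring
  calc (mainTime S ε k q : ℝ) ≤ _ := mainTime_le hR (by linarith) q
    _ ≤ 42 * (S.R * (C₁ * (z ^ 4 * f ^ 2))) + 1000 * (C₃ * (z ^ 4 * f) * S.R ^ 2 *
        (C₅ * (k * S.R * (z ^ 20 * f ^ 7))) * (q + 1)) := by gcongr
    _ = 42 * (C₁ * (z ^ 4 * f ^ 2) * S.R) + 1000 * (C₃ * C₅) *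
        (k * S.R ^ 3 * z ^ 24 * f ^ 8 * (q + 1)) := by ring
    _ ≤ _ := by linarith

/-! ### The size of the input -/

/-- Replaces log R by log M, which is a variable of the polynomial. -/
theorem R_le_M (hrank : S.A₂.rank = S.R) : S.R ≤ S.M := by
  rw [← hrank]; exact S.A₂.rank_le_width

/-- Either Γ ≥ c, or c ≤ ‖A₂‖ = ρ₂κ₂, where ρ₂ is at most the norm of a row of A₂ and therefore ρ₂²
≤ Γ. -/
theorem one_le_sq_Γ {c : ℝ} (hc : 0 < c) (hR : 0 < S.R) (hrank : S.A₂.rank = S.R)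
    (h : c ≤ max S.Γ (specNorm S.A₂)) :
    1 ≤ ((c ^ 2)⁻¹ + (c ^ 4)⁻¹) * (S.Γ ^ 2 * condNumber S.A₂ ^ 4) := by
  have hσ := specNorm_A₂_pos hR hrank
  have hρ := minSingularValue_pos _ hσ
  have hκ := one_le_condNumber _ hσ
  rcases le_max_iff.1 h with h | h
  · have h1 : 1 ≤ (c ^ 2)⁻¹ * S.Γ ^ 2 := by
      rw [← div_eq_inv_mul, one_le_div (by positivity)]; gcongr
    calc (1 : ℝ) ≤ ((c ^ 2)⁻¹ * S.Γ ^ 2) * condNumber S.A₂ ^ 4 :=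
          one_le_mul_of_one_le_of_one_le h1 (one_le_pow₀ hκ)
      _ ≤ _ := by
          rw [mul_assoc]
          gcongr
          exact le_add_of_nonneg_right (by positivity)
  · have h1 : minSingularValue S.A₂ ≤ S.normV ⟨0, hR⟩ :=
      le_weight S.normV_nonneg S.preparesV (le_norm_columnMatrix_normV hrank) _
    have h2 : S.normV ⟨0, hR⟩ ^ 2 ≤ S.Γ :=
      (le_max_right _ _).trans (le_ciSup (f := fun j : Fin S.R =>
        max (max (S.normU j ^ 2) (S.normU j * S.normB)) (S.normV j ^ 2))
        (Set.finite_range _).bddAbove ⟨0, hR⟩)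
    have h3 : c ≤ minSingularValue S.A₂ * condNumber S.A₂ := by
      rw [condNumber, mul_div_cancel₀ _ hρ.ne']; exact h
    have h4 : c ^ 4 ≤ S.Γ ^ 2 * condNumber S.A₂ ^ 4 := by
      calc c ^ 4 ≤ (minSingularValue S.A₂ * condNumber S.A₂) ^ 4 := by gcongr
        _ = (minSingularValue S.A₂ ^ 2) ^ 2 * condNumber S.A₂ ^ 4 := by ring
        _ ≤ (S.normV ⟨0, hR⟩ ^ 2) ^ 2 * condNumber S.A₂ ^ 4 := by gcongr
        _ ≤ _ := by gcongr
    have h5 : 1 ≤ (c ^ 4)⁻¹ * (S.Γ ^ 2 * condNumber S.A₂ ^ 4) := by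
      rw [← div_eq_inv_mul, one_le_div (by positivity)]; exact h4
    refine h5.trans ?_
    gcongr
    exact le_add_of_nonneg_left (by positivity)

theorem clog_le_log (N : ℕ) : (Nat.clog 2 N : ℝ) ≤ 1 + 2 * Real.log N := by
  rcases Nat.lt_or_ge 1 N with h | h
  · have h1 : 2 ^ (Nat.clog 2 N - 1) ≤ N := (Nat.pow_pred_clog_lt_self (by norm_num) h).le
    have hpos := Nat.clog_pos (b := 2) (by norm_num) h
    have h2 : ((2 : ℝ) ^ (Nat.clog 2 N - 1)) ≤ N := by exact_mod_cast h1
    have h3 := Real.log_le_log (by positivity) h2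
    rw [Real.log_pow, Nat.cast_pred hpos] at h3
    have h4 := Real.log_two_gt_d9
    have h5 : ((Nat.clog 2 N : ℝ) - 1) * (1 / 2) ≤ (Nat.clog 2 N - 1) * Real.log 2 := by
      have : (1 : ℝ) ≤ Nat.clog 2 N := by exact_mod_cast hpos
      gcongr
      linarith
    linarith
  · rw [Nat.clog_of_right_le_one h]
    have := Real.log_natCast_nonneg N
    push_cast
    linarith

theorem length_gates_le_of_depth {N : ℕ} (C : Circuit (Nat.clog 2 N)) {x G z : ℝ}
    (hx : (C.depth : ℝ) ≤ x) (hz1 : 1 ≤ z) (hz : Real.log N ≤ z) (hG : 3 * z * (1 + x ^ 2) ≤ G) :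
    C.gates.length ≤ ⌊G⌋₊ := by
  refine Nat.le_floor ((?_ : (C.gates.length : ℝ) ≤ 3 * z * (1 + x ^ 2)).trans hG)
  calc (C.gates.length : ℝ) ≤ C.depth * Nat.clog 2 N := by exact_mod_cast C.length_gates_le
    _ ≤ (1 + x ^ 2) * (3 * z) := by
        gcongr
        · nlinarith [sq_nonneg (x - 1)]
        · have := clog_le_log N
          linarith
    _ = _ := by ring

/-- A polynomial bound for the running time. -/
def timePolynomial (K : ℝ) (D : Polynomial ℝ) : MvPolynomial (Fin 5) ℝ :=
  -- 29 = 24 + 1 + 4: the time in units of gates, the number of qubits, and κ₂⁴. Squares of `D`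
  -- dominate the depths through x ≤ 1 + x² and keep the sum of both bounds positive.
  MvPolynomial.C K * (1 + ∑ i, MvPolynomial.X i) ^ 29 *
    (2 + D.eval₂ MvPolynomial.C (MvPolynomial.X 3) ^ 2 +
      D.eval₂ MvPolynomial.C (MvPolynomial.X 2) ^ 2)

theorem eval_timePolynomial (K : ℝ) (D : Polynomial ℝ) (v : Fin 5 → ℝ) :
    MvPolynomial.eval v (timePolynomial K D) =
      K * (1 + ∑ i, v i) ^ 29 * (2 + D.eval (v 3) ^ 2 + D.eval (v 2) ^ 2) := by
  have h : ∀ i, MvPolynomial.eval v (D.eval₂ MvPolynomial.C (MvPolynomial.X i)) = D.eval (v i) := by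
    intro i
    rw [Polynomial.hom_eval₂]
    have : (MvPolynomial.eval v).comp MvPolynomial.C = RingHom.id ℝ := by ext; simp
    rw [this, MvPolynomial.eval_X, Polynomial.eval₂_id]
  simp [timePolynomial, h]

end Hybrid

/-! ### The theorem -/

open Hybrid

theorem mainTheorem4 :
    ∃ P : Hybrid.Prog, ∀ c : ℝ, 0 < c → ∀ D : Polynomial ℝ, ∃ p : MvPolynomial (Fin 5) ℝ,
      ∀ S : Hybrid.FactorizedSystem, 0 < S.R → S.A₂.rank = S.R → S.DepthBound D →
        c ≤ max S.Γ (Hybrid.specNorm S.A₂) →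
        ∀ ε : ℝ, 0 < ε → ε ≤ 1 / c → ∀ k : ℕ, 0 < k →
          (∀ o ∈ (S.run P (S.input ε k)).support, (o.2 : ℝ) ≤
            k * ((S.R : ℝ) ^ 3 * S.Γ ^ 2 *
              MvPolynomial.eval ![Hybrid.condNumber S.A₁, Hybrid.condNumber S.A₂,
                Real.log S.M, Real.log S.N, S.normB] p / ε ^ 4)) ∧
          1 - (1 / 2 : ℝ) ^ k ≤ ((S.run P (S.input ε k)).toOuterMeasure
            {o | S.residual (S.combine (S.output o.1)) - ⨅ x, S.residual x ≤ ε}).toReal := by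
  refine ⟨mainProg, fun c hc D => ?_⟩
  obtain ⟨K, hK, htime⟩ := exists_mainTime_le hc
  refine ⟨timePolynomial (K * 4 * ((c ^ 2)⁻¹ + (c ^ 4)⁻¹)) D, ?_⟩
  intro S hR hrank hdepth hsize ε hε hεc k hk
  set x := D.eval (Real.log S.N) with hx
  set y := D.eval (Real.log S.M) with hy
  set z := 1 + (condNumber S.A₁ + condNumber S.A₂ + Real.log S.M + Real.log S.N + S.normB) with hz
  have hκ₁ : 0 ≤ condNumber S.A₁ := div_nonneg (specNorm_nonneg _) (minSingularValue_nonneg _)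
  have hκ₂ : 0 ≤ condNumber S.A₂ := div_nonneg (specNorm_nonneg _) (minSingularValue_nonneg _)
  have hM := Real.log_natCast_nonneg S.M
  have hN := Real.log_natCast_nonneg S.N
  have hB := S.normB_pos
  have hz1 : 1 ≤ z := by linarith
  set G := 3 * z * (2 + x ^ 2 + y ^ 2) with hG
  clear_value z G
  have hGx : 3 * z * (1 + x ^ 2) ≤ G := by
    rw [hG]
    exact mul_le_mul_of_nonneg_left (by linarith [sq_nonneg y]) (by linarith)
  have hGy : 3 * z * (1 + y ^ 2) ≤ G := by
    rw [hG]
    exact mul_le_mul_of_nonneg_left (by linarith [sq_nonneg x]) (by linarith)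
  have hG1 : (⌊G⌋₊ : ℝ) + 1 ≤ 4 * z * (2 + x ^ 2 + y ^ 2) := by
    have h3 : (⌊G⌋₊ : ℝ) ≤ 3 * (z * (2 + x ^ 2 + y ^ 2)) :=
      (Nat.floor_le (by rw [hG]; positivity)).trans (by rw [hG, mul_assoc])
    have h4 : 1 ≤ z * (2 + x ^ 2 + y ^ 2) :=
      one_le_mul_of_one_le_of_one_le hz1 (by linarith [sq_nonneg x, sq_nonneg y])
    rw [mul_assoc]
    linarith
  have hbound := bound_mainProg (k := k) (q := ⌊G⌋₊) hR hrank hε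
    (fun j => length_gates_le_of_depth _ (hdepth.1 j) hz1 (by linarith) hGx)
    (fun j => length_gates_le_of_depth _ (hdepth.2.1 j) hz1 (by linarith) hGy)
    (length_gates_le_of_depth _ hdepth.2.2 hz1 (by linarith) hGx)
  refine ⟨fun o ho => ?_, ?_⟩
  · have h1 : (o.2 : ℝ) ≤ mainTime S ε k ⌊G⌋₊ := by exact_mod_cast (hbound.always o ho).1
    have hf2 : ((√(1 / ε)) ^ 2)⁻¹ = ε := by
      rw [Real.sq_sqrt (by positivity), one_div, inv_inv]
    -- f = ε^(−1/2), and ε ≤ 1/c is the required lower bound √c ≤ f.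
    have h2 := htime S z (√(1 / ε)) k ⌊G⌋₊ hR hk
      (Real.sqrt_le_sqrt (by rw [le_one_div hc hε]; exact hεc)) hz1 (by linarith)
      (by linarith) (by linarith)
      ((Real.log_le_log (by exact_mod_cast hR) (Nat.cast_le.2 (R_le_M hrank))).trans
        (by linarith))
    rw [hf2] at h2
    have hf8 : √(1 / ε) ^ 8 = 1 / ε ^ 4 := by
      rw [show √(1 / ε) ^ 8 = (√(1 / ε) ^ 2) ^ 4 by ring, Real.sq_sqrt (by positivity), div_pow,
        one_pow]
    rw [hf8] at h2
    have hΓ := one_le_sq_Γ hc hR hrank hsize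
    have hκz : condNumber S.A₂ ≤ z := by linarith
    rw [eval_timePolynomial]
    have hv : (1 : ℝ) + ∑ i, ![condNumber S.A₁, condNumber S.A₂, Real.log S.M, Real.log S.N,
        S.normB] i = z := by
      rw [hz]; simp [Fin.sum_univ_five]
    rw [hv]
    calc (o.2 : ℝ) ≤ K * (k * S.R ^ 3 * z ^ 24 * (1 / ε ^ 4) * (⌊G⌋₊ + 1)) * 1 := by
          rw [mul_one]; exact h1.trans h2
      _ ≤ K * (k * S.R ^ 3 * z ^ 24 * (1 / ε ^ 4) * (4 * z * (2 + x ^ 2 + y ^ 2))) *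
          (((c ^ 2)⁻¹ + (c ^ 4)⁻¹) * (S.Γ ^ 2 * z ^ 4)) := by
          gcongr
          refine hΓ.trans ?_
          gcongr
      _ = k * (S.R ^ 3 * S.Γ ^ 2 * (K * 4 * ((c ^ 2)⁻¹ + (c ^ 4)⁻¹) * z ^ 29 *
          (2 + x ^ 2 + y ^ 2)) / ε ^ 4) := by ring
  · set s := {o : Store × ℕ | S.residual (S.combine (S.output o.1)) - ⨅ x, S.residual x ≤ ε}
    have h1 : (S.run mainProg (S.input ε k)).toOuterMeasure sᶜ ≤
        ENNReal.ofReal ((1 / 2 : ℝ) ^ k) := by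
      rw [toOuterMeasure_eq_expect]
      exact hbound.mean
    have h2 := toOuterMeasure_add_compl (S.run mainProg (S.input ε k)) s
    have h3 : (S.run mainProg (S.input ε k)).toOuterMeasure s ≠ ⊤ :=
      ne_top_of_le_ne_top ENNReal.one_ne_top (h2 ▸ le_self_add)
    have h4 : (S.run mainProg (S.input ε k)).toOuterMeasure sᶜ ≠ ⊤ :=
      ne_top_of_le_ne_top ENNReal.one_ne_top (h2 ▸ le_add_self)
    have h5 := congrArg ENNReal.toReal h2
    rw [ENNReal.toReal_add h3 h4, ENNReal.toReal_one] at h5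
    have h6 := ENNReal.toReal_mono ENNReal.ofReal_ne_top h1
    rw [ENNReal.toReal_ofReal (by positivity)] at h6
    linarith

end
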